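/- **Theorem 4.4.** Let $c\ge 1$, $0<\varepsilon\le 1$ and $0<\delta<\gamma<\frac14$. Let $\mathcal C$ be a class of geometric objects (each object occupies a region of a fixed space, and two distinct objects are adjacent in the intersection graph iff their regions meet), with the following oracles: (i) a dynamic data structure $\mathcal{DS}_0$ for objects in $\mathcal C$ that can detect whether some stored object intersects a query object, and supports insertions and deletions of objects, with $O(\tau_0(n))$ (possibly amortized) query and update time on instances that never store more than $n$ objects; (ii) a static algorithm $\mathcal A$ that, for any $n$ distinct objects in $\mathcal C$, computes a vertex cover of their intersection graph of size at most $c\,\mathrm{OPT}$ in $T(n)$ time, under the promise that $n\le (2+O(\gamma))\,\mathrm{OPT}$, where $\mathrm{OPT}$ is the minimum size of a vertex cover of that graph (nothing is assumed about $\mathcal A$ when the promise fails). Assume that $T\ge 0$, that $T(n)/n$ is monotonically increasing (in the weak sense) and that $T(2n)=O(T(n))$, both for $n\ge 1$. Then there is a dynamic data structure for sets of objects in $\mathcal C$, initially empty, which under insertions and deletions of objects explicitly maintains, after every update, a vertex cover of the intersection graph of the current set of size at most $c\,(1+O(\sqrt{\delta/\gamma}+\varepsilon))\,\mathrm{OPT}$,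 where $\mathrm{OPT}$ is the current minimum size. If the current set never has more than $n$ objects, its amortized update time is $$\widetilde O\!\left(\frac{\tau_0(n)}{\delta^2\varepsilon}+\frac{T(n)}{\varepsilon n}\right),$$ that is, any sequence of $m$ updates takes total time at most $m$ times this bound. Here $\widetilde O$ hides a factor $\log^{k}(n+2)$ with $k$ an absolute constant. The constant hidden in the approximation ratio depends only on the constant in the promise; the constant hidden in the time bound depends only on the constants hidden in the hypotheses (in the promise, in $O(\tau_0(n))$, and in $T(2n)=O(T(n))$); neither depends on $c,\varepsilon,\delta,\gamma,\mathcal C,\tau_0,T,n$. Time is measured on a random access machine with addition, subtraction and comparison of natural numbers at unit cost, which accesses objects only through handles and calls both oracles as black boxes, paying the time of the oracle for each call; every operation of $\mathcal{DS}_0$ takes at least one time unit. The program depends only on $c,\varepsilon,\delta,\gamma$ and the constants hidden in the hypotheses. -/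

import Mathlib

/-! ### Intersection graphs and minimum vertex covers -/

/-- The intersection graph of a set `S` of objects.  An object is an element of `α`, and it occupies
the region `shape x` of a space `P` (for instance `P` is `d`-dimensional Euclidean space).  Distinct
objects are adjacent when their regions meet. -/
def intersectionGraph {α P : Type*} (shape : α → Set P) (S : Set α) : SimpleGraph S where
  Adj u v := u ≠ v ∧ (shape u ∩ shape v).Nonempty
  symm := ⟨fun _ _ h => ⟨h.1.symm, by rw [Set.inter_comm]; exact h.2⟩⟩
  loopless := ⟨fun _ h => h.1 rfl⟩

/-- The minimum size of a vertex cover of the intersection graph of `S`; it is only used for finite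
`S`, where the extended natural number `vertexCoverNum` is finite. -/
noncomputable def minCover {α P : Type*} (shape : α → Set P) (S : Set α) : ℕ :=
  (intersectionGraph shape S).vertexCoverNum.toNat

/-! ### Oracle (i): dynamic intersection detection -/

/-- The operations of a dynamic intersection-detection structure. -/
inductive DetOp (α : Type*)
  | insert (x : α)
  | delete (x : α)
  | query (x : α)

/-- Histories of one instance of the structure are lists of operations, *latest first*; an instance
starts empty.  `DetOp.content` is the set of objects stored after a history. -/
noncomputable def DetOp.content {α : Type*} : List (DetOp α) → Finset α
  | [] => ∅
  | .insert x :: h => by classical exact Insert.insert x (DetOp.content h)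
  | .delete x :: h => by classical exact (DetOp.content h).erase x
  | .query _ :: h => DetOp.content h

/-- Only absent objects are inserted and only stored objects are deleted. -/
def DetOp.Legal {α : Type*} : List (DetOp α) → Prop
  | [] => True
  | .insert x :: h => x ∉ DetOp.content h ∧ DetOp.Legal h
  | .delete x :: h => x ∈ DetOp.content h ∧ DetOp.Legal h
  | .query _ :: h => DetOp.Legal h

/-- At no time during the history more than `n` objects are stored. -/
def DetOp.SizeLe {α : Type*} (n : ℕ) : List (DetOp α) → Prop
  | [] => True
  | o :: h => (DetOp.content (o :: h)).card ≤ n ∧ DetOp.SizeLe n h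

/-- The observable behaviour of a deterministic data structure for intersection detection:
`ans h x` is the answer to the query `x` after the history `h`, and `time h o` is the time taken
by the operation `o` after the history `h`. -/
structure Detector (α : Type*) where
  ans : List (DetOp α) → α → Bool
  time : List (DetOp α) → DetOp α → ℕ

/-- The total time of all operations of a history. -/
def Detector.totalTime {α : Type*} (D : Detector α) : List (DetOp α) → ℕ
  | [] => 0
  | o :: h => D.time h o + D.totalTime h

/-- `D` is a correct dynamic intersection-detection structure with `O(τ₀(n))` query and update time,
where `B` is the hidden constant: a query with `x` tells whether a stored object intersects `x`,
and operations on an instance that never stores more than `n` objects cost `B * τ₀ n` each,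
in the amortized sense (which includes the worst-case sense). An operation takes at least one unit
of time. -/
def Detector.Detects {α P : Type*} (D : Detector α) (shape : α → Set P) (B : ℝ) (τ₀ : ℕ → ℝ) :
    Prop :=
  (∀ h x, DetOp.Legal h →
    (D.ans h x = true ↔ ∃ y ∈ DetOp.content h, (shape x ∩ shape y).Nonempty)) ∧
  (∀ h o, 1 ≤ D.time h o) ∧
  (∀ n h, DetOp.Legal h → DetOp.SizeLe n h → (D.totalTime h : ℝ) ≤ B * τ₀ n * h.length)

/-! ### Oracle (ii): static approximation under a promise -/

/-- The observable behaviour of a deterministic static algorithm: for an input list of objects, it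
either does not terminate (`none`) or returns a set of objects after a number of time units. -/
abbrev StaticAlg (α : Type*) := List α → Option (Finset α × ℕ)

/-- `A` computes, for every list of `n` distinct objects with `n ≤ ρ * OPT`, a vertex cover of size
at most `c * OPT` of the intersection graph, in time `T n`.  Nothing is known about `A` on the other
inputs. -/
def StaticAlg.Approximates {α P : Type*} (A : StaticAlg α) (shape : α → Set P) (ρ c : ℝ)
    (T : ℕ → ℝ) : Prop :=
  ∀ L : List α, L.Nodup → (L.length : ℝ) ≤ ρ * minCover shape {x | x ∈ L} →
    ∃ X t, A L = some (X, t) ∧ (∀ x ∈ X, x ∈ L) ∧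
      (intersectionGraph shape {x | x ∈ L}).IsVertexCover {v | v.1 ∈ X} ∧
      (X.card : ℝ) ≤ c * minCover shape {x | x ∈ L} ∧ (t : ℝ) ≤ T L.length

/-! ### A random access machine with the two oracles -/

/-- Structured programs of a random access machine.  The machine has registers and arrays of unlimited
length, both holding natural numbers (a program names only finitely many of them), arithmetic is
restricted to addition and truncated subtraction, and arrays are indexed by register contents.  Objects cannot be inspected: the machine knows them through *handles*,
which are natural numbers, and it can pass handles to the oracles.  There is an unlimited supply
of initially empty instances of the detection structure, numbered by natural numbers. -/
inductive Prog
  /-- do nothing -/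
  | skip
  /-- `r := a` -/
  | const (r a : ℕ)
  /-- `r := s` -/
  | move (r s : ℕ)
  /-- `r := s + t` -/
  | add (r s t : ℕ)
  /-- `r := s - t`, truncated at zero -/
  | sub (r s t : ℕ)
  /-- `r := a[s]`, where `a` is the name of an array -/
  | load (r a s : ℕ)
  /-- `a[r] := s`, where `a` is the name of an array -/
  | store (a r s : ℕ)
  /-- insert the object with handle `h` into the detection instance number `i` -/
  | detInsert (i h : ℕ)
  /-- delete the object with handle `h` from the detection instance number `i` -/
  | detDelete (i h : ℕ)
  /-- `r := 1` if the instance number `i` answers yes to the object with handle `h`, else `0` -/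
  | detQuery (r i h : ℕ)
  /-- run the static algorithm on the objects with handles `a[0], …, a[l - 1]` and write
  the characteristic vector of the result into `b[0], …, b[l - 1]` -/
  | solve (a b l : ℕ)
  /-- sequential composition -/
  | seq (P Q : Prog)
  /-- `if r < s then P else Q` -/
  | ite (r s : ℕ) (P Q : Prog)
  /-- `while r < s do P` -/
  | while (r s : ℕ) (P : Prog)

/-- The state of the machine, including the histories of all instances of the detection structure. -/
structure Mach (α : Type*) where
  reg : ℕ → ℕ
  arr : ℕ → ℕ → ℕ
  hist : ℕ → List (DetOp α)

/-- Everything is zero, and all instances of the detection structure are empty. -/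
def Mach.init (α : Type*) : Mach α := ⟨fun _ => 0, fun _ _ => 0, fun _ => []⟩

/-- Assign a value to a register. -/
def Mach.setReg {α : Type*} (m : Mach α) (r a : ℕ) : Mach α :=
  { m with reg := Function.update m.reg r a }

/-- Record an operation on an instance of the detection structure. -/
def Mach.record {α : Type*} (m : Mach α) (i : ℕ) (o : DetOp α) : Mach α :=
  { m with hist := Function.update m.hist i (o :: m.hist i) }

open Classical in
/-- Write the characteristic vector of `X`, with respect to the first `l` handles in the array `a`,
into the first `l` cells of the array `b`. -/
noncomputable def Mach.writeBits {α : Type*} (tbl : ℕ → Option α) (m : Mach α) (a b l : ℕ)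
    (X : Finset α) : Mach α :=
  { m with arr := Function.update m.arr b (fun i =>
      if i < l then (if ∃ x ∈ X, tbl (m.arr a i) = some x then 1 else 0) else m.arr b i) }

/-- `Exec D A tbl P m m' t`: with oracles `D` and `A`, and with `tbl` telling which object a handle
stands for, the program `P` started in state `m` terminates in state `m'` after `t` time units.
Ordinary instructions and tests take one unit; an oracle call takes in addition the time of
the oracle, and, for the static algorithm, the time for passing input and output.
A run that never ends, calls an oracle with a handle that stands for no object, or calls
the static algorithm on an input on which it does not terminate, has no final state. -/
inductive Exec {α : Type*} (D : Detector α) (A : StaticAlg α) (tbl : ℕ → Option α) :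
    Prog → Mach α → Mach α → ℕ → Prop
  | skip (m) : Exec D A tbl .skip m m 1
  | const (m) (r a) : Exec D A tbl (.const r a) m (m.setReg r a) 1
  | move (m) (r s) : Exec D A tbl (.move r s) m (m.setReg r (m.reg s)) 1
  | add (m) (r s t) : Exec D A tbl (.add r s t) m (m.setReg r (m.reg s + m.reg t)) 1
  | sub (m) (r s t) : Exec D A tbl (.sub r s t) m (m.setReg r (m.reg s - m.reg t)) 1
  | load (m) (r a s) : Exec D A tbl (.load r a s) m (m.setReg r (m.arr a (m.reg s))) 1
  | store (m) (a r s) : Exec D A tbl (.store a r s) m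
      { m with arr := Function.update m.arr a (Function.update (m.arr a) (m.reg r) (m.reg s)) } 1
  | detInsert (m) (i h) (x : α) : tbl (m.reg h) = some x →
      Exec D A tbl (.detInsert i h) m (m.record (m.reg i) (.insert x))
        (1 + D.time (m.hist (m.reg i)) (.insert x))
  | detDelete (m) (i h) (x : α) : tbl (m.reg h) = some x →
      Exec D A tbl (.detDelete i h) m (m.record (m.reg i) (.delete x))
        (1 + D.time (m.hist (m.reg i)) (.delete x))
  | detQuery (m) (r i h) (x : α) : tbl (m.reg h) = some x →
      Exec D A tbl (.detQuery r i h) m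
        ((m.record (m.reg i) (.query x)).setReg r
          (if D.ans (m.hist (m.reg i)) x = true then 1 else 0))
        (1 + D.time (m.hist (m.reg i)) (.query x))
  | solve (m) (a b l) (L : List α) (X : Finset α) (t : ℕ) :
      L.map some = (List.range (m.reg l)).map (fun i => tbl (m.arr a i)) →
      A L = some (X, t) →
      Exec D A tbl (.solve a b l) m (m.writeBits tbl a b (m.reg l) X) (1 + m.reg l + t)
  | seq {P Q m₁ m₂ m₃ t₁ t₂} : Exec D A tbl P m₁ m₂ t₁ → Exec D A tbl Q m₂ m₃ t₂ →
      Exec D A tbl (.seq P Q) m₁ m₃ (t₁ + t₂)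
  | iteTrue {r s P Q m m' t} : m.reg r < m.reg s → Exec D A tbl P m m' t →
      Exec D A tbl (.ite r s P Q) m m' (1 + t)
  | iteFalse {r s P Q m m' t} : ¬ m.reg r < m.reg s → Exec D A tbl Q m m' t →
      Exec D A tbl (.ite r s P Q) m m' (1 + t)
  | whileFalse {r s P m} : ¬ m.reg r < m.reg s → Exec D A tbl (.while r s P) m m 1
  | whileTrue {r s P m₁ m₂ m₃ t₁ t₂} : m₁.reg r < m₁.reg s → Exec D A tbl P m₁ m₂ t₁ →
      Exec D A tbl (.while r s P) m₂ m₃ t₂ → Exec D A tbl (.while r s P) m₁ m₃ (1 + t₁ + t₂)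

/-! ### Dynamic data structures for vertex cover -/

/-- An update of the dynamic set of objects: insert the object `x`, which is given the handle `h`,
or delete the object with handle `h`. -/
inductive Update (α : Type*)
  | insert (h : ℕ) (x : α)
  | delete (h : ℕ)

/-- Update sequences are lists of updates, *latest first*, and the set of objects is initially empty.
`Update.table us h` is the object with handle `h` after the updates `us`, if there is one. -/
def Update.table {α : Type*} : List (Update α) → ℕ → Option α
  | [] => fun _ => none
  | .insert h x :: us => Function.update (Update.table us) h (some x)
  | .delete h :: us => Function.update (Update.table us) h none

/-- The set of objects that are present after the updates `us`. -/
def Update.objects {α : Type*} (us : List (Update α)) : Set α :=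
  {x | ∃ h, Update.table us h = some x}

/-- Only absent objects are inserted, under a handle that is not in use, and only handles that are in
use are deleted. -/
def Update.Legal {α : Type*} : List (Update α) → Prop
  | [] => True
  | .insert h x :: us => Update.table us h = none ∧ x ∉ Update.objects us ∧ Update.Legal us
  | .delete h :: us => Update.table us h ≠ none ∧ Update.Legal us

/-- At no time more than `n` objects are present. -/
def Update.SizeLe {α : Type*} (n : ℕ) : List (Update α) → Prop
  | [] => True
  | u :: us => (Update.objects (u :: us)).ncard ≤ n ∧ Update.SizeLe n us

/-- `Runs D A P us m t`: the program `P`, used as a dynamic data structure, is in state `m` after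
processing the updates `us`, and has spent `t` time units in total.  The program is run once for every
update.  Before, register `0` is set to `0` for an insertion and to `1` for a deletion, and register
`1` to the handle; the rest of the state persists.  While a deletion is processed, the handle
still stands for the object that is being deleted. -/
inductive Runs {α : Type*} (D : Detector α) (A : StaticAlg α) (P : Prog) :
    List (Update α) → Mach α → ℕ → Prop
  | nil : Runs D A P [] (Mach.init α) 0
  | insert {us m m' t t'} (h : ℕ) (x : α) : Runs D A P us m t →
      Exec D A (Update.table (.insert h x :: us)) P ((m.setReg 0 0).setReg 1 h) m' t' →
      Runs D A P (.insert h x :: us) m' (t + t')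
  | delete {us m m' t t'} (h : ℕ) : Runs D A P us m t →
      Exec D A (Update.table us) P ((m.setReg 0 1).setReg 1 h) m' t' →
      Runs D A P (.delete h :: us) m' (t + t')

/-- In state `m`, after the updates `us`, the array `0` holds an explicit list of handles of an
`r`-approximate minimum vertex cover of the intersection graph of the present objects; the length of
the list is in register `2`. -/
def HoldsCover {α P : Type*} (shape : α → Set P) (us : List (Update α)) (m : Mach α) (r : ℝ) : Prop :=
  (∀ i < m.reg 2, Update.table us (m.arr 0 i) ≠ none) ∧
  (intersectionGraph shape (Update.objects us)).IsVertexCover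
    {v | ∃ i < m.reg 2, Update.table us (m.arr 0 i) = some v.1} ∧
  (m.reg 2 : ℝ) ≤ r * minCover shape (Update.objects us)

/-! ### Vertex covers of graphs on handles -/

/-! The cover is rebuilt only now and then. Between rebuilds an inserted vertex joins the cover and
a deleted one leaves it. Every update moves the optimum by at most one (`vc_mono`, `vc_le_erase`)
and the size of the cover by at most one, and a rebuild is due once the updates since the last one
reach about an `ε / 12` fraction of the cover built then. So the ratio degrades only by a factor `1
+ O(ε)` (`ratio_le`). A rebuild costs time proportional to the current cover, not to the number of
objects, and is shared by about `ε` times that many updates (`Maintains.next`).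

A rebuild is a kernelization in the style of Nemhauser and Trotter, based on an approximate
fractional cover. In the bipartite double cover an auction with integer prices up to `L = 2 * R`
builds a matching `M`: an unmatched left copy takes one of its cheapest right neighbours, whose
price rises by one and whose former owner waits again; a left copy all of whose neighbours cost `L`
gives up. The final prices give values `z` (`dualVal`), on a scale where `4 * R` is one, that
satisfy every edge constraint (`Auction.edge`) and sum to `(2 * R + 1) * |M|` (`Auction.sum_dual`),
where `|M|` is at most twice the optimum (`Auction.card_matched_le`). Hence matching edges exceed
their constraint by very little in total, and unmatched copies carry very little value.

The values are rounded with a threshold `t < R`: vertices above `2 * R + t` are taken, those below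
`2 * R - t` dropped, and those in between, the middle part, are left to the static algorithm.
Averaging gives a threshold that few matching edges cross (`Rounding.exists_threshold`). For it, up
to an error `O(|M| / R)`, the high vertices number no more than what any cover spends outside the
middle part (`Rounding.card_high_le`), and the middle part has at most twice its vertex cover number
of vertices (`Rounding.card_mid_le`). Here `R` is of order `1 / δ` and `q` of order `γ / δ`. If the
middle part has more than `|M| / q` vertices, the error is `O(γ)` relative to it and the promise of
the static algorithm holds (`promise_of_mass`). Otherwise the whole middle part is taken, at a cost
of `O(δ / γ)` times the optimum.

The auction never lists edges. For each price, and for the vertices not touched so far, a binary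
heap of detection instances finds a neighbour with `O(log n)` queries (`wp_setFind`). The auction
starts from the old cover `C` and touches further vertices only when they become relevant; each
price raise pays for at most two of them. Prices sum to at most `2 * |C| * L`, so there are `O(|C| *
L)` rounds with `O(L)` searches each (`wp_runAuction`), whence the factor `1 / δ ^ 2`.

All this is carried out for a concrete program with weakest preconditions over states that store
handles instead of objects; `wp_sound` transfers the result to the machine. -/

/-- `D` is a vertex cover of the graph that `adj` induces on `S`. -/
def IsCov (adj : ℕ → ℕ → Prop) (S D : Finset ℕ) : Prop :=
  D ⊆ S ∧ ∀ u ∈ S, ∀ v ∈ S, adj u v → u ∈ D ∨ v ∈ D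

/-- The minimum size of a vertex cover of the graph that `adj` induces on `S`. -/
noncomputable def vc (adj : ℕ → ℕ → Prop) (S : Finset ℕ) : ℕ :=
  sInf {n | ∃ D, IsCov adj S D ∧ D.card = n}

section vc
variable {adj : ℕ → ℕ → Prop}

theorem exists_vc (S : Finset ℕ) : ∃ D, IsCov adj S D ∧ D.card = vc adj S := by
  have : {n | ∃ D, IsCov adj S D ∧ D.card = n}.Nonempty :=
    ⟨S.card, S, ⟨subset_rfl, fun u hu _ _ _ => Or.inl hu⟩, rfl⟩
  exact Nat.sInf_mem this

theorem IsCov.vc_le {S D : Finset ℕ} (h : IsCov adj S D) : vc adj S ≤ D.card :=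
  Nat.sInf_le ⟨D, h, rfl⟩

theorem IsCov.inter {S D S' : Finset ℕ} (h : IsCov adj S D) (hS : S' ⊆ S) :
    IsCov adj S' (D ∩ S') := by
  refine ⟨Finset.inter_subset_right, fun u hu v hv huv => ?_⟩
  rcases h.2 u (hS hu) v (hS hv) huv with h | h
  · exact Or.inl (Finset.mem_inter.2 ⟨h, hu⟩)
  · exact Or.inr (Finset.mem_inter.2 ⟨h, hv⟩)

theorem vc_mono {S S' : Finset ℕ} (hS : S' ⊆ S) : vc adj S' ≤ vc adj S := by
  obtain ⟨D, hD, hc⟩ := exists_vc (adj := adj) S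
  exact (hD.inter hS).vc_le.trans (hc ▸ Finset.card_le_card Finset.inter_subset_left)

/-- A cover of the rest becomes a cover of `S` by adding `x`. With `vc_mono`, an update moves the
optimum by at most one, so the optimum at the last rebuild stays comparable with the current one. -/
theorem vc_le_erase (S : Finset ℕ) (x : ℕ) : vc adj S ≤ vc adj (S.erase x) + 1 := by
  obtain ⟨D, hD, hc⟩ := exists_vc (adj := adj) (S.erase x)
  by_cases hx : x ∈ S
  · have : IsCov adj S (insert x D) := by
      refine ⟨?_, fun u hu v hv huv => ?_⟩
      · intro y hy
        rcases Finset.mem_insert.1 hy with rfl | hy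
        · exact hx
        · exact Finset.mem_of_mem_erase (hD.1 hy)
      · by_cases h1 : u = x
        · simp [h1]
        by_cases h2 : v = x
        · simp [h2]
        rcases hD.2 u (Finset.mem_erase.2 ⟨h1, hu⟩) v (Finset.mem_erase.2 ⟨h2, hv⟩) huv with h | h
        · simp [h]
        · simp [h]
    exact this.vc_le.trans ((Finset.card_insert_le _ _).trans (by omega))
  · rw [Finset.erase_eq_of_notMem hx]; omega

end vc

/-! ### Matchings and prices in the bipartite double cover -/

/-- `mt` is a matching of left copies to right copies of vertices (`mt l = r + 1` when `l` is matched
to `r`, and `mt l = 0` when `l` is unmatched), `ow` is its inverse, and `p` are prices of the right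
copies up to `L`, such that every matched left vertex got one of the cheapest neighbours, up to one
unit.  All vertices outside `V` are untouched. -/
structure Auction (adj : ℕ → ℕ → Prop) (S V : Finset ℕ) (L : ℕ) (p ow mt : ℕ → ℕ) : Prop where
  inv : ∀ l r, mt l = r + 1 ↔ ow r = l + 1
  priced : ∀ r, ow r = 0 ↔ p r = 0
  le : ∀ r, p r ≤ L
  nbr : ∀ l r, mt l = r + 1 → adj l r
  cheap : ∀ l r, mt l = r + 1 → ∀ r' ∈ S, adj l r' → p r ≤ p r' + 1
  out : ∀ v, v ∉ V → p v = 0 ∧ mt v = 0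
  sub : V ⊆ S

/-- The fractional vertex cover, scaled by `2 * L`, that belongs to the prices. -/
def dualVal (L : ℕ) (p mt : ℕ → ℕ) (v : ℕ) : ℕ :=
  (if mt v = 0 then 0 else L + 1 - p (mt v - 1)) + p v

/-- The matched left vertices. -/
def matched (V : Finset ℕ) (mt : ℕ → ℕ) : Finset ℕ := V.filter fun v => mt v ≠ 0

/-- The matched left vertices whose matching edge has both ends above `L - t` and some end above `L + t`. -/
def crossing (V : Finset ℕ) (mt z : ℕ → ℕ) (L t : ℕ) : Finset ℕ :=
  (matched V mt).filter fun l =>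
    L - t ≤ z l ∧ L - t ≤ z (mt l - 1) ∧ (L + t < z l ∨ L + t < z (mt l - 1))

namespace Auction
variable {adj : ℕ → ℕ → Prop} {S V : Finset ℕ} {L : ℕ} {p ow mt : ℕ → ℕ}

theorem ow_out (h : Auction adj S V L p ow mt) {v : ℕ} (hv : v ∉ V) : ow v = 0 :=
  (h.priced v).2 (h.out v hv).1

theorem mem_of_mt (h : Auction adj S V L p ow mt) {v : ℕ} (hv : mt v ≠ 0) : v ∈ V := by
  by_contra hV; exact hv (h.out v hV).2

theorem mem_of_ow (h : Auction adj S V L p ow mt) {v : ℕ} (hv : ow v ≠ 0) : v ∈ V := by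
  by_contra hV; exact hv (h.ow_out hV)

/-- A right copy is free of charge exactly as long as nobody owns it. Hence the left half of
`dualVal` is at most `L`, not `L + 1`, which `Rounding.card_high_le` needs. -/
theorem pos_of_mt (h : Auction adj S V L p ow mt) {l r : ℕ} (hl : mt l = r + 1) : 1 ≤ p r := by
  have := (h.inv l r).1 hl
  have h2 := h.priced r
  by_contra h3
  have : ow r = 0 := h2.2 (by omega)
  omega

/-- Sums over matched right vertices are sums over matching edges. -/
theorem sum_right (h : Auction adj S V L p ow mt) (f : ℕ → ℕ) :
    ∑ l ∈ matched V mt, f (mt l - 1) = ∑ r ∈ V.filter (fun r => ow r ≠ 0), f r := by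
  refine Finset.sum_bij (fun l _ => mt l - 1) ?_ ?_ ?_ ?_
  · intro l hl
    simp only [matched, Finset.mem_filter] at hl
    have := (h.inv l (mt l - 1)).1 (by omega)
    have h3 : ow (mt l - 1) ≠ 0 := by omega
    exact Finset.mem_filter.2 ⟨h.mem_of_ow h3, h3⟩
  · intro a ha b hb hab
    simp only [matched, Finset.mem_filter] at ha hb
    have h1 := (h.inv a (mt a - 1)).1 (by omega)
    have h2 := (h.inv b (mt b - 1)).1 (by omega)
    rw [hab] at h1; omega
  · intro r hr
    simp only [Finset.mem_filter] at hr
    have h1 := (h.inv (ow r - 1) r).2 (by omega)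
    have h3 : mt (ow r - 1) ≠ 0 := by omega
    exact ⟨ow r - 1, Finset.mem_filter.2 ⟨h.mem_of_mt h3, h3⟩, by simp [h1]⟩
  · intros; rfl

theorem sum_price (h : Auction adj S V L p ow mt) :
    ∑ v ∈ V, p v = ∑ l ∈ matched V mt, p (mt l - 1) := by
  rw [h.sum_right, Finset.sum_filter_of_ne]
  intro r _ hr h0
  exact hr ((h.priced r).1 h0)

/-- Every matching edge splits `L + 1` between its left end, which gets `L + 1 - p`, and its right
end, which gets `p`; unmatched copies get nothing. The truncated subtraction is exact because prices
are at most `L`. -/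
theorem sum_dual (h : Auction adj S V L p ow mt) :
    ∑ v ∈ V, dualVal L p mt v = (L + 1) * (matched V mt).card := by
  have h1 : ∑ v ∈ V, (if mt v = 0 then 0 else L + 1 - p (mt v - 1)) =
      ∑ l ∈ matched V mt, (L + 1 - p (mt l - 1)) := by
    rw [matched, Finset.sum_filter]
    refine Finset.sum_congr rfl fun v _ => ?_
    by_cases hv : mt v = 0 <;> simp [hv]
  unfold dualVal
  rw [Finset.sum_add_distrib, h1, h.sum_price, ← Finset.sum_add_distrib,
    Finset.sum_congr rfl (g := fun _ => L + 1), Finset.sum_const, smul_eq_mul, mul_comm]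
  intro l _
  have := h.le (mt l - 1)
  omega

/-- A matching edge joins copies of two adjacent vertices, one of which lies in `D`. A vertex of `D`
has two copies, each on at most one matching edge. -/
theorem card_matched_le (h : Auction adj S V L p ow mt) {D : Finset ℕ} (hD : IsCov adj S D) :
    (matched V mt).card ≤ 2 * D.card := by
  have h1 : (matched V mt).card ≤ ∑ l ∈ matched V mt,
      ((if l ∈ D then 1 else 0) + (if mt l - 1 ∈ D then 1 else 0)) := by
    rw [Finset.card_eq_sum_ones]
    refine Finset.sum_le_sum fun l hl => ?_
    simp only [matched, Finset.mem_filter] at hl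
    have hm : mt l = (mt l - 1) + 1 := by omega
    have hr := h.mem_of_ow (v := mt l - 1) (by have := (h.inv _ _).1 hm; omega)
    rcases hD.2 l (h.sub hl.1) (mt l - 1) (h.sub hr) (h.nbr _ _ hm) with h | h <;> simp [h]
  have h2 : ∀ A : Finset ℕ, ∑ l ∈ A, (if l ∈ D then 1 else 0) ≤ D.card := by
    intro A
    rw [← Finset.card_filter]
    exact Finset.card_le_card fun x hx => (Finset.mem_filter.1 hx).2
  rw [Finset.sum_add_distrib, h.sum_right (fun r => if r ∈ D then 1 else 0)] at h1
  have := h2 (matched V mt)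
  have := h2 (V.filter (fun r => ow r ≠ 0))
  omega

/-- Only owned right copies have a price. This bounds the number of price raises, and with it the
length of the auction. -/
theorem sum_price_le (h : Auction adj S V L p ow mt) {D : Finset ℕ} (hD : IsCov adj S D) :
    ∑ v ∈ V, p v ≤ 2 * D.card * L := by
  rw [h.sum_price]
  refine (Finset.sum_le_card_nsmul _ _ L fun l _ => h.le _).trans ?_
  rw [smul_eq_mul]
  exact Nat.mul_le_mul_right _ (h.card_matched_le hD)

/-- The auction is over: unmatched vertices have only neighbours of maximal price. -/
theorem edge (h : Auction adj S V L p ow mt)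
    (done : ∀ l ∈ S, mt l = 0 → ∀ r ∈ S, adj l r → L ≤ p r)
    {u v : ℕ} (hu : u ∈ S) (hv : v ∈ S) (huv : adj u v) (hvu : adj v u) :
    2 * L ≤ dualVal L p mt u + dualVal L p mt v := by
  -- One edge of the double cover, from the left copy of `u` to the right copy of `v`: the partner
  -- of `u` costs at most one more than `v`, and the `+ 1` in `L + 1` makes up for this unit. The
  -- claim adds both orientations.
  have key : ∀ u ∈ S, ∀ v ∈ S, adj u v →
      L ≤ (if mt u = 0 then 0 else L + 1 - p (mt u - 1)) + p v := by
    intro u hu v hv huv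
    by_cases hm : mt u = 0
    · simpa [hm] using done u hu hm v hv huv
    · have h1 := h.cheap u (mt u - 1) (by omega) v hv huv
      have h2 := h.le (mt u - 1)
      simp only [hm, if_false]; omega
  have h1 := key u hu v hv huv
  have h2 := key v hv u hu hvu
  unfold dualVal
  omega

end Auction

/-! ### Rounding the fractional cover with a threshold -/

/-- The properties of a finished auction, with a threshold `t`, that the rounding uses. -/
structure Rounding (adj : ℕ → ℕ → Prop) (S V : Finset ℕ) (R t : ℕ) (p ow mt z : ℕ → ℕ) : Prop where
  auc : Auction adj S V (2 * R) p ow mt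
  symm : ∀ u v, adj u v → adj v u
  done : ∀ l ∈ S, mt l = 0 → ∀ r ∈ S, adj l r → 2 * R ≤ p r
  dual : ∀ v, z v = dualVal (2 * R) p mt v
  lt : t < R

namespace Rounding
variable {adj : ℕ → ℕ → Prop} {S V : Finset ℕ} {R t : ℕ} {p ow mt z : ℕ → ℕ}

theorem edge (h : Rounding adj S V R t p ow mt z) {u v : ℕ} (hu : u ∈ S) (hv : v ∈ S)
    (huv : adj u v) : 4 * R ≤ z u + z v := by
  have := h.auc.edge h.done hu hv huv (h.symm _ _ huv)
  rw [h.dual, h.dual]; omega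

theorem partner (h : Rounding adj S V R t p ow mt z) {l : ℕ} (hl : l ∈ matched V mt) :
    l ∈ V ∧ mt l - 1 ∈ V ∧ adj l (mt l - 1) ∧ 4 * R ≤ z l + z (mt l - 1) := by
  simp only [matched, Finset.mem_filter] at hl
  have hm : mt l = (mt l - 1) + 1 := by omega
  have hr := h.auc.mem_of_ow (v := mt l - 1) (by have := (h.auc.inv _ _).1 hm; omega)
  exact ⟨hl.1, hr, h.auc.nbr _ _ hm,
    h.edge (h.auc.sub hl.1) (h.auc.sub hr) (h.auc.nbr _ _ hm)⟩

theorem sum_dual (h : Rounding adj S V R t p ow mt z) :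
    ∑ v ∈ V, z v = (2 * R + 1) * (matched V mt).card := by
  rw [← h.auc.sum_dual]
  exact Finset.sum_congr rfl fun v _ => h.dual v

theorem mem_of_pos (h : Rounding adj S V R t p ow mt z) {v : ℕ} (hv : 0 < z v) : v ∈ V := by
  by_contra hV
  have := h.auc.out v hV
  rw [h.dual, dualVal, this.1, this.2] at hv
  simp at hv

/-- Excess of the matching edges, and deficits of the unmatched copies. -/
theorem excess (h : Rounding adj S V R t p ow mt z) :
    ∑ l ∈ matched V mt, (z l + z (mt l - 1)) + ∑ v ∈ V.filter (fun v => mt v = 0), z v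
      + ∑ v ∈ V.filter (fun v => ow v = 0), z v = (4 * R + 2) * (matched V mt).card := by
  have h1 := Finset.sum_filter_add_sum_filter_not V (fun v => mt v = 0) z
  have h2 := Finset.sum_filter_add_sum_filter_not V (fun v => ow v = 0) z
  rw [Finset.sum_add_distrib, h.auc.sum_right z]
  have h3 := h.sum_dual
  have h4 : ∑ l ∈ matched V mt, z l = ∑ v ∈ V.filter (fun v => ¬ mt v = 0), z v := rfl
  have h5 : (4 * R + 2) * (matched V mt).card = 2 * ((2 * R + 1) * (matched V mt).card) := by ring
  rw [h5, ← h3, h4]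
  simp only [ne_eq] at *
  omega

/-- In `excess` each matching edge weighs at least `4 * R`, so the unmatched copies share what `4 *
R + 2` leaves over. -/
theorem deficit (h : Rounding adj S V R t p ow mt z) :
    ∑ v ∈ V.filter (fun v => mt v = 0), z v + ∑ v ∈ V.filter (fun v => ow v = 0), z v
      ≤ 2 * (matched V mt).card := by
  have h1 := h.excess
  have h2 : ∑ _l ∈ matched V mt, 4 * R ≤ ∑ l ∈ matched V mt, (z l + z (mt l - 1)) :=
    Finset.sum_le_sum fun l hl => (h.partner hl).2.2.2
  rw [Finset.sum_const, smul_eq_mul] at h2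
  have h5 : (4 * R + 2) * (matched V mt).card =
      (matched V mt).card * (4 * R) + 2 * (matched V mt).card := by ring
  omega

/-- Exchange the summations. A matching edge with end values `x ≤ y` is crossing only for `2 * R - x
≤ s < y - 2 * R`, hence for at most `x + y - 4 * R` thresholds, which is its surplus over the edge
constraint. By `excess` all surpluses add up to at most `2 * |M|`. -/
theorem sum_crossing (h : Rounding adj S V R t p ow mt z) :
    ∑ s ∈ Finset.range R, (crossing V mt z (2 * R) s).card ≤ 2 * (matched V mt).card := by
  have h1 := h.excess
  have h2 : ∑ s ∈ Finset.range R, (crossing V mt z (2 * R) s).card + 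
      (matched V mt).card * (4 * R) ≤ ∑ l ∈ matched V mt, (z l + z (mt l - 1)) := by
    simp only [crossing, Finset.card_filter]
    rw [Finset.sum_comm, ← smul_eq_mul (matched V mt).card, ← Finset.sum_const,
      ← Finset.sum_add_distrib]
    refine Finset.sum_le_sum fun l hl => ?_
    have hp := (h.partner hl).2.2.2
    rw [← Finset.card_filter]
    have : (Finset.range R).filter (fun s => 2 * R - s ≤ z l ∧ 2 * R - s ≤ z (mt l - 1) ∧
        (2 * R + s < z l ∨ 2 * R + s < z (mt l - 1))) ⊆
        Finset.Ico (2 * R - min (z l) (z (mt l - 1))) (max (z l) (z (mt l - 1)) - 2 * R) := by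
      intro s hs
      simp only [Finset.mem_filter, Finset.mem_range, Finset.mem_Ico] at hs ⊢
      omega
    have := Finset.card_le_card this
    rw [Nat.card_Ico] at this
    omega
  have h5 : (4 * R + 2) * (matched V mt).card =
      (matched V mt).card * (4 * R) + 2 * (matched V mt).card := by ring
  omega

/-- Averaging of `sum_crossing` over the `R` thresholds. -/
theorem exists_threshold (h : Rounding adj S V R t p ow mt z) :
    ∃ s < R, (crossing V mt z (2 * R) s).card * R ≤ 2 * (matched V mt).card := by
  by_contra hcon
  push Not at hcon
  have h1 := h.sum_crossing
  have hR : 0 < R := lt_of_le_of_lt (Nat.zero_le _) h.lt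
  have h2 : ∑ s ∈ Finset.range R, 2 * (matched V mt).card <
      ∑ s ∈ Finset.range R, (crossing V mt z (2 * R) s).card * R :=
    Finset.sum_lt_sum_of_nonempty ⟨0, Finset.mem_range.2 hR⟩ fun s hs =>
      hcon s (Finset.mem_range.1 hs)
  rw [Finset.sum_const, ← Finset.sum_mul, smul_eq_mul, Finset.card_range] at h2
  have := Nat.mul_le_mul_right R h1
  rw [mul_comm R] at h2
  omega

/-- The vertices of value about one half. -/
def mid (V : Finset ℕ) (z : ℕ → ℕ) (R t : ℕ) : Finset ℕ :=
  V.filter fun v => 2 * R - t ≤ z v ∧ z v ≤ 2 * R + t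

/-- The vertices of value well above one half. -/
def high (V : Finset ℕ) (z : ℕ → ℕ) (R t : ℕ) : Finset ℕ := V.filter fun v => 2 * R + t < z v

/-- Count both copies of every vertex of the middle part. An unmatched copy carries a value of at
least `R`, and `deficit` bounds the total of these values. A matching edge inside the middle part
meets `D`, and one with a single end there is crossing. Halving the count gives the bound. -/
theorem card_mid_le (h : Rounding adj S V R t p ow mt z)
    (hc : (crossing V mt z (2 * R) t).card * R ≤ 2 * (matched V mt).card)
    {D : Finset ℕ} (hD : IsCov adj (mid V z R t) D) :
    (mid V z R t).card * R ≤ 2 * D.card * R + 2 * (matched V mt).card := by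
  set W := mid V z R t with hW
  have hWV : ∀ v ∈ W, v ∈ V ∧ 2 * R - t ≤ z v ∧ z v ≤ 2 * R + t := by
    intro v hv; simpa [hW, mid] using hv
  have ht := h.lt
  -- unmatched copies
  have un : ∀ q : ℕ → ℕ, (W.filter (fun v => q v = 0)).card * R ≤
      ∑ v ∈ V.filter (fun v => q v = 0), z v := by
    intro q
    calc (W.filter (fun v => q v = 0)).card * R ≤ ∑ v ∈ W.filter (fun v => q v = 0), z v := by
          rw [← smul_eq_mul]
          refine Finset.card_nsmul_le_sum _ _ _ fun v hv => ?_
          have := hWV v (Finset.mem_filter.1 hv).1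
          omega
      _ ≤ _ := by
          refine Finset.sum_le_sum_of_subset fun v hv => ?_
          rw [Finset.mem_filter] at hv ⊢
          exact ⟨(hWV v hv.1).1, hv.2⟩
  have u1 := un mt
  have u2 := un ow
  have hd := h.deficit
  -- matched copies
  have cD : ∀ A : Finset ℕ, ∑ l ∈ A, (if l ∈ D then 1 else 0) ≤ D.card := by
    intro A
    rw [← Finset.card_filter]
    exact Finset.card_le_card fun x hx => (Finset.mem_filter.1 hx).2
  have mm : (W.filter (fun v => mt v ≠ 0)).card + (W.filter (fun v => ow v ≠ 0)).card ≤
      4 * D.card + (crossing V mt z (2 * R) t).card := by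
    have e1 : (W.filter (fun v => mt v ≠ 0)).card =
        ∑ l ∈ matched V mt, (if l ∈ W then 1 else 0) := by
      rw [← Finset.card_filter]
      congr 1
      ext v
      simp only [matched, Finset.mem_filter]
      exact ⟨fun hv => ⟨⟨(hWV v hv.1).1, hv.2⟩, hv.1⟩, fun hv => ⟨hv.2, hv.1.2⟩⟩
    have e2 : (W.filter (fun v => ow v ≠ 0)).card =
        ∑ l ∈ matched V mt, (if mt l - 1 ∈ W then 1 else 0) := by
      rw [h.auc.sum_right (fun r => if r ∈ W then 1 else 0), ← Finset.card_filter]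
      congr 1
      ext v
      simp only [Finset.mem_filter]
      exact ⟨fun hv => ⟨⟨(hWV v hv.1).1, hv.2⟩, hv.1⟩, fun hv => ⟨hv.2, hv.1.2⟩⟩
    -- If just one end is in the middle part, the edge constraint puts the other at `2 * R - t` or
    -- more, so that end must lie above `2 * R + t`.
    have e3 : ∑ l ∈ matched V mt, ((if l ∈ W then 1 else 0) + (if mt l - 1 ∈ W then 1 else 0)) ≤
        ∑ l ∈ matched V mt, (2 * ((if l ∈ D then 1 else 0) + (if mt l - 1 ∈ D then 1 else 0)) +
          (if 2 * R - t ≤ z l ∧ 2 * R - t ≤ z (mt l - 1) ∧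
            (2 * R + t < z l ∨ 2 * R + t < z (mt l - 1)) then 1 else 0)) := by
      refine Finset.sum_le_sum fun l hl => ?_
      obtain ⟨p1, p2, p3, p4⟩ := h.partner hl
      by_cases a : l ∈ W <;> by_cases b : mt l - 1 ∈ W
      · rcases hD.2 _ a _ b p3 with c | c <;> simp only [a, b, c, if_true] <;> split_ifs <;> omega
      · have ha := hWV _ a
        have hb : ¬ (2 * R - t ≤ z (mt l - 1) ∧ z (mt l - 1) ≤ 2 * R + t) := fun hb =>
          b (by simp only [hW, mid, Finset.mem_filter]; exact ⟨p2, hb⟩)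
        rw [if_pos (show 2 * R - t ≤ z l ∧ 2 * R - t ≤ z (mt l - 1) ∧
            (2 * R + t < z l ∨ 2 * R + t < z (mt l - 1)) by omega)]
        simp only [a, b, if_true, if_false]; omega
      · have ha := hWV _ b
        have hb : ¬ (2 * R - t ≤ z l ∧ z l ≤ 2 * R + t) := fun hb =>
          a (by simp only [hW, mid, Finset.mem_filter]; exact ⟨p1, hb⟩)
        rw [if_pos (show 2 * R - t ≤ z l ∧ 2 * R - t ≤ z (mt l - 1) ∧
            (2 * R + t < z l ∨ 2 * R + t < z (mt l - 1)) by omega)]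
        simp only [a, b, if_true, if_false]; omega
      · simp only [a, b, if_false]; omega
    rw [e1, e2, ← Finset.sum_add_distrib]
    refine e3.trans ?_
    rw [Finset.sum_add_distrib, ← Finset.mul_sum, Finset.sum_add_distrib,
      h.auc.sum_right (fun r => if r ∈ D then 1 else 0)]
    have := cD (matched V mt)
    have := cD (V.filter (fun r => ow r ≠ 0))
    have e : ∑ l ∈ matched V mt, (if 2 * R - t ≤ z l ∧ 2 * R - t ≤ z (mt l - 1) ∧
        (2 * R + t < z l ∨ 2 * R + t < z (mt l - 1)) then 1 else 0) =
        (crossing V mt z (2 * R) t).card := (Finset.card_filter _ _).symm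
    omega
  have s1 := Finset.card_filter_add_card_filter_not (s := W) (fun v => mt v = 0)
  have s2 := Finset.card_filter_add_card_filter_not (s := W) (fun v => ow v = 0)
  simp only [ne_eq] at mm
  have mm' := Nat.mul_le_mul_right R mm
  have t1 : W.card * R + W.card * R = ((W.filter (fun v => mt v = 0)).card +
    (W.filter (fun v => ¬ mt v = 0)).card) * R + ((W.filter (fun v => ow v = 0)).card +
    (W.filter (fun v => ¬ ow v = 0)).card) * R := by rw [s1, s2]
  simp only [add_mul] at mm' t1
  have t2 : 4 * D.card * R = 2 * (2 * D.card * R) := by ring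
  omega

/-- An exchange argument: the matching partner of a high vertex outside `D` lies in `D`, and unless
the edge is crossing the partner is a low vertex, an element of `O`. Counting both copies, each
missing high vertex is paid for by low vertices of `D` or by crossing edges. The low and the high
vertices of `D` are disjoint and outside the middle part. -/
theorem card_high_le (h : Rounding adj S V R t p ow mt z)
    (hc : (crossing V mt z (2 * R) t).card * R ≤ 2 * (matched V mt).card)
    {D : Finset ℕ} (hD : IsCov adj S D) :
    (high V z R t).card * R ≤ (D \ mid V z R t).card * R + (matched V mt).card := by
  set F := high V z R t with hF
  have hFV : ∀ v, v ∈ F ↔ v ∈ V ∧ 2 * R + t < z v := by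
    intro v; simp [hF, high]
  set O := D.filter (fun v => z v < 2 * R - t) with hO
  -- Each half of the dual value is at most `2 * R`, the left one because a partner costs at least
  -- one. So a high vertex needs both halves, and both of its copies are matched.
  have both : ∀ v ∈ F, mt v ≠ 0 ∧ ow v ≠ 0 := by
    intro v hv
    have h1 := ((hFV v).1 hv).2
    rw [h.dual, dualVal] at h1
    have h2 := h.auc.le v
    constructor
    · intro h0; rw [if_pos h0] at h1; omega
    · intro h0
      have h3 := (h.auc.priced v).1 h0
      by_cases h4 : mt v = 0
      · rw [if_pos h4] at h1; omega
      · have := h.auc.pos_of_mt (l := v) (r := mt v - 1) (by omega)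
        rw [if_neg h4] at h1; omega
  have e1 : (F \ D).card = ∑ l ∈ matched V mt, (if l ∈ F \ D then 1 else 0) := by
    rw [← Finset.card_filter]
    congr 1
    ext v
    simp only [matched, Finset.mem_filter]
    constructor
    · intro hv
      have hv' := (Finset.mem_sdiff.1 hv).1
      exact ⟨⟨((hFV v).1 hv').1, (both v hv').1⟩, hv⟩
    · exact fun hv => hv.2
  have e2 : (F \ D).card = ∑ l ∈ matched V mt, (if mt l - 1 ∈ F \ D then 1 else 0) := by
    rw [h.auc.sum_right (fun r => if r ∈ F \ D then 1 else 0), ← Finset.card_filter]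
    congr 1
    ext v
    simp only [Finset.mem_filter]
    constructor
    · intro hv
      have hv' := (Finset.mem_sdiff.1 hv).1
      exact ⟨⟨((hFV v).1 hv').1, (both v hv').2⟩, hv⟩
    · exact fun hv => hv.2
  have e3 : ∑ l ∈ matched V mt, ((if l ∈ F \ D then 1 else 0) + (if mt l - 1 ∈ F \ D then 1 else 0))
      ≤ ∑ l ∈ matched V mt, ((if l ∈ O then 1 else 0) + (if mt l - 1 ∈ O then 1 else 0) +
          (if 2 * R - t ≤ z l ∧ 2 * R - t ≤ z (mt l - 1) ∧
            (2 * R + t < z l ∨ 2 * R + t < z (mt l - 1)) then 1 else 0)) := by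
    refine Finset.sum_le_sum fun l hl => ?_
    obtain ⟨p1, p2, p3, p4⟩ := h.partner hl
    have hcov := hD.2 _ (h.auc.sub p1) _ (h.auc.sub p2) p3
    simp only [Finset.mem_sdiff, hFV, hO, Finset.mem_filter]
    by_cases a : l ∈ D <;> by_cases b : mt l - 1 ∈ D
    · simp [a, b]
    · simp only [a, b, p1, p2]
      split_ifs <;> simp at * <;> omega
    · simp only [a, b, p1, p2]
      split_ifs <;> simp at * <;> omega
    · tauto
  have cO : ∀ A : Finset ℕ, ∑ l ∈ A, (if l ∈ O then 1 else 0) ≤ O.card := by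
    intro A
    rw [← Finset.card_filter]
    exact Finset.card_le_card fun x hx => (Finset.mem_filter.1 hx).2
  rw [Finset.sum_add_distrib, ← e1, ← e2, Finset.sum_add_distrib, Finset.sum_add_distrib,
    h.auc.sum_right (fun r => if r ∈ O then 1 else 0)] at e3
  have e : ∑ l ∈ matched V mt, (if 2 * R - t ≤ z l ∧ 2 * R - t ≤ z (mt l - 1) ∧
        (2 * R + t < z l ∨ 2 * R + t < z (mt l - 1)) then 1 else 0) =
        (crossing V mt z (2 * R) t).card := (Finset.card_filter _ _).symm
  have c1 := cO (matched V mt)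
  have c2 := cO (V.filter (fun r => ow r ≠ 0))
  have e4 : 2 * (F \ D).card ≤ 2 * O.card + (crossing V mt z (2 * R) t).card := by omega
  have e5 : (F ∩ D).card + O.card ≤ (D \ mid V z R t).card := by
    rw [← Finset.card_union_of_disjoint]
    · refine Finset.card_le_card fun v hv => ?_
      simp only [Finset.mem_union, Finset.mem_inter, hFV, hO, Finset.mem_filter, Finset.mem_sdiff,
        mid] at hv ⊢
      rcases hv with hv | hv
      · exact ⟨hv.2, fun hh => by omega⟩
      · exact ⟨hv.1, fun hh => by omega⟩
    · rw [Finset.disjoint_left]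
      intro v hv hv'
      simp only [Finset.mem_inter, hFV, hO, Finset.mem_filter] at hv hv'
      omega
  have e6 := Finset.card_sdiff_add_card_inter F D
  have e7 := Nat.mul_le_mul_right R e4
  have e8 := Nat.mul_le_mul_right R e5
  rw [← e6]
  simp only [add_mul] at e7 e8 ⊢
  have e9 : 2 * (F \ D).card * R = 2 * ((F \ D).card * R) := by ring
  have e10 : 2 * O.card * R = 2 * (O.card * R) := by ring
  omega

/-- All these vertices have value at least `R`, while the total value is `(2 * R + 1) * |M|`. This
crude bound keeps a rebuilt cover within six times the old one and six times the optimum, however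
good the static algorithm is. -/
theorem card_high_add_mid (h : Rounding adj S V R t p ow mt z) :
    (high V z R t).card + (mid V z R t).card ≤ 3 * (matched V mt).card := by
  have ht := h.lt
  rw [← Finset.card_union_of_disjoint]
  · have h1 : (high V z R t ∪ mid V z R t).card * R ≤ ∑ v ∈ high V z R t ∪ mid V z R t, z v := by
      rw [← smul_eq_mul]
      refine Finset.card_nsmul_le_sum _ _ _ fun v hv => ?_
      simp only [high, mid, Finset.mem_union, Finset.mem_filter] at hv
      omega
    have h2 : ∑ v ∈ high V z R t ∪ mid V z R t, z v ≤ ∑ v ∈ V, z v := by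
      refine Finset.sum_le_sum_of_subset fun v hv => ?_
      simp only [high, mid, Finset.mem_union, Finset.mem_filter] at hv
      tauto
    rw [h.sum_dual] at h2
    have h3 : (2 * R + 1) * (matched V mt).card ≤ 3 * (matched V mt).card * R := by nlinarith
    exact Nat.le_of_mul_le_mul_right (h1.trans (h2.trans h3)) (by omega)
  · rw [Finset.disjoint_left]
    intro v hv hv'
    simp only [high, mid, Finset.mem_filter] at hv hv'
    omega

/-- The values at the ends of an edge add up to at least `4 * R`, so if neither end is high, both
are in the middle part. They belong to `V` because only touched vertices have positive value. -/
theorem isCov (h : Rounding adj S V R t p ow mt z) {X : Finset ℕ}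
    (hX : IsCov adj (mid V z R t) X) : IsCov adj S (high V z R t ∪ X) := by
  have ht := h.lt
  refine ⟨fun v hv => ?_, fun u hu v hv huv => ?_⟩
  · rcases Finset.mem_union.1 hv with hv | hv
    · exact h.auc.sub (Finset.mem_filter.1 hv).1
    · exact h.auc.sub (Finset.mem_filter.1 (hX.1 hv)).1
  · have e := h.edge hu hv huv
    by_cases a : 2 * R + t < z u
    · exact Or.inl (Finset.mem_union_left _ (Finset.mem_filter.2 ⟨h.mem_of_pos (by omega), a⟩))
    by_cases b : 2 * R + t < z v
    · exact Or.inr (Finset.mem_union_left _ (Finset.mem_filter.2 ⟨h.mem_of_pos (by omega), b⟩))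
    have hu' : u ∈ mid V z R t := Finset.mem_filter.2 ⟨h.mem_of_pos (by omega), by omega⟩
    have hv' : v ∈ mid V z R t := Finset.mem_filter.2 ⟨h.mem_of_pos (by omega), by omega⟩
    rcases hX.2 u hu' v hv' huv with h | h
    · exact Or.inl (Finset.mem_union_right _ h)
    · exact Or.inr (Finset.mem_union_right _ h)

end Rounding

/-! ### A program logic for the machine -/

/-- States of the machine in which detection instances hold sets of handles.  `clock` counts
instructions, `ext` is the time spent by the static algorithm. -/
structure St where
  reg : ℕ → ℕ
  arr : ℕ → ℕ → ℕ
  cont : ℕ → Set ℕ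
  clock : ℕ
  ext : ℕ

namespace St

def tick (s : St) : St := { s with clock := s.clock + 1 }

def set (s : St) (r a : ℕ) : St :=
  { s with reg := Function.update s.reg r a, clock := s.clock + 1 }

def put (s : St) (a i v : ℕ) : St :=
  { s with arr := Function.update s.arr a (Function.update (s.arr a) i v), clock := s.clock + 1 }

def setCont (s : St) (i : ℕ) (Y : Set ℕ) : St :=
  { s with cont := Function.update s.cont i Y, clock := s.clock + 1 }

def bits (s : St) (a b l : ℕ) (X : Finset ℕ) (t : ℕ) : St :=
  { s with
    arr := Function.update s.arr b
      (fun i => if i < l then (if s.arr a i ∈ X then 1 else 0) else s.arr b i)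
    clock := s.clock + 1 + l
    ext := s.ext + t }

end St

/-- What a program may use about the objects: the handles in use, which of them have intersecting
regions, and the guarantees of the static algorithm. -/
structure Env where
  live : Set ℕ
  meets : ℕ → ℕ → Prop
  ρ : ℝ
  c : ℝ
  T : ℕ → ℝ

/-- Adjacency of handles in the intersection graph. -/
def Env.adj (e : Env) (u v : ℕ) : Prop := u ≠ v ∧ e.meets u v

open Classical in
/-- Weakest preconditions: `wp e P Q s` guarantees that `P` terminates from `s` in a state with `Q`. -/
noncomputable def wp (e : Env) : Prog → (St → Prop) → St → Prop
  | .skip, Q, s => Q s.tick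
  | .const r a, Q, s => Q (s.set r a)
  | .move r t, Q, s => Q (s.set r (s.reg t))
  | .add r t u, Q, s => Q (s.set r (s.reg t + s.reg u))
  | .sub r t u, Q, s => Q (s.set r (s.reg t - s.reg u))
  | .load r a t, Q, s => Q (s.set r (s.arr a (s.reg t)))
  | .store a r t, Q, s => Q (s.put a (s.reg r) (s.reg t))
  | .detInsert i h, Q, s => s.reg h ∈ e.live ∧ s.reg h ∉ s.cont (s.reg i) ∧
      Q (s.setCont (s.reg i) (insert (s.reg h) (s.cont (s.reg i))))
  | .detDelete i h, Q, s => s.reg h ∈ s.cont (s.reg i) ∧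
      Q (s.setCont (s.reg i) (s.cont (s.reg i) \ {s.reg h}))
  | .detQuery r i h, Q, s => s.reg h ∈ e.live ∧
      Q (s.set r (if ∃ w ∈ s.cont (s.reg i), e.meets (s.reg h) w then 1 else 0))
  | .solve a b l, Q, s =>
      ((List.range (s.reg l)).map (s.arr a)).Nodup ∧ (∀ i < s.reg l, s.arr a i ∈ e.live) ∧
      (s.reg l : ℝ) ≤ e.ρ * vc e.adj ((Finset.range (s.reg l)).image (s.arr a)) ∧
      ∀ (X : Finset ℕ) (t : ℕ), IsCov e.adj ((Finset.range (s.reg l)).image (s.arr a)) X →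
        (X.card : ℝ) ≤ e.c * vc e.adj ((Finset.range (s.reg l)).image (s.arr a)) →
        (t : ℝ) ≤ e.T (s.reg l) → Q (s.bits a b (s.reg l) X t)
  | .seq P P', Q, s => wp e P (wp e P' Q) s
  | .ite r t P P', Q, s => if s.reg r < s.reg t then wp e P Q s.tick else wp e P' Q s.tick
  | .while r t P, Q, s => ∀ F : St → Prop,
      (∀ s, (s.reg r < s.reg t → wp e P F s.tick) → (¬ s.reg r < s.reg t → Q s.tick) → F s) → F s

section rules
variable {e : Env}

theorem wp_mono {P : Prog} {Q Q' : St → Prop} {s : St} (h : wp e P Q s) (hQ : ∀ s, Q s → Q' s) :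
    wp e P Q' s := by
  induction P generalizing Q Q' s with
  | seq P P' ih ih' => exact ih h fun s hs => ih' hs hQ
  | ite r t P P' ih ih' =>
    simp only [wp] at h ⊢
    split_ifs with hc
    · exact ih (by simpa [hc] using h) hQ
    · exact ih' (by simpa [hc] using h) hQ
  | solve a b l => exact ⟨h.1, h.2.1, h.2.2.1, fun X t h1 h2 h3 => hQ _ (h.2.2.2 X t h1 h2 h3)⟩
  | detInsert i k => exact ⟨h.1, h.2.1, hQ _ h.2.2⟩
  | detDelete i k => exact ⟨h.1, hQ _ h.2⟩
  | detQuery r i k => exact ⟨h.1, hQ _ h.2⟩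
  | skip => exact hQ _ h
  | const => exact hQ _ h
  | move => exact hQ _ h
  | add => exact hQ _ h
  | sub => exact hQ _ h
  | load => exact hQ _ h
  | store => exact hQ _ h
  | _ r t P ih =>
    exact fun F hF => h F fun s h1 h2 => hF s h1 fun hc => hQ _ (h2 hc)

/-- The loop clause of `wp` is the least predicate closed under unfolding the loop once, which is
why it includes termination. Here the clause itself is shown to be closed. -/
theorem wp_while_intro {r t : ℕ} {P : Prog} {Q : St → Prop} {s : St}
    (h1 : s.reg r < s.reg t → wp e P (wp e (.while r t P) Q) s.tick)
    (h2 : ¬ s.reg r < s.reg t → Q s.tick) : wp e (.while r t P) Q s :=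
  fun F hF => hF s (fun hc => wp_mono (h1 hc) fun _ hs => hs F hF) h2

theorem wp_while {r t : ℕ} {P : Prog} {Q : St → Prop} {s : St} (I : St → Prop) (μ : St → ℕ)
    (h0 : I s) (h1 : ∀ s, I s → s.reg r < s.reg t → wp e P (fun s' => I s' ∧ μ s' < μ s) s.tick)
    (h2 : ∀ s, I s → ¬ s.reg r < s.reg t → Q s.tick) : wp e (.while r t P) Q s := by
  induction hn : μ s using Nat.strong_induction_on generalizing s with
  | _ n ih =>
    refine wp_while_intro (fun hc => ?_) (h2 s h0)
    exact wp_mono (h1 s h0 hc) fun s' hs' => ih _ (hn ▸ hs'.2) hs'.1 rfl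

end rules

/-! ### Handles and objects -/

section link
variable {α P : Type*} {shape : α → Set P} {tbl : ℕ → Option α}

/-- The handles whose objects intersect. -/
def meetsOf (shape : α → Set P) (tbl : ℕ → Option α) (u v : ℕ) : Prop :=
  ∃ x y, tbl u = some x ∧ tbl v = some y ∧ (shape x ∩ shape y).Nonempty

/-- The environment given by objects and a table of handles. -/
def envOf (shape : α → Set P) (tbl : ℕ → Option α) (ρ c : ℝ) (T : ℕ → ℝ) : Env where
  live := {h | tbl h ≠ none}
  meets := meetsOf shape tbl
  ρ := ρ
  c := c
  T := T

/-- Distinct handles stand for distinct objects. -/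
def InjTable (tbl : ℕ → Option α) : Prop := ∀ h h' x, tbl h = some x → tbl h' = some x → h = h'

/-- The objects of a set of handles. -/
def objs (tbl : ℕ → Option α) (S : Finset ℕ) : Set α := {x | ∃ h ∈ S, tbl h = some x}

/-- Distinct handles stand for distinct objects, so covers translate in both directions without
growing: an object of a cover goes to its handle, a handle to its object. -/
theorem minCover_eq_vc (hinj : InjTable tbl) {ρ c : ℝ} {T : ℕ → ℝ} (S : Finset ℕ) :
    minCover shape (objs tbl S) = vc (envOf shape tbl ρ c T).adj S := by
  classical
  set G := intersectionGraph shape (objs tbl S) with hG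
  have hle : G.vertexCoverNum ≤ (vc (envOf shape tbl ρ c T).adj S : ℕ∞) := by
    obtain ⟨D, hD, hc⟩ := exists_vc (adj := (envOf shape tbl ρ c T).adj) S
    have hcov : G.IsVertexCover {v | ∃ h ∈ D, tbl h = some v.1} := by
      rintro ⟨x, a, ha, hx⟩ ⟨y, b, hb, hy⟩ hxy
      have hab : (envOf shape tbl ρ c T).adj a b := by
        refine ⟨?_, x, y, hx, hy, hxy.2⟩
        rintro rfl
        exact hxy.1 (Subtype.ext (Option.some_injective _ (hx.symm.trans hy)))
      rcases hD.2 a ha b hb hab with h | h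
      · exact Or.inl ⟨a, h, hx⟩
      · exact Or.inr ⟨b, h, hy⟩
    refine hcov.vertexCoverNum_le.trans ?_
    rw [← hc, ← Set.encard_coe_eq_coe_finsetCard]
    have hf : ∀ v : {v : objs tbl S // ∃ h ∈ D, tbl h = some v.1}, ∃ h ∈ D, tbl h = some v.1.1 :=
      fun v => v.2
    choose f hf1 hf2 using hf
    refine Function.Embedding.encard_le ⟨fun v => ⟨f v, hf1 v⟩, fun v w hvw => ?_⟩
    have hvw' : f v = f w := congrArg Subtype.val hvw
    have := hf2 v
    rw [hvw', hf2 w] at this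
    exact Subtype.ext (Subtype.ext (Option.some_injective _ this).symm)
  have hge : (vc (envOf shape tbl ρ c T).adj S : ℕ∞) ≤ G.vertexCoverNum := by
    obtain ⟨s, hs, hcov⟩ := G.vertexCoverNum_exists
    rw [← hs]
    set D := S.filter (fun h => ∃ v ∈ s, tbl h = some v.1) with hDdef
    have hD : IsCov (envOf shape tbl ρ c T).adj S D := by
      refine ⟨Finset.filter_subset _ _, fun u hu v hv huv => ?_⟩
      obtain ⟨hne, x, y, hx, hy, hxy⟩ := huv
      have hadj : G.Adj ⟨x, u, hu, hx⟩ ⟨y, v, hv, hy⟩ := by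
        refine ⟨fun h => hne ?_, hxy⟩
        have hxy' : x = y := congrArg Subtype.val h
        exact hinj u v x hx (hxy' ▸ hy)
      rcases hcov hadj with h | h
      · exact Or.inl (Finset.mem_filter.2 ⟨hu, _, h, hx⟩)
      · exact Or.inr (Finset.mem_filter.2 ⟨hv, _, h, hy⟩)
    refine (Nat.cast_le.2 hD.vc_le).trans ?_
    rw [← Set.encard_coe_eq_coe_finsetCard]
    have hf : ∀ h : (D : Set ℕ), ∃ v ∈ s, tbl h = some v.1 :=
      fun h => (Finset.mem_filter.1 (Finset.mem_coe.1 h.2)).2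
    choose f hf1 hf2 using hf
    refine Function.Embedding.encard_le ⟨fun v => ⟨f v, hf1 v⟩, fun v w hvw => ?_⟩
    have hvw' : f v = f w := congrArg Subtype.val hvw
    exact Subtype.ext (hinj _ _ _ (hf2 v) (hvw' ▸ hf2 w))
  rw [minCover, le_antisymm hle hge, ENat.toNat_natCast]

variable {D : Detector α} {A : StaticAlg α} {cap : ℕ}

/-- The state `s` of the program logic describes the state `m` of the machine, when the machine has
used `t` time units so far and never more than `cap` objects were present. -/
structure Describes (D : Detector α) (tbl : ℕ → Option α) (cap : ℕ) (s : St) (m : Mach α) (t : ℕ) :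
    Prop where
  reg : m.reg = s.reg
  arr : m.arr = s.arr
  live : ∀ i, s.cont i ⊆ {h | tbl h ≠ none}
  cont : ∀ i x, x ∈ DetOp.content (m.hist i) ↔ ∃ h ∈ s.cont i, tbl h = some x
  legal : ∀ i, DetOp.Legal (m.hist i)
  size : ∀ i, DetOp.SizeLe cap (m.hist i)
  time : ∃ I : Finset ℕ, (∀ i, i ∉ I → m.hist i = []) ∧
    t ≤ s.clock + s.ext + ∑ i ∈ I, D.totalTime (m.hist i) ∧
    ∑ i ∈ I, (m.hist i).length ≤ s.clock

/-- Only the instances in the finite set `I` have been used. Adding `i` to `I` does not change the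
sums before the operation, because an unused instance has an empty history. -/
theorem Describes.record {s : St} {m : Mach α} {t : ℕ} (h : Describes D tbl cap s m t)
    (hcap : ∀ X : Finset α, (∀ x ∈ X, ∃ h, tbl h = some x) → X.card ≤ cap)
    (i : ℕ) (o : DetOp α) (Y : Set ℕ) (hY : Y ⊆ {h | tbl h ≠ none})
    (hl : DetOp.Legal (o :: m.hist i))
    (hc : ∀ x, x ∈ DetOp.content (o :: m.hist i) ↔ ∃ h ∈ Y, tbl h = some x) :
    Describes D tbl cap (s.setCont i Y) (m.record i o) (t + (1 + D.time (m.hist i) o)) := by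
  obtain ⟨I, hI1, hI2, hI3⟩ := h.time
  refine ⟨h.reg, h.arr, fun j => ?_, fun j x => ?_, fun j => ?_, fun j => ?_, insert i I, ?_, ?_, ?_⟩
  · by_cases hj : j = i
    · subst hj; simpa [St.setCont] using hY
    · simpa [St.setCont, hj] using h.live j
  · by_cases hj : j = i
    · subst hj; simpa [St.setCont, Mach.record] using hc x
    · simpa [St.setCont, Mach.record, hj] using h.cont j x
  · by_cases hj : j = i
    · subst hj; simpa [Mach.record] using hl
    · simpa [Mach.record, hj] using h.legal j
  · by_cases hj : j = i
    · subst hj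
      simp only [Mach.record, Function.update_self]
      refine ⟨hcap _ fun x hx => ?_, h.size j⟩
      obtain ⟨k, _, hk⟩ := (hc x).1 hx
      exact ⟨k, hk⟩
    · simpa [Mach.record, hj] using h.size j
  · intro j hj
    simp only [Finset.mem_insert, not_or] at hj
    simpa [Mach.record, hj.1] using hI1 j hj.2
  · have e1 : ∑ j ∈ insert i I, D.totalTime ((m.record i o).hist j) =
        D.time (m.hist i) o + ∑ j ∈ I, D.totalTime (m.hist j) := by
      have e2 : ∑ j ∈ I, D.totalTime (m.hist j) = ∑ j ∈ insert i I, D.totalTime (m.hist j) := by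
        refine Finset.sum_subset (Finset.subset_insert _ _) fun j _ hj => ?_
        rw [hI1 j hj]; rfl
      rw [e2, ← Finset.add_sum_erase _ _ (Finset.mem_insert_self i I),
        ← Finset.add_sum_erase (insert i I) (fun j => D.totalTime (m.hist j))
          (Finset.mem_insert_self i I)]
      rw [Finset.sum_congr rfl (g := fun j => D.totalTime (m.hist j))]
      · simp [Mach.record, Detector.totalTime, add_assoc]
      · intro j hj
        simp [Mach.record, Finset.ne_of_mem_erase hj]
    rw [e1]
    simp only [St.setCont]
    omega
  · have e1 : ∑ j ∈ insert i I, ((m.record i o).hist j).length =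
        1 + ∑ j ∈ I, (m.hist j).length := by
      have e2 : ∑ j ∈ I, (m.hist j).length = ∑ j ∈ insert i I, (m.hist j).length := by
        refine Finset.sum_subset (Finset.subset_insert _ _) fun j _ hj => ?_
        rw [hI1 j hj]; rfl
      rw [e2, ← Finset.add_sum_erase _ _ (Finset.mem_insert_self i I),
        ← Finset.add_sum_erase (insert i I) (fun j => (m.hist j).length)
          (Finset.mem_insert_self i I)]
      rw [Finset.sum_congr rfl (g := fun j => (m.hist j).length)]
      · simp [Mach.record]; omega
      · intro j hj
        simp [Mach.record, Finset.ne_of_mem_erase hj]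
    rw [e1]
    simp only [St.setCont]
    omega

theorem Describes.step {s : St} {m : Mach α} {t : ℕ} (h : Describes D tbl cap s m t) (f : ℕ → ℕ)
    (g : ℕ → ℕ → ℕ) (k l : ℕ) :
    Describes D tbl cap { s with reg := f, arr := g, clock := s.clock + k, ext := s.ext + l }
      { m with reg := f, arr := g } (t + (k + l)) := by
  obtain ⟨I, hI1, hI2, hI3⟩ := h.time
  refine ⟨rfl, rfl, h.live, h.cont, h.legal, h.size, I, hI1, ?_, ?_⟩
  · dsimp only; omega
  · dsimp only; omega

/-- The program logic is sound for the machine. -/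
theorem wp_sound {B : ℝ} {τ₀ : ℕ → ℝ} {ρ c : ℝ} {T : ℕ → ℝ} (hinj : InjTable tbl)
    (hcap : ∀ X : Finset α, (∀ x ∈ X, ∃ h, tbl h = some x) → X.card ≤ cap)
    (hD : D.Detects shape B τ₀) (hA : A.Approximates shape ρ c T)
    {p : Prog} {Q : St → Prop} {s : St} {m : Mach α} {t : ℕ}
    (h : wp (envOf shape tbl ρ c T) p Q s) (hr : Describes D tbl cap s m t) :
    ∃ s' m' t', Exec D A tbl p m m' t' ∧ Describes D tbl cap s' m' (t + t') ∧ Q s' := by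
  classical
  induction p generalizing Q s m t with
  | skip => exact ⟨_, _, _, .skip m, by
      have := hr.step s.reg s.arr 1 0
      simpa [St.tick, ← hr.reg, ← hr.arr] using this, h⟩
  | const r a =>
    exact ⟨_, _, _, .const m r a, by
      have := hr.step (Function.update s.reg r a) s.arr 1 0
      simpa [Mach.setReg, St.set, hr.reg, ← hr.arr] using this, h⟩
  | move r a =>
    exact ⟨_, _, _, .move m r a, by
      have := hr.step (Function.update s.reg r (s.reg a)) s.arr 1 0
      simpa [Mach.setReg, St.set, hr.reg, ← hr.arr] using this, h⟩
  | add r a b =>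
    exact ⟨_, _, _, .add m r a b, by
      have := hr.step (Function.update s.reg r (s.reg a + s.reg b)) s.arr 1 0
      simpa [Mach.setReg, St.set, hr.reg, ← hr.arr] using this, h⟩
  | sub r a b =>
    exact ⟨_, _, _, .sub m r a b, by
      have := hr.step (Function.update s.reg r (s.reg a - s.reg b)) s.arr 1 0
      simpa [Mach.setReg, St.set, hr.reg, ← hr.arr] using this, h⟩
  | load r a b =>
    exact ⟨_, _, _, .load m r a b, by
      have := hr.step (Function.update s.reg r (s.arr a (s.reg b))) s.arr 1 0
      simpa [Mach.setReg, St.set, hr.reg, ← hr.arr] using this, h⟩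
  | store a b d =>
    exact ⟨_, _, _, .store m a b d, by
      have := hr.step s.reg
        (Function.update s.arr a (Function.update (s.arr a) (s.reg b) (s.reg d))) 1 0
      simpa [St.put, hr.arr, ← hr.reg] using this, h⟩
  | detInsert i k =>
    obtain ⟨h1, h2, h3⟩ := h
    obtain ⟨x, hx⟩ := Option.ne_none_iff_exists'.1 h1
    have hx' : tbl (m.reg k) = some x := by rw [hr.reg]; exact hx
    refine ⟨_, _, _, .detInsert m i k x hx', ?_, h3⟩
    rw [hr.reg]
    have hnot : x ∉ DetOp.content (m.hist (s.reg i)) := by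
      rw [hr.cont]
      rintro ⟨k', hk', hkx⟩
      exact h2 (hinj _ _ _ hx hkx ▸ hk')
    refine hr.record hcap _ _ _ ?_ ⟨hnot, hr.legal _⟩ ?_
    · exact Set.insert_subset h1 (hr.live _)
    · intro y
      simp only [DetOp.content, Finset.mem_insert, hr.cont, Set.mem_insert_iff]
      constructor
      · rintro (rfl | ⟨k', hk', hy⟩)
        · exact ⟨_, Or.inl rfl, hx⟩
        · exact ⟨k', Or.inr hk', hy⟩
      · rintro ⟨k', rfl | hk', hy⟩
        · rw [hx] at hy; exact Or.inl (Option.some_injective _ hy).symm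
        · exact Or.inr ⟨k', hk', hy⟩
  | detDelete i k =>
    obtain ⟨h1, h3⟩ := h
    obtain ⟨x, hx⟩ := Option.ne_none_iff_exists'.1 (hr.live _ h1)
    have hx' : tbl (m.reg k) = some x := by rw [hr.reg]; exact hx
    refine ⟨_, _, _, .detDelete m i k x hx', ?_, h3⟩
    rw [hr.reg]
    refine hr.record hcap _ _ _ ?_ ⟨(hr.cont _ _).2 ⟨_, h1, hx⟩, hr.legal _⟩ ?_
    · exact Set.sdiff_subset.trans (hr.live _)
    · intro y
      simp only [DetOp.content, Finset.mem_erase, hr.cont, Set.mem_sdiff, Set.mem_singleton_iff]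
      constructor
      · rintro ⟨hne, k', hk', hy⟩
        refine ⟨k', ⟨hk', ?_⟩, hy⟩
        rintro rfl
        rw [hx] at hy; exact hne (Option.some_injective _ hy).symm
      · rintro ⟨k', ⟨hk', hne⟩, hy⟩
        refine ⟨?_, k', hk', hy⟩
        rintro rfl
        exact hne (hinj _ _ _ hy hx)
  | detQuery r i k =>
    obtain ⟨h1, h3⟩ := h
    obtain ⟨x, hx⟩ := Option.ne_none_iff_exists'.1 h1
    have hx' : tbl (m.reg k) = some x := by rw [hr.reg]; exact hx
    refine ⟨_, _, _, .detQuery m r i k x hx', ?_, h3⟩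
    have hrec := hr.record hcap (s.reg i) (.query x) (s.cont (s.reg i)) (hr.live _)
      (show DetOp.Legal (.query x :: m.hist (s.reg i)) from hr.legal _) (fun y => hr.cont _ y)
    have hans : (D.ans (m.hist (s.reg i)) x = true) ↔
        ∃ w ∈ s.cont (s.reg i), meetsOf shape tbl (s.reg k) w := by
      rw [hD.1 _ _ (hr.legal _)]
      constructor
      · rintro ⟨y, hy, hxy⟩
        obtain ⟨w, hw, hwy⟩ := (hr.cont _ _).1 hy
        exact ⟨w, hw, x, y, hx, hwy, hxy⟩
      · rintro ⟨w, hw, x', y, hx'', hwy, hxy⟩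
        rw [hx] at hx''
        obtain rfl := Option.some_injective _ hx''
        exact ⟨y, (hr.cont _ _).2 ⟨w, hw, hwy⟩, hxy⟩
    -- The query has been paid for by `hrec`; writing the answer into a register costs nothing more.
    have hst := fun v => hrec.step (Function.update s.reg r v) s.arr 0 0
    by_cases hq : ∃ w ∈ s.cont (s.reg i), meetsOf shape tbl (s.reg k) w
    · have := hst 1
      simpa [St.setCont, St.set, Mach.record, Mach.setReg, hr.reg, ← hr.arr, hans.2 hq, envOf, hq]
        using this
    · have := hst 0
      simpa [St.setCont, St.set, Mach.record, Mach.setReg, hr.reg, ← hr.arr, mt hans.1 hq, envOf, hq]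
        using this
  | solve a b l =>
    obtain ⟨h1, h2, h3, h4⟩ := h
    set S := (Finset.range (s.reg l)).image (s.arr a) with hS
    have hL : ∃ L : List α, L.map some = (List.range (s.reg l)).map (fun i => tbl (s.arr a i)) := by
      refine ⟨(List.range (s.reg l)).filterMap (fun i => tbl (s.arr a i)), ?_⟩
      rw [List.map_filterMap]
      have : ∀ i ∈ List.range (s.reg l), (tbl (s.arr a i)).map some = some (tbl (s.arr a i)) := by
        intro i hi
        obtain ⟨x, hx⟩ := Option.ne_none_iff_exists'.1 (h2 i (List.mem_range.1 hi))
        rw [hx]; rfl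
      rw [List.filterMap_congr this]
      exact congrFun (List.filterMap_eq_map (f := fun i => tbl (s.arr a i))) _
    obtain ⟨L, hL⟩ := hL
    have hlen : L.length = s.reg l := by simpa using congrArg List.length hL
    have hmem : ∀ x, x ∈ L ↔ ∃ h ∈ S, tbl h = some x := by
      intro x
      have : x ∈ L ↔ some x ∈ L.map some := by simp
      rw [this, hL]
      simp [hS]
    have hset : {x | x ∈ L} = objs tbl S := by
      ext x; exact hmem x
    have hnd : L.Nodup := by
      have : (L.map some).Nodup := by
        have e : (List.range (s.reg l)).map (fun i => tbl (s.arr a i)) =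
            ((List.range (s.reg l)).map (s.arr a)).map tbl := by simp
        rw [hL, e]
        refine List.Nodup.map_on ?_ h1
        intro u hu v hv huv
        rw [List.mem_map] at hu hv
        obtain ⟨i, hi, rfl⟩ := hu
        obtain ⟨x, hx⟩ := Option.ne_none_iff_exists'.1 (h2 i (List.mem_range.1 hi))
        exact hinj _ _ x hx (huv ▸ hx)
      exact List.Nodup.of_map _ this
    have hmc := minCover_eq_vc (shape := shape) (ρ := ρ) (c := c) (T := T) hinj S
    obtain ⟨X, τ, hX1, hX2, hX3, hX4, hX5⟩ := hA L hnd (by rw [hset, hmc, hlen]; exact h3)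
    rw [hset, hmc] at hX4
    rw [hlen] at hX5
    -- The static algorithm returns objects, and `X'` consists of their handles. It is no larger
    -- than `X` because different handles have different objects.
    set X' : Finset ℕ := S.filter (fun h => ∃ x ∈ X, tbl h = some x) with hX'
    have hcov : IsCov (envOf shape tbl ρ c T).adj S X' := by
      refine ⟨Finset.filter_subset _ _, fun u hu v hv huv => ?_⟩
      obtain ⟨hne, x, y, hx, hy, hxy⟩ := huv
      have hadj : (intersectionGraph shape {x | x ∈ L}).Adj
          ⟨x, (hmem x).2 ⟨u, hu, hx⟩⟩ ⟨y, (hmem y).2 ⟨v, hv, hy⟩⟩ := by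
        refine ⟨fun h => hne ?_, hxy⟩
        have hxy' : x = y := congrArg Subtype.val h
        exact hinj u v x hx (hxy' ▸ hy)
      rcases hX3 hadj with h | h
      · exact Or.inl (Finset.mem_filter.2 ⟨hu, _, h, hx⟩)
      · exact Or.inr (Finset.mem_filter.2 ⟨hv, _, h, hy⟩)
    have hcard : X'.card ≤ X.card := by
      refine le_trans (Finset.card_le_card_of_injOn tbl (t := X.image some) (fun h hh => ?_)
        fun u hu v hv huv => ?_) Finset.card_image_le
      · obtain ⟨x, hx, hhx⟩ := (Finset.mem_filter.1 hh).2
        rw [hhx]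
        exact Finset.mem_coe.2 (Finset.mem_image_of_mem _ hx)
      · obtain ⟨x, hx, hux⟩ := (Finset.mem_filter.1 hu).2
        exact hinj u v x hux (huv ▸ hux)
    refine ⟨_, _, _, .solve m a b l L X τ (by rw [hr.reg, hr.arr]; exact hL) hX1, ?_,
      h4 X' τ hcov ((Nat.cast_le.2 hcard).trans hX4) hX5⟩
    have := hr.step s.reg (Function.update s.arr b (fun i => if i < s.reg l then
      (if s.arr a i ∈ X' then 1 else 0) else s.arr b i)) (1 + s.reg l) τ
    have e : (fun i => if i < s.reg l then (if ∃ x ∈ X, tbl (s.arr a i) = some x then 1 else 0)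
        else s.arr b i) = (fun i => if i < s.reg l then
      (if s.arr a i ∈ X' then 1 else 0) else s.arr b i) := by
      funext i
      by_cases hi : i < s.reg l
      · have : s.arr a i ∈ S := Finset.mem_image.2 ⟨i, Finset.mem_range.2 hi, rfl⟩
        simp [hi, hX', this]
      · simp [hi]
    simp only [St.bits, Mach.writeBits, hr.reg, hr.arr]
    rw [← e] at this ⊢
    rw [← hr.reg] at this ⊢
    convert this using 1
    · simp only [add_assoc]
  | seq p q ih ih' =>
    obtain ⟨s1, m1, t1, e1, r1, h1⟩ := ih h hr
    obtain ⟨s2, m2, t2, e2, r2, h2⟩ := ih' h1 r1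
    exact ⟨s2, m2, _, .seq e1 e2, by rw [← add_assoc]; exact r2, h2⟩
  | ite r a p q ih ih' =>
    have ht : Describes D tbl cap s.tick m (t + 1) := by
      have := hr.step s.reg s.arr 1 0
      simpa [St.tick, ← hr.reg, ← hr.arr] using this
    simp only [wp] at h
    by_cases hc : s.reg r < s.reg a
    · rw [if_pos hc] at h
      obtain ⟨s1, m1, t1, e1, r1, h1⟩ := ih h ht
      exact ⟨s1, m1, _, .iteTrue (by rw [hr.reg]; exact hc) e1, by rw [← add_assoc]; exact r1, h1⟩
    · rw [if_neg hc] at h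
      obtain ⟨s1, m1, t1, e1, r1, h1⟩ := ih' h ht
      exact ⟨s1, m1, _, .iteFalse (by rw [hr.reg]; exact hc) e1, by rw [← add_assoc]; exact r1, h1⟩
  | _ r a p ih =>
    -- The induction over the loop becomes the choice of a closed predicate: from every machine
    -- state described by `s` the loop terminates as required.
    refine h (fun s => ∀ m t, Describes D tbl cap s m t → ∃ s' m' t',
      Exec D A tbl (.while r a p) m m' t' ∧ Describes D tbl cap s' m' (t + t') ∧ Q s') ?_ m t hr
    intro s h1 h2 m t hr
    have ht : Describes D tbl cap s.tick m (t + 1) := by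
      have := hr.step s.reg s.arr 1 0
      simpa [St.tick, ← hr.reg, ← hr.arr] using this
    by_cases hc : s.reg r < s.reg a
    · obtain ⟨s1, m1, t1, e1, r1, g1⟩ := ih (h1 hc) ht
      obtain ⟨s2, m2, t2, e2, r2, g2⟩ := g1 _ _ r1
      exact ⟨s2, m2, _, .whileTrue (by rw [hr.reg]; exact hc) e1 e2,
        by simpa only [add_assoc] using r2, g2⟩
    · exact ⟨_, _, _, .whileFalse (by rw [hr.reg]; exact hc), ht, h2 hc⟩

end link

-- Simplification rules for the program logic

infixr:60 " ;; " => Prog.seq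

namespace St
variable (s : St) (r a i v l b t : ℕ) (Y : Set ℕ) (X : Finset ℕ)

@[simp] theorem tick_reg : s.tick.reg = s.reg := rfl
@[simp] theorem tick_arr : s.tick.arr = s.arr := rfl
@[simp] theorem tick_cont : s.tick.cont = s.cont := rfl
@[simp] theorem tick_clock : s.tick.clock = s.clock + 1 := rfl
@[simp] theorem tick_ext : s.tick.ext = s.ext := rfl
@[simp] theorem set_reg : (s.set r a).reg = Function.update s.reg r a := rfl
@[simp] theorem set_arr : (s.set r a).arr = s.arr := rfl
@[simp] theorem set_cont : (s.set r a).cont = s.cont := rfl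
@[simp] theorem set_clock : (s.set r a).clock = s.clock + 1 := rfl
@[simp] theorem set_ext : (s.set r a).ext = s.ext := rfl
@[simp] theorem put_reg : (s.put a i v).reg = s.reg := rfl
@[simp] theorem put_arr : (s.put a i v).arr =
    Function.update s.arr a (Function.update (s.arr a) i v) := rfl
@[simp] theorem put_cont : (s.put a i v).cont = s.cont := rfl
@[simp] theorem put_clock : (s.put a i v).clock = s.clock + 1 := rfl
@[simp] theorem put_ext : (s.put a i v).ext = s.ext := rfl
@[simp] theorem setCont_reg : (s.setCont i Y).reg = s.reg := rfl
@[simp] theorem setCont_arr : (s.setCont i Y).arr = s.arr := rfl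
@[simp] theorem setCont_cont : (s.setCont i Y).cont = Function.update s.cont i Y := rfl
@[simp] theorem setCont_clock : (s.setCont i Y).clock = s.clock + 1 := rfl
@[simp] theorem setCont_ext : (s.setCont i Y).ext = s.ext := rfl
@[simp] theorem bits_reg : (s.bits a b l X t).reg = s.reg := rfl
@[simp] theorem bits_arr : (s.bits a b l X t).arr = Function.update s.arr b
      (fun i => if i < l then (if s.arr a i ∈ X then 1 else 0) else s.arr b i) := rfl
@[simp] theorem bits_cont : (s.bits a b l X t).cont = s.cont := rfl
@[simp] theorem bits_clock : (s.bits a b l X t).clock = s.clock + 1 + l := rfl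
@[simp] theorem bits_ext : (s.bits a b l X t).ext = s.ext + t := rfl

end St

section simprules
variable {e : Env} {Q : St → Prop} {s : St} (r a t u i h : ℕ) (P P' : Prog)

@[simp] theorem wp_skip : wp e .skip Q s = Q s.tick := rfl
@[simp] theorem wp_const : wp e (.const r a) Q s = Q (s.set r a) := rfl
@[simp] theorem wp_move : wp e (.move r t) Q s = Q (s.set r (s.reg t)) := rfl
@[simp] theorem wp_add : wp e (.add r t u) Q s = Q (s.set r (s.reg t + s.reg u)) := rfl
@[simp] theorem wp_sub : wp e (.sub r t u) Q s = Q (s.set r (s.reg t - s.reg u)) := rfl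
@[simp] theorem wp_load : wp e (.load r a t) Q s = Q (s.set r (s.arr a (s.reg t))) := rfl
@[simp] theorem wp_store : wp e (.store a r t) Q s = Q (s.put a (s.reg r) (s.reg t)) := rfl
@[simp] theorem wp_detInsert : wp e (.detInsert i h) Q s = (s.reg h ∈ e.live ∧
    s.reg h ∉ s.cont (s.reg i) ∧
      Q (s.setCont (s.reg i) (insert (s.reg h) (s.cont (s.reg i))))) := rfl
@[simp] theorem wp_detDelete : wp e (.detDelete i h) Q s = (s.reg h ∈ s.cont (s.reg i) ∧
      Q (s.setCont (s.reg i) (s.cont (s.reg i) \ {s.reg h}))) := rfl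
open Classical in
@[simp] theorem wp_detQuery : wp e (.detQuery r i h) Q s = (s.reg h ∈ e.live ∧
    Q (s.set r (if ∃ w ∈ s.cont (s.reg i), e.meets (s.reg h) w then 1 else 0))) := rfl
@[simp] theorem wp_seq : wp e (.seq P P') Q s = wp e P (wp e P' Q) s := rfl
@[simp] theorem wp_ite : wp e (.ite r t P P') Q s =
    if s.reg r < s.reg t then wp e P Q s.tick else wp e P' Q s.tick := rfl

end simprules

/-! ### Searching for a witness

Objects sit at the nodes of a binary heap: node `i` has children `2 * i` and `2 * i + 1`.  There are
`w` sets of objects, and the detection instance `i * w + k` holds the objects of set `k` in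
the subtree of node `i`. -/

/-- `i` is an ancestor of `j` (or equal to it) in the binary heap. -/
def Anc (i j : ℕ) : Prop := ∃ e, j / 2 ^ e = i

theorem Anc.refl (i : ℕ) : Anc i i := ⟨0, by simp⟩

theorem Anc.le {i j : ℕ} (h : Anc i j) : i ≤ j := by
  obtain ⟨e, rfl⟩ := h
  exact Nat.div_le_self _ _

theorem anc_half {i j : ℕ} : Anc i j ↔ i = j ∨ Anc i (j / 2) := by
  constructor
  · rintro ⟨e, rfl⟩
    rcases e with _ | e
    · left; simp
    · right; exact ⟨e, by rw [Nat.div_div_eq_div_mul, pow_succ']⟩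
  · rintro (rfl | ⟨e, rfl⟩)
    · exact Anc.refl _
    · exact ⟨e + 1, by rw [Nat.div_div_eq_div_mul, pow_succ']⟩

theorem anc_one {j : ℕ} (h : 1 ≤ j) : Anc 1 j := by
  induction j using Nat.strong_induction_on with
  | _ j ih =>
    by_cases h1 : j = 1
    · exact h1 ▸ Anc.refl 1
    · exact anc_half.2 (Or.inr (ih (j / 2) (by omega) (by omega)))

theorem anc_child {i j : ℕ} (h : Anc i j) : i = j ∨ Anc (2 * i) j ∨ Anc (2 * i + 1) j := by
  induction j using Nat.strong_induction_on with
  | _ j ih =>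
    by_cases h0 : j = 0
    · subst h0
      have := h.le
      left; omega
    rcases anc_half.1 h with h1 | h1
    · exact Or.inl h1
    · rcases ih (j / 2) (by omega) h1 with h2 | h2 | h2
      · have : j = 2 * i ∨ j = 2 * i + 1 := by omega
        rcases this with rfl | rfl
        · exact Or.inr (Or.inl (Anc.refl _))
        · exact Or.inr (Or.inr (Anc.refl _))
      · exact Or.inr (Or.inl (anc_half.2 (Or.inr h2)))
      · exact Or.inr (Or.inr (anc_half.2 (Or.inr h2)))

/-- Division with remainder by `w`: the instances of different nodes, or of different sets at one
node, never clash. -/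
theorem index_inj {w i j k l : ℕ} (hk : k < w) (hl : l < w) :
    i * w + k = j * w + l ↔ i = j ∧ k = l := by
  constructor
  · intro h
    have h1 : (i * w + k) / w = i := by
      rw [mul_comm, Nat.mul_add_div (by omega), Nat.div_eq_of_lt hk, add_zero]
    have h2 : (j * w + l) / w = j := by
      rw [mul_comm, Nat.mul_add_div (by omega), Nat.div_eq_of_lt hl, add_zero]
    have h3 : i = j := by rw [← h1, h, h2]
    subst h3
    exact ⟨rfl, by omega⟩
  · rintro ⟨rfl, rfl⟩; rfl

/-- The node of a handle. -/
def nodeOf (w : ℕ) (arr : ℕ → ℕ → ℕ) (h : ℕ) : ℕ := arr 2 h / w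

/-- The heap has `N` nodes and holds the handles in `S`; `A k` is the set number `k`. -/
structure Forest (w N : ℕ) (arr : ℕ → ℕ → ℕ) (cont : ℕ → Set ℕ) (S : Finset ℕ) (A : ℕ → Set ℕ) :
    Prop where
  node : ∀ h ∈ S, arr 2 h = nodeOf w arr h * w
  pos : ∀ h ∈ S, 1 ≤ nodeOf w arr h
  le : ∀ h ∈ S, nodeOf w arr h ≤ N
  own : ∀ h ∈ S, arr 3 (arr 2 h) = h
  up : ∀ i, i ≤ 2 * N + 1 → arr 4 (i * w) = i / 2 * w
  sub : ∀ k < w, A k ⊆ S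
  low : ∀ k < w, cont k = ∅
  cont : ∀ i k, 1 ≤ i → k < w → cont (i * w + k) = {h | h ∈ A k ∧ Anc i (nodeOf w arr h)}

theorem Forest.congr {w N : ℕ} {arr arr' : ℕ → ℕ → ℕ} {cont : ℕ → Set ℕ} {S : Finset ℕ}
    {A : ℕ → Set ℕ} (h : Forest w N arr cont S A) (h2 : arr' 2 = arr 2) (h3 : arr' 3 = arr 3)
    (h4 : arr' 4 = arr 4) : Forest w N arr' cont S A := by
  have e : ∀ h, nodeOf w arr' h = nodeOf w arr h := fun h => by rw [nodeOf, h2]; rfl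
  refine ⟨fun x hx => ?_, fun x hx => ?_, fun x hx => ?_, fun x hx => ?_, fun i hi => ?_, h.sub,
    h.low, fun i k hi hk => ?_⟩
  · rw [e, h2]; exact h.node x hx
  · rw [e]; exact h.pos x hx
  · rw [e]; exact h.le x hx
  · rw [h2, h3]; exact h.own x hx
  · rw [h4]; exact h.up i hi
  · rw [h.cont i k hi hk]; simp only [e]

theorem Forest.congr_sets {w N : ℕ} {arr : ℕ → ℕ → ℕ} {cont : ℕ → Set ℕ} {S : Finset ℕ}
    {A A' : ℕ → Set ℕ} (h : Forest w N arr cont S A) (hA : ∀ k < w, A' k = A k) :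
    Forest w N arr cont S A' :=
  ⟨h.node, h.pos, h.le, h.own, h.up, fun k hk => hA k hk ▸ h.sub k hk,
    h.low,
    fun i k hi hk => by rw [h.cont i k hi hk, hA k hk]⟩

/-- Between `s` and `s'` only registers from `r₀` on and detection instances have changed, and at most
`b` instructions have been executed. -/
structure Frame (r₀ b : ℕ) (s s' : St) : Prop where
  reg : ∀ r, r < r₀ → s'.reg r = s.reg r
  arr : s'.arr = s.arr
  clock : s'.clock ≤ s.clock + b
  ext : s'.ext = s.ext

section witness
variable {e : Env} {w N d : ℕ} {S : Finset ℕ} {A : ℕ → Set ℕ}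

/-- Walk from the node in register 54 to the root. -/
def climb (P : Prog) : Prog := .while 59 54 (.add 55 54 50 ;; P ;; .load 54 4 54)

/-- Induction on the height: the walk goes from `i` to `i / 2` and ends at `0`, the parent entry of
the root. The handle must be absent from every instance on the path, or the insertion would be
illegal; the step at `i` does not touch the instances further up. -/
theorem wp_climb_insert (hw : 0 < w) {s : St} {Q : St → Prop} {i k h : ℕ} (d : ℕ)
    (hi : i < 2 ^ d) (hiN : i ≤ N)
    (hup : ∀ i, i ≤ 2 * N + 1 → s.arr 4 (i * w) = i / 2 * w)
    (h54 : s.reg 54 = i * w) (h50 : s.reg 50 = k) (h51 : s.reg 51 = h) (h59 : s.reg 59 = 0)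
    (hk : k < w) (hlive : h ∈ e.live) (hnot : ∀ j, 1 ≤ j → Anc j i → h ∉ s.cont (j * w + k))
    (hQ : ∀ s', Frame 52 (5 * d + 1) s s' →
      (∀ j l, 1 ≤ j → l < w → s'.cont (j * w + l) =
        {x | x ∈ s.cont (j * w + l) ∨ (l = k ∧ Anc j i ∧ x = h)}) →
      (∀ l < w, s'.cont l = s.cont l) → Q s') :
    wp e (climb (.detInsert 55 51)) Q s := by
  induction d generalizing s i with
  | zero =>
    have : i = 0 := by simpa using hi
    subst this
    refine wp_while_intro (fun hc => ?_) fun _ => hQ _ ⟨fun _ _ => rfl, rfl, by simp, rfl⟩ ?_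
      fun _ _ => rfl
    · rw [h59, h54] at hc; simp at hc
    · intro j l hj hl
      ext x
      simp only [St.tick_cont, Set.mem_ofPred_eq]
      constructor
      · exact Or.inl
      · rintro (h | ⟨_, h, _⟩)
        · exact h
        · have := h.le; omega
  | succ d ih =>
    refine wp_while_intro (fun hc => ?_) fun hc => ?_
    · have hi0 : i ≠ 0 := by
        rintro rfl
        rw [h59, h54] at hc; simp at hc
      simp [h51, h54, h50]
      refine ⟨hlive, hnot i (by omega) (Anc.refl i), ?_⟩
      refine ih (i := i / 2) (by rw [pow_succ] at hi; omega) (by omega) ?_ ?_ ?_ ?_ ?_ ?_ ?_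
      · exact hup
      · simp [hup i (by omega)]
      · simp [h50]
      · simp [h51]
      · simp [h59]
      · intro j hj hji
        have hne : j ≠ i := by have := hji.le; omega
        have := hnot j hj (anc_half.2 (Or.inr hji))
        simpa [Function.update_apply, index_inj hk hk, hne, hw.ne'] using this
      · intro s' hf hc' hlow
        have hlow' : ∀ l < w, s'.cont l = s.cont l := by
          intro l hl
          have h1 : 1 * w ≤ i * w := Nat.mul_le_mul_right w (by omega)
          have h2 : l ≠ i * w + k := by omega
          rw [hlow l hl]
          simp [h2]
        refine hQ s' ⟨fun r hr => ?_, ?_, ?_, ?_⟩ ?_ hlow'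
        · rw [hf.reg r hr]
          have h1 : r ≠ 54 := by omega
          have h2 : r ≠ 55 := by omega
          simp [h1, h2]
        · rw [hf.arr]; rfl
        · have := hf.clock
          simp only [St.set_clock, St.setCont_clock, St.tick_clock] at this
          omega
        · rw [hf.ext]; rfl
        · intro j l hj hl
          rw [hc' j l hj hl]
          ext x
          have e1 : Anc j i ↔ j = i ∨ Anc j (i / 2) := anc_half
          by_cases hji : j = i ∧ l = k
          · obtain ⟨rfl, rfl⟩ := hji
            simp [Anc.refl]
            tauto
          · have : ¬ (j * w + l = i * w + k) := by rw [index_inj hl hk]; exact hji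
            simp [this]
            tauto
    · have : i = 0 := by
        rw [h59, h54] at hc
        rcases Nat.eq_zero_or_pos i with h | h
        · exact h
        · exact absurd (Nat.mul_pos h hw) hc
      subst this
      refine hQ _ ⟨fun _ _ => rfl, rfl, by simp, rfl⟩ ?_ fun _ _ => rfl
      intro j l hj hl
      ext x
      simp only [St.tick_cont, Set.mem_ofPred_eq]
      constructor
      · exact Or.inl
      · rintro (h | ⟨_, h, _⟩)
        · exact h
        · have := h.le; omega

/-- The walk of `wp_climb_insert`, with presence along the path in place of absence. -/
theorem wp_climb_delete (hw : 0 < w) {s : St} {Q : St → Prop} {i k h : ℕ} (d : ℕ)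
    (hi : i < 2 ^ d) (hiN : i ≤ N)
    (hup : ∀ i, i ≤ 2 * N + 1 → s.arr 4 (i * w) = i / 2 * w)
    (h54 : s.reg 54 = i * w) (h50 : s.reg 50 = k) (h51 : s.reg 51 = h) (h59 : s.reg 59 = 0)
    (hk : k < w) (hin : ∀ j, 1 ≤ j → Anc j i → h ∈ s.cont (j * w + k))
    (hQ : ∀ s', Frame 52 (5 * d + 1) s s' →
      (∀ j l, 1 ≤ j → l < w → s'.cont (j * w + l) =
        {x | x ∈ s.cont (j * w + l) ∧ ¬ (l = k ∧ Anc j i ∧ x = h)}) →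
      (∀ l < w, s'.cont l = s.cont l) → Q s') :
    wp e (climb (.detDelete 55 51)) Q s := by
  induction d generalizing s i with
  | zero =>
    have : i = 0 := by simpa using hi
    subst this
    refine wp_while_intro (fun hc => ?_) fun _ => hQ _ ⟨fun _ _ => rfl, rfl, by simp, rfl⟩ ?_
      fun _ _ => rfl
    · rw [h59, h54] at hc; simp at hc
    · intro j l hj hl
      ext x
      simp only [St.tick_cont, Set.mem_ofPred_eq]
      refine ⟨fun hx => ⟨hx, ?_⟩, And.left⟩
      rintro ⟨_, h, _⟩
      have := h.le; omega
  | succ d ih =>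
    refine wp_while_intro (fun hc => ?_) fun hc => ?_
    · have hi0 : i ≠ 0 := by
        rintro rfl
        rw [h59, h54] at hc; simp at hc
      simp [h51, h54, h50]
      refine ⟨hin i (by omega) (Anc.refl i), ?_⟩
      refine ih (i := i / 2) (by rw [pow_succ] at hi; omega) (by omega) ?_ ?_ ?_ ?_ ?_ ?_ ?_
      · exact hup
      · simp [hup i (by omega)]
      · simp [h50]
      · simp [h51]
      · simp [h59]
      · intro j hj hji
        have hne : j ≠ i := by have := hji.le; omega
        have := hin j hj (anc_half.2 (Or.inr hji))
        simpa [Function.update_apply, index_inj hk hk, hne, hw.ne'] using this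
      · intro s' hf hc' hlow
        have hlow' : ∀ l < w, s'.cont l = s.cont l := by
          intro l hl
          have h1 : 1 * w ≤ i * w := Nat.mul_le_mul_right w (by omega)
          have h2 : l ≠ i * w + k := by omega
          rw [hlow l hl]
          simp [h2]
        refine hQ s' ⟨fun r hr => ?_, ?_, ?_, ?_⟩ ?_ hlow'
        · rw [hf.reg r hr]
          have h1 : r ≠ 54 := by omega
          have h2 : r ≠ 55 := by omega
          simp [h1, h2]
        · rw [hf.arr]; rfl
        · have := hf.clock
          simp only [St.set_clock, St.setCont_clock, St.tick_clock] at this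
          omega
        · rw [hf.ext]; rfl
        · intro j l hj hl
          rw [hc' j l hj hl]
          ext x
          have e1 : Anc j i ↔ j = i ∨ Anc j (i / 2) := anc_half
          by_cases hji : j = i ∧ l = k
          · obtain ⟨rfl, rfl⟩ := hji
            simp [Anc.refl]
            tauto
          · have : ¬ (j * w + l = i * w + k) := by rw [index_inj hl hk]; exact hji
            simp [this]
            tauto
    · have : i = 0 := by
        rw [h59, h54] at hc
        rcases Nat.eq_zero_or_pos i with h | h
        · exact h
        · exact absurd (Nat.mul_pos h hw) hc
      subst this
      refine hQ _ ⟨fun _ _ => rfl, rfl, by simp, rfl⟩ ?_ fun _ _ => rfl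
      intro j l hj hl
      ext x
      simp only [St.tick_cont, Set.mem_ofPred_eq]
      refine ⟨fun hx => ⟨hx, ?_⟩, And.left⟩
      rintro ⟨_, h, _⟩
      have := h.le; omega

/-- Insert the handle in register `h` into the set whose number is in register `k`. -/
def setInsert (k h : ℕ) : Prog :=
  .move 50 k ;; .move 51 h ;; .load 54 2 51 ;; .const 59 0 ;; climb (.detInsert 55 51)

/-- Delete the handle in register `h` from the set whose number is in register `k`. -/
def setDelete (k h : ℕ) : Prog :=
  .move 50 k ;; .move 51 h ;; .load 54 2 51 ;; .const 59 0 ;; climb (.detDelete 55 51)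

theorem wp_setInsert {s : St} {Q : St → Prop} {k h : ℕ} (hF : Forest w N s.arr s.cont S A)
    (hd : N < 2 ^ d) (hlive : ↑S ⊆ e.live) (hrh : h < 50) (hk : s.reg k < w)
    (hS : s.reg h ∈ S) (hnot : s.reg h ∉ A (s.reg k))
    (hQ : ∀ s', Frame 50 (5 * d + 5) s s' →
      Forest w N s'.arr s'.cont S
        (Function.update A (s.reg k) (insert (s.reg h) (A (s.reg k)))) → Q s') :
    wp e (setInsert k h) Q s := by
  have hw : 0 < w := by omega
  have h50 : h ≠ 50 := by omega
  simp only [setInsert, wp_seq, wp_move, wp_load, wp_const]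
  refine wp_climb_insert (k := s.reg k) (h := s.reg h) (i := nodeOf w s.arr (s.reg h)) (N := N)
    hw d ?_ (hF.le _ hS) hF.up ?_ ?_ ?_ ?_ hk (hlive hS) ?_ ?_
  · exact lt_of_le_of_lt (hF.le _ hS) hd
  · simp [h50, ← hF.node _ hS]
  · simp
  · simp [h50]
  · simp
  · intro j hj hji
    simp only [St.set_cont]
    rw [hF.cont j _ hj hk]
    exact fun hh => hnot hh.1
  · intro s' hf hc hlow
    have harr : s'.arr = s.arr := by rw [hf.arr]; rfl
    refine hQ s' ⟨fun r hr => ?_, harr, ?_, ?_⟩ ?_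
    · rw [hf.reg r (by omega)]
      have h1 : r ≠ 59 := by omega
      have h2 : r ≠ 54 := by omega
      have h3 : r ≠ 51 := by omega
      have h4 : r ≠ 50 := by omega
      simp [h1, h2, h3, h4]
    · have := hf.clock
      simp only [St.set_clock] at this
      omega
    · rw [hf.ext]; rfl
    · rw [harr]
      refine ⟨hF.node, hF.pos, hF.le, hF.own, hF.up, fun l hl => ?_,
        fun l hl => (hlow l hl).trans (hF.low l hl), fun j l hj hl => ?_⟩
      · by_cases hlk : l = s.reg k
        · subst hlk
          rw [Function.update_self]
          exact Set.insert_subset hS (hF.sub _ hl)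
        · rw [Function.update_of_ne hlk]; exact hF.sub _ hl
      · rw [hc j l hj hl]
        simp only [St.set_cont]
        rw [hF.cont j l hj hl]
        ext x
        by_cases hlk : l = s.reg k
        · subst hlk
          simp only [Set.mem_ofPred_eq, Function.update_self, Set.mem_insert_iff, true_and]
          constructor
          · rintro (h | ⟨h1, rfl⟩)
            · exact ⟨Or.inr h.1, h.2⟩
            · exact ⟨Or.inl rfl, h1⟩
          · rintro ⟨rfl | h1, h2⟩
            · exact Or.inr ⟨h2, rfl⟩
            · exact Or.inl ⟨h1, h2⟩
        · simp [hlk]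

theorem wp_setDelete {s : St} {Q : St → Prop} {k h : ℕ} (hF : Forest w N s.arr s.cont S A)
    (hd : N < 2 ^ d) (hrh : h < 50) (hk : s.reg k < w)
    (hin : s.reg h ∈ A (s.reg k))
    (hQ : ∀ s', Frame 50 (5 * d + 5) s s' →
      Forest w N s'.arr s'.cont S
        (Function.update A (s.reg k) (A (s.reg k) \ {s.reg h})) → Q s') :
    wp e (setDelete k h) Q s := by
  have hw : 0 < w := by omega
  have h50 : h ≠ 50 := by omega
  have hS : s.reg h ∈ S := hF.sub _ hk hin
  simp only [setDelete, wp_seq, wp_move, wp_load, wp_const]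
  refine wp_climb_delete (k := s.reg k) (h := s.reg h) (i := nodeOf w s.arr (s.reg h)) (N := N)
    hw d ?_ (hF.le _ hS) hF.up ?_ ?_ ?_ ?_ hk ?_ ?_
  · exact lt_of_le_of_lt (hF.le _ hS) hd
  · simp [h50, ← hF.node _ hS]
  · simp
  · simp [h50]
  · simp
  · intro j hj hji
    simp only [St.set_cont]
    rw [hF.cont j _ hj hk]
    exact ⟨hin, hji⟩
  · intro s' hf hc hlow
    have harr : s'.arr = s.arr := by rw [hf.arr]; rfl
    refine hQ s' ⟨fun r hr => ?_, harr, ?_, ?_⟩ ?_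
    · rw [hf.reg r (by omega)]
      have h1 : r ≠ 59 := by omega
      have h2 : r ≠ 54 := by omega
      have h3 : r ≠ 51 := by omega
      have h4 : r ≠ 50 := by omega
      simp [h1, h2, h3, h4]
    · have := hf.clock
      simp only [St.set_clock] at this
      omega
    · rw [hf.ext]; rfl
    · rw [harr]
      refine ⟨hF.node, hF.pos, hF.le, hF.own, hF.up, fun l hl => ?_,
        fun l hl => (hlow l hl).trans (hF.low l hl), fun j l hj hl => ?_⟩
      · by_cases hlk : l = s.reg k
        · subst hlk
          rw [Function.update_self]
          exact Set.sdiff_subset.trans (hF.sub _ hl)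
        · rw [Function.update_of_ne hlk]; exact hF.sub _ hl
      · rw [hc j l hj hl]
        simp only [St.set_cont]
        rw [hF.cont j l hj hl]
        ext x
        by_cases hlk : l = s.reg k
        · subst hlk
          simp only [Set.mem_ofPred_eq, Function.update_self, Set.mem_sdiff, Set.mem_singleton_iff,
            true_and]
          constructor
          · rintro ⟨⟨h1, h2⟩, h3⟩
            exact ⟨⟨h1, fun hx => h3 ⟨hx ▸ h2, hx⟩⟩, h2⟩
          · rintro ⟨⟨h1, h2⟩, h3⟩
            exact ⟨⟨h1, h3⟩, fun hx => h2 hx.2⟩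
        · simp [hlk]

/-- The body of the descent: go to a child whose instance answers yes, or clear register 56. -/
def descend : Prog :=
  .while 59 56 (.add 57 54 54 ;; .add 55 57 50 ;; .detQuery 56 55 51 ;;
    .ite 59 56 (.move 54 57) (.add 57 57 58 ;; .add 55 57 50 ;; .detQuery 56 55 51 ;;
      .ite 59 56 (.move 54 57) .skip))

/-- Search the set whose number is in register `k` for an object that intersects the one in
register `h`.  Register 52 tells whether there is one, register 53 is then its handle. -/
def setFind (w k h : ℕ) : Prog :=
  .move 50 k ;; .move 51 h ;; .const 58 w ;; .const 59 0 ;; .move 54 58 ;; .add 55 54 50 ;;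
  .detQuery 52 55 51 ;; .move 56 52 ;; descend ;; .load 53 3 54

/-- The subtree of `i` contains a witness. If the instances of both children answer no, the witness
sits at `i` itself, and since a node holds one handle, array 3 names it. The hypothesis `N < i * 2 ^
d` bounds the number of levels below `i`. -/
theorem wp_descend {s : St} {Q : St → Prop} {i k h : ℕ} (d : ℕ)
    (hF : Forest w N s.arr s.cont S A) (hi0 : 1 ≤ i) (hi : N < i * 2 ^ d)
    (h54 : s.reg 54 = i * w) (h50 : s.reg 50 = k) (h51 : s.reg 51 = h) (h58 : s.reg 58 = w)
    (h59 : s.reg 59 = 0) (h56 : s.reg 56 = 1)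
    (hk : k < w) (hlive : h ∈ e.live)
    (hex : ∃ x ∈ A k, Anc i (nodeOf w s.arr x) ∧ e.meets h x)
    (hQ : ∀ s', Frame 53 (11 * d + 1) s s' → s'.cont = s.cont →
      (∃ x ∈ A k, s'.reg 54 = s.arr 2 x ∧ e.meets h x) → Q s') :
    wp e descend Q s := by
  have no_child : ∀ {s : St} (_ : Forest w N s.arr s.cont S A) (j), 1 ≤ j →
      ((∃ x ∈ s.cont (j * w + k), e.meets h x) ↔
        ∃ x ∈ A k, Anc j (nodeOf w s.arr x) ∧ e.meets h x) := by
    intro s hF j hj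
    rw [hF.cont j k hj hk]
    simp [and_assoc]
  induction d generalizing s i with
  | zero =>
    obtain ⟨x, hx, hxi, _⟩ := hex
    have := hxi.le
    have := hF.le x (hF.sub k hk hx)
    simp at hi; omega
  | succ d ih =>
    refine wp_while_intro (fun hc => ?_) fun hc => absurd (by rw [h59, h56]; omega) hc
    have e2 : i * w + i * w = (2 * i) * w := by ring
    have e3 : 2 * i * w + w = (2 * i + 1) * w := by ring
    by_cases hl : ∃ x ∈ A k, Anc (2 * i) (nodeOf w s.arr x) ∧ e.meets h x
    · have hl' : ∃ x ∈ s.cont (2 * i * w + k), e.meets h x := (no_child hF _ (by omega)).2 hl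
      simp [h51, h54, h50, h59, e2, hl', hlive]
      refine ih (i := 2 * i) hF (by omega) (by rw [pow_succ] at hi; nlinarith) ?_ ?_ ?_ ?_ ?_ ?_ ?_ ?_
      · simp
      · simp [h50]
      · simp [h51]
      · simp [h58]
      · simp [h59]
      · simp
      · exact hl
      · intro s' hf hc' hx
        refine hQ s' ⟨fun r hr => ?_, ?_, ?_, ?_⟩ hc' hx
        · rw [hf.reg r hr]
          have h1 : r ≠ 54 := by omega
          have h2 : r ≠ 55 := by omega
          have h3 : r ≠ 56 := by omega
          have h4 : r ≠ 57 := by omega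
          simp [h1, h2, h3, h4]
        · rw [hf.arr]; rfl
        · have := hf.clock
          simp only [St.set_clock, St.tick_clock] at this
          omega
        · rw [hf.ext]; rfl
    · have hl' : ¬ ∃ x ∈ s.cont (2 * i * w + k), e.meets h x := fun hh =>
        hl ((no_child hF _ (by omega)).1 hh)
      by_cases hr : ∃ x ∈ A k, Anc (2 * i + 1) (nodeOf w s.arr x) ∧ e.meets h x
      · have hr' : ∃ x ∈ s.cont ((2 * i + 1) * w + k), e.meets h x :=
          (no_child hF _ (by omega)).2 hr
        simp [h51, h54, h50, h58, h59, e2, e3, hl', hr', hlive, -not_exists]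
        refine ih (i := 2 * i + 1) hF (by omega) (by rw [pow_succ] at hi; nlinarith [Nat.zero_le (2 ^ d)])
          ?_ ?_ ?_ ?_ ?_ ?_ ?_ ?_
        · simp
        · simp [h50]
        · simp [h51]
        · simp [h58]
        · simp [h59]
        · simp
        · exact hr
        · intro s' hf hc' hx
          refine hQ s' ⟨fun r hr => ?_, ?_, ?_, ?_⟩ hc' hx
          · rw [hf.reg r hr]
            have h1 : r ≠ 54 := by omega
            have h2 : r ≠ 55 := by omega
            have h3 : r ≠ 56 := by omega
            have h4 : r ≠ 57 := by omega
            simp [h1, h2, h3, h4]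
          · rw [hf.arr]; rfl
          · have := hf.clock
            simp only [St.set_clock, St.tick_clock] at this
            omega
          · rw [hf.ext]; rfl
      · have hr' : ¬ ∃ x ∈ s.cont ((2 * i + 1) * w + k), e.meets h x := fun hh =>
          hr ((no_child hF _ (by omega)).1 hh)
        simp [h51, h54, h50, h58, h59, e2, e3, hl', hr', hlive, -not_exists]
        refine wp_while_intro (fun hc => absurd hc (by simp [h59])) fun _ => ?_
        refine hQ _ ⟨fun r hr => ?_, rfl, ?_, rfl⟩ rfl ?_
        · have h1 : r ≠ 54 := by omega
          have h2 : r ≠ 55 := by omega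
          have h3 : r ≠ 56 := by omega
          have h4 : r ≠ 57 := by omega
          simp [h2, h3, h4]
        · simp only [St.set_clock, St.tick_clock]; omega
        · obtain ⟨x, hx, hxi, hxm⟩ := hex
          refine ⟨x, hx, ?_, hxm⟩
          have : i = nodeOf w s.arr x := by
            rcases anc_child hxi with h | h | h
            · exact h
            · exact absurd ⟨x, hx, h, hxm⟩ hl
            · exact absurd ⟨x, hx, h, hxm⟩ hr
          simp [h54, this, ← hF.node x (hF.sub k hk hx)]

/-- The instance of the root holds the whole set, so one query decides whether there is a witness,
and the descent locates it. If the answer is no, register 56 is zero and the descent ends at once.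
-/
theorem wp_setFind {s : St} {Q : St → Prop} {k h : ℕ} (hF : Forest w N s.arr s.cont S A)
    (hd : N < 2 ^ d) (hrh : h < 50) (hk : s.reg k < w) (hlive : s.reg h ∈ e.live)
    (hQ : ∀ s', Frame 50 (11 * d + 11) s s' → s'.cont = s.cont →
      ((s'.reg 52 = 0 ∧ ∀ x ∈ A (s.reg k), ¬ e.meets (s.reg h) x) ∨
        (s'.reg 52 = 1 ∧ s'.reg 53 ∈ A (s.reg k) ∧ e.meets (s.reg h) (s'.reg 53))) → Q s') :
    wp e (setFind w k h) Q s := by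
  have hw : 0 < w := by omega
  have h50 : h ≠ 50 := by omega
  have hroot : (∃ x ∈ s.cont (w + s.reg k), e.meets (s.reg h) x) ↔
      ∃ x ∈ A (s.reg k), e.meets (s.reg h) x := by
    have := hF.cont 1 (s.reg k) le_rfl hk
    rw [one_mul] at this
    rw [this]
    constructor
    · rintro ⟨x, hx, hm⟩; exact ⟨x, hx.1, hm⟩
    · rintro ⟨x, hx, hm⟩
      exact ⟨x, ⟨hx, anc_one (hF.pos x (hF.sub _ hk hx))⟩, hm⟩
  have hregs : ∀ r, r < 50 → r ≠ 50 ∧ r ≠ 51 ∧ r ≠ 52 ∧ r ≠ 53 ∧ r ≠ 54 ∧ r ≠ 55 ∧ r ≠ 56 ∧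
      r ≠ 57 ∧ r ≠ 58 ∧ r ≠ 59 := by omega
  by_cases hq : ∃ x ∈ A (s.reg k), e.meets (s.reg h) x
  · have hq' := hroot.2 hq
    simp [setFind, h50, hq', hlive]
    refine wp_descend (i := 1) (k := s.reg k) (h := s.reg h) (N := N) (S := S) (A := A) d hF
      le_rfl (by simpa using hd) ?_ ?_ ?_ ?_ ?_ ?_ hk hlive ?_ ?_
    · simp
    · simp
    · simp
    · simp
    · simp
    · simp
    · obtain ⟨x, hx, hm⟩ := hq
      exact ⟨x, hx, anc_one (hF.pos x (hF.sub _ hk hx)), hm⟩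
    · rintro s' hf hc ⟨x, hx, hx54, hm⟩
      refine hQ _ ⟨fun r hr => ?_, ?_, ?_, ?_⟩ hc (Or.inr ?_)
      · obtain ⟨_, _, _, _, _, _, _, _, _, _⟩ := hregs r hr
        simp [*, hf.reg r (by omega)]
      · simp [hf.arr]
      · have := hf.clock
        simp only [St.set_clock] at this ⊢
        omega
      · simp [hf.ext]
      · have h3 : s'.arr 3 (s'.reg 54) = x := by
          rw [hx54, hf.arr]
          exact hF.own x (hF.sub _ hk hx)
        refine ⟨?_, ?_, ?_⟩
        · have := hf.reg 52 (by omega)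
          simpa using this
        · simpa [h3] using hx
        · simpa [h3] using hm
  · have hq' : ¬ ∃ x ∈ s.cont (w + s.reg k), e.meets (s.reg h) x := fun hh => hq (hroot.1 hh)
    simp [setFind, h50, hq', hlive, -not_exists]
    refine wp_while_intro (fun hc => absurd hc (by simp)) fun _ => ?_
    refine hQ _ ⟨fun r hr => ?_, rfl, ?_, rfl⟩ rfl (Or.inl ⟨by simp, ?_⟩)
    · obtain ⟨_, _, _, _, _, _, _, _, _, _⟩ := hregs r hr
      simp [*]
    · simp only [St.set_clock, St.tick_clock]; omega
    · exact fun x hx hm => hq ⟨x, hx, hm⟩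

end witness

/-! ### Allocation of nodes -/

/-- Register 3 is the last node in use so far, and the first cells of array 5 (as many as register 4
says) are the nodes that are free again. -/
structure Slots (w N : ℕ) (reg : ℕ → ℕ) (arr : ℕ → ℕ → ℕ) (S : Finset ℕ) : Prop where
  last : reg 3 = N * w
  count : N = S.card + reg 4
  free : ∀ j < reg 4, ∃ i, 1 ≤ i ∧ i ≤ N ∧ arr 5 j = i * w ∧ ∀ h ∈ S, arr 2 h ≠ i * w
  inj : ∀ j < reg 4, ∀ j' < reg 4, arr 5 j = arr 5 j' → j = j'

theorem Slots.congr {w N : ℕ} {reg reg' : ℕ → ℕ} {arr arr' : ℕ → ℕ → ℕ} {S : Finset ℕ}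
    (h : Slots w N reg arr S) (h3 : reg' 3 = reg 3) (h4 : reg' 4 = reg 4) (h5 : arr' 5 = arr 5)
    (h2 : arr' 2 = arr 2) : Slots w N reg' arr' S :=
  ⟨h3 ▸ h.last, h4 ▸ h.count, by rw [h4, h5, h2]; exact h.free, by rw [h4, h5]; exact h.inj⟩

/-- Give a node to the handle in register 1. -/
def allocNode (w : ℕ) : Prog :=
  .const 59 0 ;; .ite 59 4 (.const 55 1 ;; .sub 4 4 55 ;; .load 54 5 4)
    (.const 55 w ;; .add 3 3 55 ;; .move 54 3 ;; .add 56 3 3 ;; .store 4 56 3 ;; .add 56 56 55 ;;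
      .store 4 56 3) ;; .store 2 1 54 ;; .store 3 54 1

/-- Take the node from the handle in register 1. -/
def freeNode : Prog :=
  .load 54 2 1 ;; .store 5 4 54 ;; .const 55 1 ;; .add 4 4 55

section alloc
variable {e : Env} {w N : ℕ} {S : Finset ℕ} {A : ℕ → Set ℕ}

theorem nodeOf_eq (hw : 0 < w) {arr : ℕ → ℕ → ℕ} {h i : ℕ} (hh : arr 2 h = i * w) :
    nodeOf w arr h = i := by
  rw [nodeOf, hh, Nat.mul_div_cancel _ hw]

theorem Forest.insert_node (hw : 0 < w) {N' i h : ℕ} {arr arr' : ℕ → ℕ → ℕ} {cont : ℕ → Set ℕ}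
    (hF : Forest w N arr cont S A) (hN : N ≤ N') (hS : h ∉ S) (hi : 1 ≤ i) (hiN : i ≤ N')
    (hnew : ∀ x ∈ S, arr 2 x ≠ i * w) (h2 : arr' 2 = Function.update (arr 2) h (i * w))
    (h3 : arr' 3 = Function.update (arr 3) (i * w) h)
    (h4 : ∀ j, j ≤ 2 * N' + 1 → arr' 4 (j * w) = j / 2 * w) :
    Forest w N' arr' cont (insert h S) A := by
  have hne : ∀ x ∈ S, x ≠ h := fun x hx hh => hS (hh ▸ hx)
  have e1 : ∀ x ∈ S, arr' 2 x = arr 2 x := fun x hx => by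
    rw [h2, Function.update_of_ne (hne x hx)]
  have e2 : ∀ x ∈ S, nodeOf w arr' x = nodeOf w arr x := fun x hx => by
    rw [nodeOf, e1 x hx]; rfl
  have e3 : arr' 2 h = i * w := by rw [h2, Function.update_self]
  have e4 : nodeOf w arr' h = i := nodeOf_eq hw e3
  refine ⟨fun x hx => ?_, fun x hx => ?_, fun x hx => ?_, fun x hx => ?_, h4, fun k hk => ?_,
    hF.low, fun j k hj hk => ?_⟩
  · rcases Finset.mem_insert.1 hx with rfl | hx
    · rw [e4, e3]
    · rw [e1 x hx, e2 x hx]; exact hF.node x hx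
  · rcases Finset.mem_insert.1 hx with rfl | hx
    · rw [e4]; exact hi
    · rw [e2 x hx]; exact hF.pos x hx
  · rcases Finset.mem_insert.1 hx with rfl | hx
    · rw [e4]; exact hiN
    · rw [e2 x hx]; exact (hF.le x hx).trans hN
  · rcases Finset.mem_insert.1 hx with rfl | hx
    · rw [e3, h3, Function.update_self]
    · rw [e1 x hx, h3, Function.update_of_ne (hnew x hx)]; exact hF.own x hx
  · exact (hF.sub k hk).trans (by simp)
  · rw [hF.cont j k hj hk]
    ext x
    simp only [Set.mem_ofPred_eq]
    refine and_congr_right fun hx => ?_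
    rw [e2 x (hF.sub k hk hx)]

/-- A free node is reused if there is one. Otherwise node `N + 1` is opened and the parent entries
of its future children are written; nodes are stored as multiples of `w`, so additions suffice. A
node is opened only when all `N` nodes are occupied, which keeps the heap as small as the largest
set of objects so far. -/
theorem wp_allocNode (hw : 0 < w) {s : St} {Q : St → Prop} (hF : Forest w N s.arr s.cont S A)
    (hS : Slots w N s.reg s.arr S) (h1 : s.reg 1 ∉ S)
    (hQ : ∀ s' N', Forest w N' s'.arr s'.cont (insert (s.reg 1) S) A →
      Slots w N' s'.reg s'.arr (insert (s.reg 1) S) → (N' = N ∨ N' = S.card + 1) →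
      (∀ r, r < 50 → r ≠ 3 → r ≠ 4 → s'.reg r = s.reg r) →
      (∀ a, a ≠ 2 → a ≠ 3 → a ≠ 4 → s'.arr a = s.arr a) → s'.clock ≤ s.clock + 20 →
      s'.ext = s.ext → Q s') : wp e (allocNode w) Q s := by
  have hcard : (insert (s.reg 1) S).card = S.card + 1 := Finset.card_insert_of_notMem h1
  by_cases h4 : 0 < s.reg 4
  · obtain ⟨i, hi, hiN, hi5, hiS⟩ := hS.free (s.reg 4 - 1) (by omega)
    simp [allocNode, h4]
    refine hQ _ N (hF.insert_node hw le_rfl h1 hi hiN hiS ?_ ?_ ?_) ⟨?_, ?_, ?_, ?_⟩ (Or.inl rfl)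
      ?_ ?_ ?_ rfl
    · simp [hi5]
    · simp [hi5]
    · intro j hj
      simpa using hF.up j hj
    · simp [hS.last]
    · have := hS.count
      simp [hcard]; omega
    · intro j hj
      simp only [St.put_reg, St.set_reg, Function.update_apply] at hj
      norm_num at hj
      obtain ⟨i', hi', hiN', hi5', hiS'⟩ := hS.free j (by omega)
      refine ⟨i', hi', hiN', by simpa using hi5', fun x hx => ?_⟩
      rcases Finset.mem_insert.1 hx with rfl | hx
      · simp [hi5]
        refine ⟨fun h => ?_, hw.ne'⟩
        have := hS.inj j (by omega) (s.reg 4 - 1) (by omega) (by rw [hi5', hi5, ← h])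
        omega
      · have : x ≠ s.reg 1 := fun hh => h1 (hh ▸ hx)
        simpa [this] using hiS' x hx
    · intro j hj j' hj'
      simp only [St.put_reg, St.set_reg, Function.update_apply] at hj hj'
      norm_num at hj hj'
      simpa using hS.inj j (by omega) j' (by omega)
    · intro r hr h3 h4
      have : r ≠ 59 ∧ r ≠ 55 ∧ r ≠ 54 := by omega
      simp [h4, this]
    · intro a h2 h3 h4
      simp [h2, h3]
    · simp
  · have h40 : s.reg 4 = 0 := by omega
    have e0 : (2 * N + 2) * w ≠ (2 * N + 3) * w := by
      intro hh; have := Nat.eq_of_mul_eq_mul_right hw hh; omega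
    have e1 : N * w + w = (N + 1) * w := by ring
    have e2 : (N + 1) * w + (N + 1) * w = (2 * N + 2) * w := by ring
    have e3 : (2 * N + 2) * w + w = (2 * N + 3) * w := by ring
    simp [allocNode, h40, hS.last, e1, e2, e3]
    refine hQ _ (N + 1) (hF.insert_node hw (by omega) h1 (i := N + 1) (by omega) le_rfl ?_ ?_ ?_ ?_)
      ⟨?_, ?_, ?_, ?_⟩ (Or.inr ?_) ?_ ?_ ?_ rfl
    · intro x hx hh
      have := hF.le x hx
      rw [nodeOf_eq hw hh] at this
      omega
    · simp
    · simp
    · intro j hj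
      have c1 : j * w = (2 * N + 3) * w ↔ j = 2 * N + 3 :=
        ⟨fun h => Nat.eq_of_mul_eq_mul_right hw h, fun h => by rw [h]⟩
      have c2 : j * w = (2 * N + 2) * w ↔ j = 2 * N + 2 :=
        ⟨fun h => Nat.eq_of_mul_eq_mul_right hw h, fun h => by rw [h]⟩
      simp [Function.update_apply (Function.update (s.arr 4) _ _),
        Function.update_apply (s.arr 4), -mul_eq_mul_right_iff, c1, c2]
      by_cases d1 : j = 2 * N + 3
      · rw [if_pos d1]; congr 1; omega
      by_cases d2 : j = 2 * N + 2
      · rw [if_neg d1, if_pos d2]; congr 1; omega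
      · rw [if_neg d1, if_neg d2]; exact hF.up j (by omega)
    · simp
    · have := hS.count
      simp [hcard]; omega
    · intro j hj
      simp [h40] at hj
    · intro j hj
      simp [h40] at hj
    · have := hS.count; omega
    · intro r hr h3 h4
      have : r ≠ 59 ∧ r ≠ 55 ∧ r ≠ 54 ∧ r ≠ 56 := by omega
      simp [h3, this]
    · intro a h2 h3 h4
      simp [h2, h3, h4]
    · simp

/-- The handle has left all sets before, so no instance refers to its node. Stale array entries may
stay, since no invariant speaks of a node without a handle. -/
theorem wp_freeNode {s : St} {Q : St → Prop} (hF : Forest w N s.arr s.cont S A)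
    (hS : Slots w N s.reg s.arr S) (h1 : s.reg 1 ∈ S) (hA : ∀ k < w, s.reg 1 ∉ A k)
    (hQ : ∀ s', Forest w N s'.arr s'.cont (S.erase (s.reg 1)) A →
      Slots w N s'.reg s'.arr (S.erase (s.reg 1)) →
      (∀ r, r < 50 → r ≠ 4 → s'.reg r = s.reg r) →
      (∀ a, a ≠ 5 → s'.arr a = s.arr a) → s'.clock ≤ s.clock + 20 →
      s'.ext = s.ext → Q s') : wp e freeNode Q s := by
  have hsub : ∀ x ∈ S.erase (s.reg 1), x ∈ S := fun x hx => Finset.mem_of_mem_erase hx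
  have hne : ∀ x ∈ S.erase (s.reg 1), s.arr 2 x ≠ s.arr 2 (s.reg 1) := fun x hx hh => by
    have h2 := hF.own x (hsub x hx)
    rw [hh, hF.own _ h1] at h2
    exact Finset.ne_of_mem_erase hx h2.symm
  have hcard := Finset.card_erase_add_one h1
  have hle : S.card ≤ N := by have := hS.count; omega
  simp [freeNode]
  refine hQ _ ⟨fun x hx => hF.node x (hsub x hx), fun x hx => hF.pos x (hsub x hx),
    fun x hx => hF.le x (hsub x hx), fun x hx => hF.own x (hsub x hx), hF.up, fun k hk x hx => ?_,
    hF.low, hF.cont⟩ ⟨?_, ?_, ?_, ?_⟩ ?_ ?_ ?_ rfl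
  · exact Finset.mem_coe.2 (Finset.mem_erase.2 ⟨fun hh => hA k hk (hh ▸ hx), hF.sub k hk hx⟩)
  · simpa using hS.last
  · have := hS.count
    simp; omega
  · intro j hj
    simp at hj
    by_cases hj4 : j = s.reg 4
    · exact ⟨_, hF.pos _ h1, hF.le _ h1, by simp [hj4, ← hF.node _ h1],
        fun x hx => by simpa [← hF.node _ h1] using hne x hx⟩
    · obtain ⟨i, h2, h3, h4, h5⟩ := hS.free j (by omega)
      exact ⟨i, h2, h3, by simpa [hj4] using h4, fun x hx => by simpa using h5 x (hsub x hx)⟩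
  · intro j hj j' hj'
    simp at hj hj'
    have old : ∀ j < s.reg 4, s.arr 5 j ≠ s.arr 2 (s.reg 1) := fun j hj hh => by
      obtain ⟨i, h2, h3, h4, h5⟩ := hS.free j hj
      exact h5 _ h1 (by rw [← hh, h4])
    by_cases a : j = s.reg 4 <;> by_cases b : j' = s.reg 4
    · intro _; omega
    · have := old j' (by omega)
      intro hh
      simp [a, b] at hh
      exact absurd hh.symm this
    · have := old j (by omega)
      intro hh
      simp [a, b] at hh
      exact absurd hh this
    · simpa [a, b] using hS.inj j (by omega) j' (by omega)
  · intro r hr h4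
    have : r ≠ 55 ∧ r ≠ 54 := by omega
    simp [h4, this]
  · intro a h5
    simp [h5]
  · simp

end alloc

/-! ### The list of the cover -/

/-- The first cells of array 0 (as many as register 2 says) list `C`; array 1 holds the positions. -/
structure CoverList (len : ℕ) (arr : ℕ → ℕ → ℕ) (C : Finset ℕ) : Prop where
  idx : ∀ i < len, arr 0 i ∈ C ∧ arr 1 (arr 0 i) = i + 1
  pos : ∀ h ∈ C, 1 ≤ arr 1 h ∧ arr 1 h ≤ len ∧ arr 0 (arr 1 h - 1) = h
  out : ∀ h, h ∉ C → arr 1 h = 0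

theorem CoverList.congr {len : ℕ} {arr arr' : ℕ → ℕ → ℕ} {C : Finset ℕ}
    (h : CoverList len arr C) (h0 : arr' 0 = arr 0) (h1 : arr' 1 = arr 1) :
    CoverList len arr' C := by
  refine ⟨?_, ?_, ?_⟩
  · rw [h0, h1]; exact h.idx
  · rw [h0, h1]; exact h.pos
  · rw [h1]; exact h.out

theorem CoverList.card {len : ℕ} {arr : ℕ → ℕ → ℕ} {C : Finset ℕ} (h : CoverList len arr C) :
    C.card = len := by
  rw [← Finset.card_range len]
  symm
  refine Finset.card_bij (fun i _ => arr 0 i) (fun i hi => (h.idx i (Finset.mem_range.1 hi)).1) ?_ ?_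
  · intro i hi j hj hij
    have h1 := (h.idx i (Finset.mem_range.1 hi)).2
    have h2 := (h.idx j (Finset.mem_range.1 hj)).2
    rw [hij, h2] at h1
    omega
  · intro x hx
    obtain ⟨h1, h2, h3⟩ := h.pos x hx
    exact ⟨arr 1 x - 1, Finset.mem_range.2 (by omega), h3⟩

/-- Append the handle in register `r` to the cover. -/
def pushCover (r : ℕ) : Prog := .store 0 2 r ;; .const 55 1 ;; .add 2 2 55 ;; .store 1 r 2

/-- Remove the handle in register 1 from the cover. -/
def removeCover : Prog :=
  .load 55 1 1 ;; .const 56 1 ;; .sub 55 55 56 ;; .sub 2 2 56 ;; .load 57 0 2 ;; .store 0 55 57 ;;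
  .add 55 55 56 ;; .store 1 57 55 ;; .const 59 0 ;; .store 1 1 59

section cover
variable {e : Env} {C : Finset ℕ}

theorem CoverList.push {len h : ℕ} {arr arr' : ℕ → ℕ → ℕ} (hC : CoverList len arr C) (hh : h ∉ C)
    (h0 : arr' 0 = Function.update (arr 0) len h) (h1 : arr' 1 = Function.update (arr 1) h (len + 1)) :
    CoverList (len + 1) arr' (insert h C) := by
  refine ⟨fun i hi => ?_, fun x hx => ?_, fun x hx => ?_⟩
  · rw [h0, h1]
    by_cases hil : i = len
    · subst hil; simp
    · have h2 := hC.idx i (by omega)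
      have h3 : arr 0 i ≠ h := fun h' => hh (h' ▸ h2.1)
      simp [hil, h2, h3]
  · rw [h0, h1]
    rcases Finset.mem_insert.1 hx with rfl | hx
    · simp
    · have h2 := hC.pos x hx
      have h3 : x ≠ h := fun h' => hh (h' ▸ hx)
      have h4 : arr 1 x - 1 ≠ len := by omega
      simp only [ne_eq, h3, not_false_eq_true, Function.update_of_ne, h4]
      exact ⟨h2.1, by omega, h2.2.2⟩
  · rw [Finset.mem_insert, not_or] at hx
    rw [h1, Function.update_of_ne hx.1]
    exact hC.out x hx.2

theorem wp_pushCover {s : St} {Q : St → Prop} {r : ℕ} (hC : CoverList (s.reg 2) s.arr C)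
    (hr : r < 50) (hr2 : r ≠ 2) (hh : s.reg r ∉ C)
    (hQ : ∀ s', CoverList (s'.reg 2) s'.arr (insert (s.reg r) C) →
      (∀ r, r < 50 → r ≠ 2 → s'.reg r = s.reg r) → s'.reg 2 = s.reg 2 + 1 →
      (∀ a, a ≠ 0 → a ≠ 1 → s'.arr a = s.arr a) → s'.cont = s.cont →
      s'.clock ≤ s.clock + 10 → s'.ext = s.ext → Q s') : wp e (pushCover r) Q s := by
  have hr55 : r ≠ 55 := by omega
  simp [pushCover, hr2, hr55]
  refine hQ _ ?_ ?_ ?_ ?_ rfl ?_ rfl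
  · have := hC.push hh (arr' := Function.update (Function.update s.arr 0
      (Function.update (s.arr 0) (s.reg 2) (s.reg r))) 1
      (Function.update (s.arr 1) (s.reg r) (s.reg 2 + 1))) (by simp) (by simp)
    simpa using this
  · intro r hr hr2
    have : r ≠ 55 := by omega
    simp [hr2, this]
  · simp
  · intro a h0 h1
    simp [h0, h1]
  · simp

/-- The last entry moves into the gap. If the removed handle is itself the last entry, its position
is first rewritten and then cleared, so the order of the stores matters. -/
theorem wp_removeCover {s : St} {Q : St → Prop} (hC : CoverList (s.reg 2) s.arr C)
    (hh : s.reg 1 ∈ C)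
    (hQ : ∀ s', CoverList (s'.reg 2) s'.arr (C.erase (s.reg 1)) →
      (∀ r, r < 50 → r ≠ 2 → s'.reg r = s.reg r) → s'.reg 2 + 1 = s.reg 2 →
      (∀ a, a ≠ 0 → a ≠ 1 → s'.arr a = s.arr a) → s'.cont = s.cont →
      s'.clock ≤ s.clock + 10 → s'.ext = s.ext → Q s') : wp e removeCover Q s := by
  obtain ⟨p1, p2, p3⟩ := hC.pos _ hh
  have l1 := hC.idx (s.reg 2 - 1) (by omega)
  have e1 : s.arr 1 (s.reg 1) - 1 + 1 = s.arr 1 (s.reg 1) := by omega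
  simp [removeCover, e1]
  refine hQ _ ⟨?_, ?_, ?_⟩ ?_ ?_ ?_ rfl ?_ rfl
  · intro i hi
    simp at hi
    have l2 := hC.idx i (by omega)
    by_cases hi1 : i = s.arr 1 (s.reg 1) - 1
    · subst hi1
      have hne : s.arr 0 (s.reg 2 - 1) ≠ s.reg 1 := fun h => by
        rw [h] at l1; omega
      simp [hne, l1.1, e1]
    · have hne : s.arr 0 i ≠ s.reg 1 := fun h => by
        rw [h] at l2; omega
      have hne2 : s.arr 0 i ≠ s.arr 0 (s.reg 2 - 1) := fun h => by
        rw [h] at l2; omega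
      simp [hi1, hne, hne2, l2]
  · intro x hx
    obtain ⟨hx1, hx2⟩ := Finset.mem_erase.1 hx
    have l2 := hC.pos x hx2
    by_cases hxl : x = s.arr 0 (s.reg 2 - 1)
    · have hlast : s.arr 1 x = s.reg 2 := by rw [hxl, l1.2]; omega
      have : s.arr 1 (s.reg 1) ≠ s.reg 2 := fun h => by
        rw [h] at p3; exact hx1 (hxl.trans p3)
      have hne : s.arr 0 (s.reg 2 - 1) ≠ s.reg 1 := hxl ▸ hx1
      simp [hxl, hne]
      omega
    · have h3 : s.arr 1 x ≠ s.reg 2 := fun h => by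
        rw [h] at l2; exact hxl l2.2.2.symm
      have h4 : s.arr 1 x - 1 ≠ s.arr 1 (s.reg 1) - 1 := fun h => by
        have := l2.2.2
        rw [h, p3] at this; exact hx1 this.symm
      simp [hxl, hx1, h4]
      exact ⟨l2.1, by omega, l2.2.2⟩
  · intro x hx
    by_cases hx1 : x = s.reg 1
    · simp [hx1]
    · have hxC : x ∉ C := fun h => hx (Finset.mem_erase.2 ⟨hx1, h⟩)
      have hxl : x ≠ s.arr 0 (s.reg 2 - 1) := fun h => hxC (h ▸ l1.1)
      simpa [hx1, hxl] using hC.out x hxC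
  · intro r hr hr2
    have : r ≠ 55 ∧ r ≠ 56 ∧ r ≠ 57 ∧ r ≠ 59 := by omega
    simp [hr2, this]
  · simp; omega
  · intro a h0 h1
    simp [h0, h1]
  · simp

end cover

/-! ### The auction: invariants -/

/-- The state of a running auction.  The first `n` cells of `stk` are left vertices that wait for
their turn, the vertices in `X` are having their turn, no untouched vertex is interested in
a `scanned` vertex, and `k` vertices have been touched ahead of the price increases that pay for them. -/
structure Bidding (adj : ℕ → ℕ → Prop) (S C V : Finset ℕ) (L : ℕ) (p ow mt stk : ℕ → ℕ) (n : ℕ)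
    (X scanned : Set ℕ) (k : ℕ) : Prop where
  auc : Auction adj S V L p ow mt
  cover : C ⊆ V
  stk_mem : ∀ i < n, stk i ∈ V ∧ mt (stk i) = 0 ∧ stk i ∉ X
  stk_inj : ∀ i < n, ∀ j < n, stk i = stk j → i = j
  turn : ∀ l ∈ X, l ∈ V ∧ mt l = 0
  pend : ∀ l ∈ V, mt l = 0 → l ∈ X ∨ (∃ i < n, stk i = l) ∨ ∀ r ∈ S, adj l r → L ≤ p r
  scan : ∀ u ∈ scanned, ∀ x ∈ S, x ∉ V → adj u x → L ≤ p u
  count : V.card ≤ C.card + 2 * ∑ v ∈ S, p v + k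

namespace Bidding
variable {adj : ℕ → ℕ → Prop} {S C V : Finset ℕ} {L : ℕ} {p ow mt stk : ℕ → ℕ} {n : ℕ}
  {X scanned : Set ℕ} {k : ℕ}

theorem pop (h : Bidding adj S C V L p ow mt stk (n + 1) ∅ scanned k) :
    Bidding adj S C V L p ow mt stk n {stk n} scanned k where
  auc := h.auc
  cover := h.cover
  stk_mem i hi := by
    obtain ⟨h1, h2, _⟩ := h.stk_mem i (by omega)
    refine ⟨h1, h2, fun hh => ?_⟩
    have := h.stk_inj i (by omega) n (by omega) hh
    omega
  stk_inj i hi j hj := h.stk_inj i (by omega) j (by omega)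
  turn l hl := by
    obtain ⟨h1, h2, _⟩ := h.stk_mem n (by omega)
    rw [Set.mem_singleton_iff] at hl
    exact hl ▸ ⟨h1, h2⟩
  pend l hl hm := by
    rcases h.pend l hl hm with h1 | ⟨i, hi, h1⟩ | h1
    · exact absurd h1 (Set.notMem_empty _)
    · by_cases hin : i = n
      · left; rw [← h1, hin]; rfl
      · exact Or.inr (Or.inl ⟨i, by omega, h1⟩)
    · exact Or.inr (Or.inr h1)
  scan := h.scan
  count := h.count

/-- Prices never fall, so a bidder all of whose neighbours cost `L` need not wait again. -/
theorem drop {l : ℕ} (h : Bidding adj S C V L p ow mt stk n {l} scanned k)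
    (hl : ∀ r ∈ S, adj l r → L ≤ p r) : Bidding adj S C V L p ow mt stk n ∅ scanned k where
  auc := h.auc
  cover := h.cover
  stk_mem i hi := ⟨(h.stk_mem i hi).1, (h.stk_mem i hi).2.1, Set.notMem_empty _⟩
  stk_inj := h.stk_inj
  turn l hl := absurd hl (Set.notMem_empty _)
  pend m hm hm0 := by
    rcases h.pend m hm hm0 with h1 | h1
    · exact Or.inr (Or.inr (h1 ▸ hl))
    · exact Or.inr h1
  scan := h.scan
  count := h.count

theorem auction_insert (h : Auction adj S V L p ow mt) {x : ℕ} (hx : x ∈ S) :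
    Auction adj S (insert x V) L p ow mt :=
  { h with
    out := fun v hv => h.out v fun hh => hv (Finset.mem_insert_of_mem hh)
    sub := Finset.insert_subset hx h.sub }

/-- A vertex found by the scan bids at once without entering the stack; its touch is put on credit
in `k`. -/
theorem enter {x : ℕ} (h : Bidding adj S C V L p ow mt stk n ∅ scanned k) (hx : x ∈ S)
    (hxV : x ∉ V) : Bidding adj S C (insert x V) L p ow mt stk n {x} scanned (k + 1) where
  auc := auction_insert h.auc hx
  cover := h.cover.trans (Finset.subset_insert _ _)
  stk_mem i hi := by
    obtain ⟨h1, h2, _⟩ := h.stk_mem i hi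
    exact ⟨Finset.mem_insert_of_mem h1, h2, fun hh => hxV (hh ▸ h1)⟩
  stk_inj := h.stk_inj
  turn l hl := by
    rw [Set.mem_singleton_iff] at hl
    subst hl
    exact ⟨Finset.mem_insert_self _ _, (h.auc.out _ hxV).2⟩
  pend l hl hm := by
    rcases Finset.mem_insert.1 hl with rfl | hl
    · exact Or.inl rfl
    · rcases h.pend l hl hm with h1 | h1
      · exact absurd h1 (Set.notMem_empty _)
      · exact Or.inr h1
  scan u hu y hy hyV := h.scan u hu y hy fun hh => hyV (Finset.mem_insert_of_mem hh)
  count := by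
    rw [Finset.card_insert_of_notMem hxV]
    have := h.count
    omega

/-- A vertex touched because it is about to be bought has an unmatched left copy, which has to get
its own turn later. Therefore it is pushed on the stack, also on credit. -/
theorem touch {x : ℕ} {stk' : ℕ → ℕ} (h : Bidding adj S C V L p ow mt stk n X scanned k)
    (hx : x ∈ S) (hxV : x ∉ V) (hstk : stk' = Function.update stk n x) :
    Bidding adj S C (insert x V) L p ow mt stk' (n + 1) X scanned (k + 1) where
  auc := auction_insert h.auc hx
  cover := h.cover.trans (Finset.subset_insert _ _)
  stk_mem i hi := by
    by_cases hin : i = n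
    · subst hin
      rw [hstk, Function.update_self]
      exact ⟨Finset.mem_insert_self _ _, (h.auc.out _ hxV).2, fun hh => hxV (h.turn _ hh).1⟩
    · rw [hstk, Function.update_of_ne hin]
      obtain ⟨h1, h2, h3⟩ := h.stk_mem i (by omega)
      exact ⟨Finset.mem_insert_of_mem h1, h2, h3⟩
  stk_inj i hi j hj := by
    have key : ∀ i < n, stk i ≠ x := fun i hi hh => hxV (hh ▸ (h.stk_mem i hi).1)
    by_cases a : i = n <;> by_cases b : j = n
    · intro _; omega
    · intro hh
      simp only [hstk, a, Function.update_self, Function.update_of_ne b] at hh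
      exact absurd hh.symm (key j (by omega))
    · intro hh
      simp only [hstk, b, Function.update_self, Function.update_of_ne a] at hh
      exact absurd hh (key i (by omega))
    · rw [hstk, Function.update_of_ne a, Function.update_of_ne b]
      exact h.stk_inj i (by omega) j (by omega)
  turn l hl := ⟨Finset.mem_insert_of_mem (h.turn l hl).1, (h.turn l hl).2⟩
  pend l hl hm := by
    rcases Finset.mem_insert.1 hl with rfl | hl
    · exact Or.inr (Or.inl ⟨n, by omega, by rw [hstk, Function.update_self]⟩)
    · rcases h.pend l hl hm with h1 | ⟨i, hi, h1⟩ | h1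
      · exact Or.inl h1
      · exact Or.inr (Or.inl ⟨i, by omega, by rw [hstk, Function.update_of_ne (by omega)]; exact h1⟩)
      · exact Or.inr (Or.inr h1)
  scan u hu y hy hyV := h.scan u hu y hy fun hh => hyV (Finset.mem_insert_of_mem hh)
  count := by
    rw [Finset.card_insert_of_notMem hxV]
    have := h.count
    omega

theorem sum_update {x : ℕ} (hx : x ∈ S) :
    ∑ v ∈ S, Function.update p x (p x + 1) v = ∑ v ∈ S, p v + 1 := by
  rw [← Finset.add_sum_erase _ _ hx, ← Finset.add_sum_erase S (fun v => p v) hx,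
    Function.update_self, Finset.sum_congr rfl (g := fun v => p v)]
  · ring
  · intro y hy
    rw [Function.update_of_ne (Finset.ne_of_mem_erase hy)]

/-- The vertex `l` gets `x`, after the previous owner of `x` has been thrown out. -/
theorem win {l x n' : ℕ} {p' ow' mt' stk' mt₀ : ℕ → ℕ}
    (h : Bidding adj S C V L p ow mt stk n {l} scanned (k + 2))
    (hxV : x ∈ V) (hadj : adj l x) (hpx : p x < L)
    (hmin : ∀ r ∈ S, adj l r → p x ≤ p r)
    (hp : p' = Function.update p x (p x + 1)) (how : ow' = Function.update ow x (l + 1))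
    (hmt : mt' = Function.update mt₀ l (x + 1))
    (hprev : (ow x = 0 ∧ n' = n ∧ stk' = stk ∧ mt₀ = mt) ∨
      ∃ q, ow x = q + 1 ∧ n' = n + 1 ∧ stk' = Function.update stk n q ∧
        mt₀ = Function.update mt q 0) :
    Bidding adj S C V L p' ow' mt' stk' n' ∅ scanned k := by
  have hl := h.turn l rfl
  have hxS := h.auc.sub hxV
  have hinv := h.auc.inv
  -- In both cases `mt₀` is `mt` with the previous owner of `x`, if there is one, unmatched.
  have hmt0 : ∀ v, mt₀ v = if ow x = v + 1 then 0 else mt v := by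
    intro v
    rcases hprev with ⟨h1, _, _, h2⟩ | ⟨q, h1, _, _, h2⟩
    · rw [if_neg (by omega), h2]
    · rw [h2]
      by_cases hv : v = q
      · subst hv; rw [Function.update_self, if_pos h1]
      · rw [Function.update_of_ne hv, if_neg (by omega)]
  have hmtl : mt₀ l = 0 := by rw [hmt0]; split_ifs; rfl; exact hl.2
  have hmt' : ∀ v, mt' v = if v = l then x + 1 else if ow x = v + 1 then 0 else mt v := by
    intro v
    rw [hmt, Function.update_apply, hmt0]
  have how' : ∀ v, ow' v = if v = x then l + 1 else ow v := fun v => by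
    rw [how, Function.update_apply]
  have hp' : ∀ v, p' v = if v = x then p x + 1 else p v := fun v => by
    rw [hp, Function.update_apply]
  -- Prices only rise. This preserves `pend` and `scan`, and also `cheap` for everybody who keeps a
  -- vertex other than `x`.
  have hpp : ∀ v, p v ≤ p' v := fun v => by rw [hp']; split_ifs with hv; subst hv; omega; exact le_rfl
  -- the left vertices that are still matched as before
  have hold : ∀ m r, m ≠ l → mt' m = r + 1 → mt m = r + 1 ∧ r ≠ x := by
    intro m r hm hr
    rw [hmt', if_neg hm] at hr
    split_ifs at hr with h1
    refine ⟨hr, fun hrx => ?_⟩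
    have := (hinv m r).1 hr
    rw [hrx] at this
    exact h1 this
  have hstk : ∀ i < n', (i < n ∧ stk' i = stk i) ∨ (i = n ∧ ow x = stk' i + 1) := by
    intro i hi
    rcases hprev with ⟨_, h1, h2, _⟩ | ⟨q, h0, h1, h2, _⟩
    · exact Or.inl ⟨by omega, by rw [h2]⟩
    · by_cases hin : i = n
      · exact Or.inr ⟨hin, by rw [h2, hin, Function.update_self, h0]⟩
      · exact Or.inl ⟨by omega, by rw [h2, Function.update_of_ne hin]⟩
  have hstk2 : ∀ i < n, i < n' ∧ stk' i = stk i := by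
    intro i hi
    rcases hprev with ⟨_, h1, h2, _⟩ | ⟨q, h0, h1, h2, _⟩
    · exact ⟨by omega, by rw [h2]⟩
    · exact ⟨by omega, by rw [h2, Function.update_of_ne (by omega)]⟩
  have hprevmt : ∀ q, ow x = q + 1 → mt q = x + 1 := fun q hq => (hinv q x).2 hq
  have hpush : ∀ m, ow x = m + 1 → ∃ i < n', stk' i = m := by
    intro m hm
    rcases hprev with ⟨h1, _⟩ | ⟨q, h0, h1, h2, _⟩
    · omega
    · exact ⟨n, by omega, by rw [h2, Function.update_self]; omega⟩
  clear hprev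
  refine ⟨⟨?_, ?_, ?_, ?_, ?_, ?_, h.auc.sub⟩, h.cover, ?_, ?_, ?_, ?_, ?_, ?_⟩
  · intro m r
    rw [hmt', how']
    by_cases hm : m = l
    · subst hm
      by_cases hr : r = x
      · simp [hr]
      · have : ow r ≠ m + 1 := fun hh => by
          have := (hinv m r).2 hh
          omega
        simp [this, hr, Ne.symm hr]
    · by_cases hr : r = x
      · subst hr
        simp only [hm, if_false, if_true]
        constructor
        · intro hh
          split_ifs at hh with h1
          exact absurd ((hinv m r).1 hh) h1
        · intro hh; omega
      · simp only [hm, hr, if_false]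
        split_ifs with h1
        · constructor
          · exact fun hh => hh.elim
          · intro hh
            have h2 := (hinv m r).2 hh
            have h3 := hprevmt m h1
            omega
        · exact hinv m r
  · intro r
    rw [how', hp']
    split_ifs
    · simp
    · exact h.auc.priced r
  · intro r
    rw [hp']
    split_ifs
    · omega
    · exact h.auc.le r
  · intro m r hm
    by_cases hml : m = l
    · rw [hmt', if_pos hml] at hm
      have : r = x := by omega
      exact hml ▸ this ▸ hadj
    · exact h.auc.nbr m r (hold m r hml hm).1
  -- The bidder took a cheapest neighbour, whose new price exceeds that of any other by at most the
  -- unit that `cheap` allows.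
  · intro m r hm r' hr' hmr'
    by_cases hml : m = l
    · rw [hmt', if_pos hml] at hm
      have hrx : r = x := by omega
      have h1 := hmin r' hr' (hml ▸ hmr')
      have h2 := hpp r'
      rw [hrx, hp', if_pos rfl]
      omega
    · obtain ⟨h1, h2⟩ := hold m r hml hm
      have h3 := h.auc.cheap m r h1 r' hr' hmr'
      have h4 := hpp r'
      rw [hp' r, if_neg h2]
      omega
  · intro v hv
    have h1 := h.auc.out v hv
    have h2 : v ≠ x := fun hh => hv (hh ▸ hxV)
    have h3 : v ≠ l := fun hh => hv (hh ▸ hl.1)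
    rw [hp', if_neg h2, hmt', if_neg h3]
    refine ⟨h1.1, ?_⟩
    split_ifs
    · rfl
    · exact h1.2
  · intro i hi
    refine ⟨?_, ?_, Set.notMem_empty _⟩
    · rcases hstk i hi with ⟨h1, h2⟩ | ⟨_, h2⟩
      · rw [h2]; exact (h.stk_mem i h1).1
      · exact h.auc.mem_of_mt (by rw [hprevmt _ h2]; omega)
    · rcases hstk i hi with ⟨h1, h2⟩ | ⟨_, h2⟩
      · obtain ⟨_, h3, h4⟩ := h.stk_mem i h1
        rw [h2, hmt', if_neg (show stk i ≠ l from h4)]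
        split_ifs
        · rfl
        · exact h3
      · have h3 := hprevmt _ h2
        have h4 : stk' i ≠ l := fun hh => by rw [hh, hl.2] at h3; omega
        rw [hmt', if_neg h4, if_pos h2]
  · intro i hi j hj hij
    have key : ∀ i < n, ow x ≠ stk i + 1 := fun i hi hh => by
      have h1 := hprevmt _ hh
      have h2 := (h.stk_mem i hi).2.1
      omega
    rcases hstk i hi with ⟨h1, h2⟩ | ⟨h1, h2⟩ <;> rcases hstk j hj with ⟨h3, h4⟩ | ⟨h3, h4⟩
    · exact h.stk_inj i h1 j h3 (by rw [← h2, ← h4, hij])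
    · exact absurd (by rw [h4, ← hij, h2]) (key i h1)
    · exact absurd (by rw [h2, hij, h4]) (key j h3)
    · omega
  · exact fun l hl => absurd hl (Set.notMem_empty _)
  · intro m hm hm0
    have hml : m ≠ l := fun hh => by rw [hmt', if_pos hh] at hm0; omega
    by_cases hq : ow x = m + 1
    · exact Or.inr (Or.inl (hpush m hq))
    · rw [hmt', if_neg hml, if_neg hq] at hm0
      rcases h.pend m hm hm0 with h1 | ⟨i, hi, h1⟩ | h1
      · exact absurd h1 hml
      · exact Or.inr (Or.inl ⟨i, (hstk2 i hi).1, by rw [(hstk2 i hi).2, h1]⟩)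
      · exact Or.inr (Or.inr fun r hr hmr => (h1 r hr hmr).trans (hpp r))
  · exact fun u hu y hy hyV huy => (h.scan u hu y hy hyV huy).trans (hpp u)
  -- One raise pays for two touched vertices, which takes the credit from `k + 2` down to `k`.
  · rw [hp, sum_update hxS]
    have := h.count
    omega

/-- When everybody had their turn and the cover has been scanned, the auction is over. -/
theorem done (h : Bidding adj S C V L p ow mt stk 0 ∅ scanned k) (hC : IsCov adj S C)
    (hsymm : ∀ u v, adj u v → adj v u) (hs : ∀ u ∈ C, u ∈ scanned) :
    ∀ l ∈ S, mt l = 0 → ∀ r ∈ S, adj l r → L ≤ p r := by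
  intro l hl hm r hr hlr
  by_cases hV : l ∈ V
  · rcases h.pend l hV hm with h1 | ⟨i, hi, _⟩ | h1
    · exact absurd h1 (Set.notMem_empty _)
    · omega
    · exact h1 r hr hlr
  · rcases hC.2 l hl r hr hlr with h1 | h1
    · exact absurd (h.cover h1) hV
    · exact h.scan r (hs r h1) l hl hV (hsymm _ _ hlr)

end Bidding

/-! ### The auction: programs -/

/-- Find the first level below `L` with an object that intersects the one in register 21. -/
def findLevel (L : ℕ) : Prog :=
  .const 25 0 ;; .const 26 L ;; .const 27 0 ;;
  .while 25 26 (setFind (L + 2) 25 21 ;; .const 29 0 ;;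
    .ite 29 52 (.move 27 52 ;; .move 28 53 ;; .const 26 0) (.const 29 1 ;; .add 25 25 29))

/-- Find the cheapest neighbour of the vertex in register 21. -/
def findCheapest (L : ℕ) : Prog :=
  .load 22 6 21 ;; setDelete 22 21 ;; findLevel L ;; setInsert 22 21

section auction
variable {e : Env} {L N d : ℕ} {S : Finset ℕ} {A : ℕ → Set ℕ}

/-- Levels are searched in increasing order, so the first hit is a cheapest vertex. Register 26 is
the bound of the loop, and clearing it after a hit ends the loop while register 25 keeps the level.
The clock bound includes register 27 because the successful search does not advance register 25. -/
theorem wp_findLevel {s : St} {Q : St → Prop} (hF : Forest (L + 2) N s.arr s.cont S A)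
    (hd : N < 2 ^ d) (hlive : s.reg 21 ∈ e.live)
    (hQ : ∀ s', Frame 25 ((11 * d + 20) * (L + 1)) s s' → s'.cont = s.cont →
      ((s'.reg 27 = 0 ∧ ∀ k < L, ∀ x ∈ A k, ¬ e.meets (s.reg 21) x) ∨
        (s'.reg 27 = 1 ∧ s'.reg 25 < L ∧ s'.reg 28 ∈ A (s'.reg 25) ∧
          e.meets (s.reg 21) (s'.reg 28) ∧
          ∀ k < s'.reg 25, ∀ x ∈ A k, ¬ e.meets (s.reg 21) x)) → Q s') :
    wp e (findLevel L) Q s := by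
  simp only [findLevel, wp_seq, wp_const]
  set s₁ := ((s.set 25 0).set 26 L).set 27 0 with hs₁
  refine wp_while (fun s' => (∀ r, r < 25 → s'.reg r = s.reg r) ∧ s'.arr = s.arr ∧
      s'.ext = s.ext ∧ s'.cont = s.cont ∧
      s'.clock ≤ s.clock + 3 + (11 * d + 20) * (s'.reg 25 + s'.reg 27) ∧
      (∀ k < s'.reg 25, ∀ x ∈ A k, ¬ e.meets (s.reg 21) x) ∧
      ((s'.reg 26 = L ∧ s'.reg 27 = 0 ∧ s'.reg 25 ≤ L) ∨
        (s'.reg 26 = 0 ∧ s'.reg 27 = 1 ∧ s'.reg 25 < L ∧ s'.reg 28 ∈ A (s'.reg 25) ∧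
          e.meets (s.reg 21) (s'.reg 28))))
    (fun s' => s'.reg 26 - s'.reg 25) ?_ ?_ ?_
  · refine ⟨fun r hr => ?_, rfl, rfl, rfl, ?_, ?_, Or.inl ?_⟩
    · have : r ≠ 25 ∧ r ≠ 26 ∧ r ≠ 27 := by omega
      simp [hs₁, this]
    · simp [hs₁]
    · simp [hs₁]
    · simp [hs₁]
  · rintro s' ⟨hreg, harr, hext, hcont, hclock, hno, hcase⟩ hlt
    have hcase' : s'.reg 26 = L ∧ s'.reg 27 = 0 := by
      rcases hcase with h | h
      · exact ⟨h.1, h.2.1⟩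
      · omega
    obtain ⟨h26, h27⟩ := hcase'
    simp only [wp_seq]
    refine wp_setFind (N := N) (S := S) (A := A) (d := d) ?_ hd (by norm_num) ?_ ?_ ?_
    · rw [St.tick_arr, St.tick_cont, harr, hcont]; exact hF
    · simp; omega
    · rw [St.tick_reg, hreg 21 (by norm_num)]; exact hlive
    · intro s₂ hf hc hres
      have f25 := hf.reg 25 (by norm_num)
      have f26 := hf.reg 26 (by norm_num)
      have f27 := hf.reg 27 (by norm_num)
      have fclock := hf.clock
      have f21 : s'.reg 21 = s.reg 21 := hreg 21 (by norm_num)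
      simp only [St.tick_reg, St.tick_clock, f21] at f25 f26 f27 fclock hres
      rcases hres with ⟨h52, hnone⟩ | ⟨h52, hin, hm⟩
      · simp [h52, f25, f26, h26]
        refine ⟨⟨fun r hr => ?_, ?_, ?_, ?_, ?_, ?_, Or.inl ?_⟩, ?_⟩
        · have : r ≠ 25 ∧ r ≠ 29 := by omega
          simp [this, hf.reg r (by omega), hreg r hr]
        · rw [hf.arr]; exact harr
        · rw [hf.ext]; exact hext
        · rw [hc]; exact hcont
        · rw [f27, h27]
          rw [h27] at hclock
          simp only [add_zero] at hclock ⊢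
          rw [mul_add]
          omega
        · intro k hk
          rcases Nat.lt_or_eq_of_le hk with h | h
          · exact hno k h
          · rw [h]; exact hnone
        · omega
        · omega
      · simp [h52, f25]
        refine ⟨⟨fun r hr => ?_, ?_, ?_, ?_, ?_, ?_, ?_⟩, ?_⟩
        · have : r ≠ 29 ∧ r ≠ 27 ∧ r ≠ 28 ∧ r ≠ 26 := by omega
          simp [this, hf.reg r (by omega), hreg r hr]
        · rw [hf.arr]; exact harr
        · rw [hf.ext]; exact hext
        · rw [hc]; exact hcont
        · rw [h27] at hclock
          simp only [add_zero] at hclock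
          rw [mul_add]
          omega
        · exact hno
        · exact ⟨by omega, hin, hm⟩
        · omega
  · rintro s' ⟨hreg, harr, hext, hcont, hclock, hno, hcase⟩ hlt
    refine hQ _ ⟨hreg, harr, ?_, hext⟩ hcont ?_
    · have h1 : s'.reg 25 + s'.reg 27 ≤ L := by omega
      have := Nat.mul_le_mul_left (11 * d + 20) h1
      rw [St.tick_clock, mul_add]
      omega
    · rcases hcase with ⟨h26, h27, h25⟩ | ⟨h26, h27, h25, h28⟩
      · refine Or.inl ⟨h27, ?_⟩
        have : s'.reg 25 = L := by omega
        rw [← this]; exact hno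
      · exact Or.inr ⟨h27, h25, h28.1, h28.2, hno⟩

/-- A nonempty region meets itself, so the structure would report the bidder as its own neighbour.
The bidder is taken out of its level during the search and put back afterwards; this turns `meets`
into `adj`. -/
theorem wp_findCheapest {s : St} {Q : St → Prop} (hF : Forest (L + 2) N s.arr s.cont S A)
    (hd : N < 2 ^ d) (hlive : ↑S ⊆ e.live) (hp : s.arr 6 (s.reg 21) ≤ L)
    (hl : s.reg 21 ∈ A (s.arr 6 (s.reg 21)))
    (hlev : ∀ k < L, s.reg 21 ∈ A k → k = s.arr 6 (s.reg 21))
    (hQ : ∀ s', Frame 22 ((11 * d + 20) * (L + 3)) s s' → 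
      Forest (L + 2) N s'.arr s'.cont S A →
      ((s'.reg 27 = 0 ∧ ∀ k < L, ∀ x ∈ A k, ¬ e.adj (s.reg 21) x) ∨
        (s'.reg 27 = 1 ∧ s'.reg 25 < L ∧ s'.reg 28 ∈ A (s'.reg 25) ∧
          e.adj (s.reg 21) (s'.reg 28) ∧
          ∀ k < s'.reg 25, ∀ x ∈ A k, ¬ e.adj (s.reg 21) x)) → Q s') :
    wp e (findCheapest L) Q s := by
  set l := s.reg 21 with hl_def
  set p := s.arr 6 l with hp_def
  have hlS : l ∈ S := hF.sub p (by omega) hl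
  simp only [findCheapest, wp_seq, wp_load]
  refine wp_setDelete (N := N) (S := S) (A := A) (w := L + 2) (d := d) hF hd (by norm_num) ?_ ?_ ?_
  · simpa [← hl_def, ← hp_def] using by omega
  · simpa [← hl_def, ← hp_def] using hl
  intro s₁ hf₁ hF₁
  have e22 : s₁.reg 22 = p := by rw [hf₁.reg 22 (by norm_num)]; simp [← hl_def, ← hp_def]
  have e21 : s₁.reg 21 = l := by rw [hf₁.reg 21 (by norm_num)]; simp [← hl_def]
  simp [← hl_def, ← hp_def] at hF₁
  set A₁ := Function.update A p (A p \ {l}) with hA₁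
  have hA₁k : ∀ k < L, A₁ k = A k \ {l} := by
    intro k hk
    by_cases hkp : k = p
    · subst hkp; simp [hA₁]
    · rw [hA₁, Function.update_of_ne hkp]
      exact (Set.sdiff_singleton_eq_self fun h => hkp (hlev k hk h)).symm
  refine wp_findLevel (N := N) (S := S) (A := A₁) (d := d) hF₁ hd (hlive (by rw [e21]; exact hlS)) ?_
  intro s₂ hf₂ hc₂ hres
  rw [e21] at hres
  have g22 : s₂.reg 22 = p := by rw [hf₂.reg 22 (by norm_num)]; exact e22
  have g21 : s₂.reg 21 = l := by rw [hf₂.reg 21 (by norm_num)]; exact e21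
  have hF₂ : Forest (L + 2) N s₂.arr s₂.cont S A₁ := by rw [hf₂.arr, hc₂]; exact hF₁
  refine wp_setInsert (N := N) (S := S) (A := A₁) (w := L + 2) (d := d) hF₂ hd hlive (by norm_num)
    ?_ ?_ ?_ ?_
  · rw [g22]; omega
  · rw [g21]; exact hlS
  · rw [g21, g22]; simp [hA₁]
  intro s₃ hf₃ hF₃
  rw [g21, g22] at hF₃
  have hA : Function.update A₁ p (insert l (A₁ p)) = A := by
    rw [hA₁]
    simp [Set.insert_eq_of_mem hl]
  rw [hA] at hF₃
  have k25 := hf₃.reg 25 (by norm_num)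
  have k27 := hf₃.reg 27 (by norm_num)
  have k28 := hf₃.reg 28 (by norm_num)
  refine hQ s₃ ⟨fun r hr => ?_, ?_, ?_, ?_⟩ hF₃ ?_
  · rw [hf₃.reg r (by omega), hf₂.reg r (by omega), hf₁.reg r (by omega)]
    have : r ≠ 22 := by omega
    simp [this]
  · rw [hf₃.arr, hf₂.arr, hf₁.arr]; rfl
  · have c1 := hf₁.clock
    have c2 := hf₂.clock
    have c3 := hf₃.clock
    simp only [St.set_clock] at c1
    have : (11 * d + 20) * (L + 3) = (11 * d + 20) * (L + 1) + 2 * (11 * d + 20) := by ring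
    omega
  · rw [hf₃.ext, hf₂.ext, hf₁.ext]; rfl
  · rw [k25, k27, k28]
    rcases hres with ⟨h1, h2⟩ | ⟨h1, h2, h3, h4, h5⟩
    · refine Or.inl ⟨h1, fun k hk x hx hadj => h2 k hk x ?_ hadj.2⟩
      rw [hA₁k k hk]
      exact ⟨hx, fun h => hadj.1 (Set.mem_singleton_iff.1 h).symm⟩
    · rw [hA₁k _ h2] at h3
      refine Or.inr ⟨h1, h2, h3.1, ⟨fun h => h3.2 h.symm, h4⟩, fun k hk x hx hadj =>
        h5 k hk x ?_ hadj.2⟩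
      rw [hA₁k k (by omega)]
      exact ⟨hx, fun h => hadj.1 (Set.mem_singleton_iff.1 h).symm⟩

end auction

/-! ### Data of a running auction and the purchase of a vertex -/

/-- The first `n` cells of `a` enumerate `V` without repetitions. -/
def Enum (a : ℕ → ℕ) (n : ℕ) (V : Finset ℕ) : Prop := V = (Finset.range n).image a ∧ V.card = n

namespace Enum
variable {a : ℕ → ℕ} {n : ℕ} {V : Finset ℕ}

theorem mem (h : Enum a n V) {i : ℕ} (hi : i < n) : a i ∈ V := by
  rw [h.1]; exact Finset.mem_image_of_mem _ (Finset.mem_range.2 hi)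

theorem inj (h : Enum a n V) : ∀ i < n, ∀ j < n, a i = a j → i = j := by
  have h1 : ((Finset.range n).image a).card = (Finset.range n).card := by
    rw [← h.1, h.2, Finset.card_range]
  have h2 := Finset.card_image_iff.1 h1
  intro i hi j hj hij
  exact h2 (Finset.mem_coe.2 (Finset.mem_range.2 hi)) (Finset.mem_coe.2 (Finset.mem_range.2 hj)) hij

theorem push {x : ℕ} {a' : ℕ → ℕ} (h : Enum a n V) (hx : x ∉ V) (ha : a' = Function.update a n x) :
    Enum a' (n + 1) (insert x V) := by
  refine ⟨?_, by rw [Finset.card_insert_of_notMem hx, h.2]⟩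
  rw [Finset.range_add_one, Finset.image_insert, ha, Function.update_self, h.1]
  congr 1
  refine Finset.image_congr fun i hi => ?_
  have : i ≠ n := by have := Finset.mem_range.1 (Finset.mem_coe.1 hi); omega
  rw [Function.update_of_ne this]

end Enum

/-- The sets that the auction stores: for every price the vertices of that price, and the reservoir of
the untouched vertices. -/
def auctionSets (S V : Finset ℕ) (L : ℕ) (p : ℕ → ℕ) (k : ℕ) : Set ℕ :=
  {v | v ∈ S ∧ if k ≤ L then p v = k else v ∉ V}

theorem auctionSets_insert {S V : Finset ℕ} {L x k : ℕ} {p : ℕ → ℕ} (hk : k < L + 2) :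
    auctionSets S (insert x V) L p k = Function.update (auctionSets S V L p) (L + 1)
      (auctionSets S V L p (L + 1) \ {x}) k := by
  by_cases h : k = L + 1
  · subst h
    ext v
    simp [auctionSets]
    tauto
  · rw [Function.update_of_ne h]
    have : k ≤ L := by omega
    simp [auctionSets, this]

theorem auctionSets_raise {S V : Finset ℕ} {L x k j : ℕ} {p p' : ℕ → ℕ} {A₁ : ℕ → Set ℕ}
    (hj : j < L) (hx : x ∈ S) (hpx : p x = j) (hp : p' = Function.update p x (j + 1))
    (hA₁ : A₁ = Function.update (auctionSets S V L p) j (auctionSets S V L p j \ {x})) :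
    auctionSets S V L p' k = Function.update A₁ (j + 1) (insert x (A₁ (j + 1))) k := by
  have e : A₁ (j + 1) = auctionSets S V L p (j + 1) := by
    rw [hA₁, Function.update_of_ne (by omega)]
  have hj1 : j + 1 ≤ L := hj
  have hj0 : j ≤ L := hj.le
  by_cases h1 : k = j + 1
  · subst h1
    rw [Function.update_self, e]
    ext v
    by_cases hv : v = x
    · subst hv; simp [auctionSets, hp, hj1, hx]
    · simp [auctionSets, hp, hj1, hv]
  · rw [Function.update_of_ne h1, hA₁]
    by_cases h2 : k = j
    · subst h2
      rw [Function.update_self]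
      ext v
      by_cases hv : v = x
      · subst hv; simp [auctionSets, hp, hj0]
      · simp [auctionSets, hp, hj0, hv]
    · rw [Function.update_of_ne h2]
      ext v
      by_cases hv : v = x
      · subst hv
        have c1 : ¬ j + 1 = k := fun h => h1 h.symm
        have c2 : ¬ j = k := fun h => h2 h.symm
        simp [auctionSets, hp, hpx, c1, c2]
      · simp [auctionSets, hp, hv]

/-- A running auction on the machine. -/
structure Running (e : Env) (L N : ℕ) (S C V : Finset ℕ) (X : Set ℕ) (k : ℕ) (s : St) : Prop where
  forest : Forest (L + 2) N s.arr s.cont S (auctionSets S V L (s.arr 6))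
  bidding : Bidding e.adj S C V L (s.arr 6) (s.arr 7) (s.arr 8) (s.arr 10) (s.reg 8) X
    {u | ∃ i < s.reg 9, s.arr 0 i = u} k
  enum : Enum (s.arr 9) (s.reg 7) V
  mark : ∀ v, s.arr 14 v = if v ∈ V then 1 else 0

/-- What the auction leaves alone. -/
structure AuctionFrame (b : ℕ) (s s' : St) : Prop where
  reg : ∀ r, r < 7 → s'.reg r = s.reg r
  arr : ∀ a, (a < 6 ∨ 10 < a) → a ≠ 14 → s'.arr a = s.arr a
  clock : s'.clock ≤ s.clock + b
  ext : s'.ext = s.ext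

/-- Make the vertex in register `r` a touched vertex. -/
def touchVertex (L r : ℕ) : Prog :=
  .const 29 1 ;; .store 14 r 29 ;; .store 9 7 r ;; .add 7 7 29 ;; .const 30 (L + 1) ;;
    setDelete 30 r

section commit
variable {e : Env} {L N d : ℕ} {S C V : Finset ℕ} {X : Set ℕ} {k : ℕ}

/-- A touched vertex leaves the reservoir, set number `L + 1`, and is recorded in arrays 9 and 14.
The passes after the auction visit only the recorded vertices. -/
theorem wp_touchVertex {s : St} {Q : St → Prop} {r : ℕ}
    (hF : Forest (L + 2) N s.arr s.cont S (auctionSets S V L (s.arr 6)))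
    (hE : Enum (s.arr 9) (s.reg 7) V) (hM : ∀ v, s.arr 14 v = if v ∈ V then 1 else 0)
    (hd : N < 2 ^ d) (hr : r < 50) (hr7 : r ≠ 7) (hr29 : r ≠ 29) (hr30 : r ≠ 30)
    (hS : s.reg r ∈ S) (hV : s.reg r ∉ V)
    (hQ : ∀ s', Forest (L + 2) N s'.arr s'.cont S (auctionSets S (insert (s.reg r) V) L (s'.arr 6)) →
      Enum (s'.arr 9) (s'.reg 7) (insert (s.reg r) V) →
      (∀ v, s'.arr 14 v = if v ∈ insert (s.reg r) V then 1 else 0) →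
      (∀ q < 50, q ≠ 7 → q ≠ 29 → q ≠ 30 → s'.reg q = s.reg q) →
      (∀ a, a ≠ 9 → a ≠ 14 → s'.arr a = s.arr a) → s'.clock ≤ s.clock + (5 * d + 10) →
      s'.ext = s.ext → Q s') : wp e (touchVertex L r) Q s := by
  simp [touchVertex, hr29]
  refine wp_setDelete (N := N) (S := S) (A := auctionSets S V L (s.arr 6)) (w := L + 2) (d := d)
    ?_ hd hr ?_ ?_ ?_
  · exact hF.congr (by simp) (by simp) (by simp)
  · simp
  · simp [hr7, hr29, hr30, auctionSets, hS, hV]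
  intro s' hf hF'
  simp [hr7, hr29, hr30] at hF'
  refine hQ s' ?_ ?_ ?_ ?_ ?_ ?_ ?_
  · refine hF'.congr_sets fun k hk => ?_
    rw [hf.arr]
    simpa using auctionSets_insert hk
  · rw [hf.arr, hf.reg 7 (by norm_num)]
    simpa using hE.push hV rfl
  · intro v
    rw [hf.arr]
    by_cases hv : v = s.reg r
    · simp [hv]
    · simp [hv, hM]
  · intro q hq h7 h29 h30
    rw [hf.reg q hq]
    simp [h7, h29, h30]
  · intro a h9 h14
    rw [hf.arr]
    simp [h9, h14]
  · have := hf.clock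
    simp at this
    omega
  · rw [hf.ext]; rfl

/-- Touch the vertex in register 28 and let it wait for its turn, if it is untouched. -/
def touchWinner (L : ℕ) : Prog :=
  .load 30 14 28 ;; .const 29 0 ;; .ite 29 30 .skip
    (touchVertex L 28 ;; .store 10 8 28 ;; .const 29 1 ;; .add 8 8 29)

/-- Raise the price of the vertex in register 28, which is at the level in register 25. -/
def raisePrice : Prog :=
  setDelete 25 28 ;; .const 29 1 ;; .add 25 25 29 ;; setInsert 25 28 ;; .store 6 28 25

/-- Give the vertex in register 28 to the bidder in register 21. -/
def changeOwner : Prog :=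
  .load 31 7 28 ;; .const 29 0 ;; .const 30 1 ;;
  .ite 29 31 (.sub 31 31 30 ;; .store 8 31 29 ;; .store 10 8 31 ;; .add 8 8 30) .skip ;;
  .add 31 21 30 ;; .store 7 28 31 ;; .add 31 28 30 ;; .store 8 21 31

theorem Bidding.weaken {adj : ℕ → ℕ → Prop} {p ow mt stk : ℕ → ℕ} {n : ℕ} {scanned : Set ℕ}
    {k k' : ℕ} (h : Bidding adj S C V L p ow mt stk n X scanned k) (hk : k ≤ k') :
    Bidding adj S C V L p ow mt stk n X scanned k' :=
  { h with count := h.count.trans (by omega) }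

/-- Array 14 tells whether the winner has been touched before. If so, nothing happens and the credit
`k + 1` is merely generous. -/
theorem wp_touchWinner {s : St} {Q : St → Prop} (h : Running e L N S C V X k s) (hd : N < 2 ^ d)
    (hS : s.reg 28 ∈ S)
    (hQ : ∀ s' V', Running e L N S C V' X (k + 1) s' → s.reg 28 ∈ V' → AuctionFrame (5 * d + 20) s s' →
      (∀ r, 9 ≤ r → r < 29 → s'.reg r = s.reg r) → s'.arr 6 = s.arr 6 → s'.arr 7 = s.arr 7 →
      s'.arr 8 = s.arr 8 → s'.reg 8 ≤ s.reg 8 + 1 → Q s') : wp e (touchWinner L) Q s := by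
  by_cases hV : s.reg 28 ∈ V
  · have : s.arr 14 (s.reg 28) = 1 := by simp [h.mark, hV]
    simp [touchWinner, this]
    refine hQ _ V ⟨h.forest, h.bidding.weaken (by omega), h.enum, h.mark⟩ hV
      ⟨?_, fun _ _ _ => rfl, by simp; omega, rfl⟩ ?_ rfl rfl rfl (by simp)
    · intro r hr
      have : r ≠ 29 ∧ r ≠ 30 := by omega
      simp [this]
    · intro r _ hr
      have : r ≠ 29 ∧ r ≠ 30 := by omega
      simp [this]
  · have : s.arr 14 (s.reg 28) = 0 := by simp [h.mark, hV]
    simp [touchWinner, this]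
    refine wp_touchVertex (N := N) (S := S) (V := V) (d := d) (by exact h.forest) (by exact h.enum)
      (by exact h.mark) hd (by norm_num) (by norm_num) (by norm_num) (by norm_num)
      (by simpa using hS) (by simpa using hV) ?_
    intro s' hF hE hM hreg harr hclock hext
    have g28 : s'.reg 28 = s.reg 28 := by
      rw [hreg 28 (by norm_num) (by norm_num) (by norm_num) (by norm_num)]; simp
    have g8 : s'.reg 8 = s.reg 8 := by
      rw [hreg 8 (by norm_num) (by norm_num) (by norm_num) (by norm_num)]; simp
    have g9 : s'.reg 9 = s.reg 9 := by
      rw [hreg 9 (by norm_num) (by norm_num) (by norm_num) (by norm_num)]; simp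
    have garr : ∀ a, a ≠ 9 → a ≠ 14 → s'.arr a = s.arr a := fun a h1 h2 => by
      rw [harr a h1 h2]; rfl
    have e0 := garr 0 (by norm_num) (by norm_num)
    have e6 := garr 6 (by norm_num) (by norm_num)
    have e7 := garr 7 (by norm_num) (by norm_num)
    have e8 := garr 8 (by norm_num) (by norm_num)
    have e10 := garr 10 (by norm_num) (by norm_num)
    simp at hF hE hM hclock
    simp
    refine hQ _ (insert (s.reg 28) V) ⟨?_, ?_, ?_, ?_⟩ (Finset.mem_insert_self _ _) ⟨?_, ?_, ?_, ?_⟩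
      ?_ ?_ ?_ ?_ ?_
    · exact hF.congr (by simp) (by simp) (by simp)
    · have := h.bidding.touch hS hV rfl
      simp [g8, g9, e0, e6, e7, e8, e10, g28]
      exact this
    · simpa using hE
    · intro v
      simpa using hM v
    · intro r hr
      have h1 : r ≠ 29 ∧ r ≠ 30 ∧ r ≠ 7 ∧ r ≠ 8 := by omega
      simp only [St.set_reg, St.put_reg, ne_eq, h1, not_false_eq_true, Function.update_of_ne]
      rw [hreg r (by omega) (by omega) (by omega) (by omega)]
      simp [h1]
    · intro a ha h14
      have h1 : a ≠ 9 ∧ a ≠ 10 := by omega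
      simp [h1, garr a h1.1 h14]
    · simp; omega
    · simp [hext]
    · intro r hr9 hr
      have h1 : r ≠ 29 ∧ r ≠ 30 ∧ r ≠ 7 ∧ r ≠ 8 := by omega
      simp only [St.set_reg, St.put_reg, ne_eq, h1, not_false_eq_true, Function.update_of_ne]
      rw [hreg r (by omega) (by omega) (by omega) (by omega)]
      simp [h1]
    · simp [e6]
    · simp [e7]
    · simp [e8]
    · simp [g8]

theorem wp_raisePrice {s : St} {Q : St → Prop} 
    (hF : Forest (L + 2) N s.arr s.cont S (auctionSets S V L (s.arr 6))) (hd : N < 2 ^ d)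
    (hlive : ↑S ⊆ e.live) (hS : s.reg 28 ∈ S) (h25 : s.arr 6 (s.reg 28) = s.reg 25)
    (hL : s.reg 25 < L)
    (hQ : ∀ s', Forest (L + 2) N s'.arr s'.cont S (auctionSets S V L (s'.arr 6)) →
      (∀ r < 50, r ≠ 25 → r ≠ 29 → s'.reg r = s.reg r) → (∀ a, a ≠ 6 → s'.arr a = s.arr a) →
      s'.arr 6 = Function.update (s.arr 6) (s.reg 28) (s.arr 6 (s.reg 28) + 1) →
      s'.clock ≤ s.clock + (10 * d + 20) → s'.ext = s.ext → Q s') :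
    wp e raisePrice Q s := by
  simp only [raisePrice, wp_seq]
  refine wp_setDelete (N := N) (S := S) (w := L + 2) (d := d) hF hd (by norm_num) (by omega)
    (by simp [auctionSets, hS, hL.le, h25]) ?_
  intro s₁ hf₁ hF₁
  have g28 := hf₁.reg 28 (by norm_num)
  have g25 := hf₁.reg 25 (by norm_num)
  simp only [wp_seq, wp_const, wp_add]
  refine wp_setInsert (N := N) (S := S) (w := L + 2) (d := d) (by exact hF₁) hd hlive (by norm_num)
    ?_ ?_ ?_ ?_
  · simp [g25]; omega
  · simpa [g28] using hS
  · have hL1 : s.reg 25 + 1 ≤ L := hL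
    simp [g28, g25, auctionSets, hL1, h25]
  intro s₂ hf₂ hF₂
  have f28 := hf₂.reg 28 (by norm_num)
  have f25 := hf₂.reg 25 (by norm_num)
  simp [g28, g25] at hF₂ f28 f25
  simp [f28, f25]
  have harr : s₂.arr = s.arr := by
    rw [hf₂.arr]; simp [hf₁.arr]
  refine hQ _ ?_ ?_ ?_ ?_ ?_ ?_
  · refine (hF₂.congr (by simp) (by simp) (by simp)).congr_sets fun k hk => ?_
    have := auctionSets_raise (V := V) (k := k) (p := s.arr 6) hL hS h25 rfl rfl
    simpa [harr] using this
  · intro r hr h25 h29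
    simp [hf₂.reg r hr, h25, h29, hf₁.reg r hr]
  · intro a ha
    simp [ha, harr]
  · simp [harr, h25]
  · have := hf₁.clock
    have := hf₂.clock
    simp at this ⊢
    omega
  · simp [hf₂.ext, hf₁.ext]

/-- The bidder in register 21 buys the vertex in register 28. -/
def buy (L : ℕ) : Prog := touchWinner L ;; raisePrice ;; changeOwner

/-- At most one vertex was touched by the scan and at most one as the winner, so the debt is at most
two and the raise settles it. At most two vertices join the stack: the winner, if it is new, and the
evicted owner. -/
theorem wp_buy {s : St} {Q : St → Prop} (h : Running e L N S C V {s.reg 21} k s) (hk : k ≤ 1)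
    (hd : N < 2 ^ d)
    (hlive : ↑S ⊆ e.live) (hS : s.reg 28 ∈ S) (h25 : s.arr 6 (s.reg 28) = s.reg 25)
    (hL : s.reg 25 < L) (hadj : e.adj (s.reg 21) (s.reg 28))
    (hmin : ∀ r ∈ S, e.adj (s.reg 21) r → s.reg 25 ≤ s.arr 6 r)
    (hQ : ∀ s' V', Running e L N S C V' ∅ 0 s' → AuctionFrame (15 * d + 55) s s' →
      s'.reg 9 = s.reg 9 → s'.reg 8 ≤ s.reg 8 + 2 →
      ∑ v ∈ S, s'.arr 6 v = ∑ v ∈ S, s.arr 6 v + 1 → Q s') :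
    wp e (buy L) Q s := by
  simp only [buy, wp_seq]
  refine wp_touchWinner h hd hS ?_
  intro s₁ V' hR₁ hV' hf₁ hreg₁ e6 e7 e8 hn₁
  have g28 := hreg₁ 28 (by norm_num) (by norm_num)
  have g25 := hreg₁ 25 (by norm_num) (by norm_num)
  have g21 := hreg₁ 21 (by norm_num) (by norm_num)
  have g9 := hreg₁ 9 (by norm_num) (by norm_num)
  refine wp_raisePrice hR₁.forest hd hlive (by rw [g28]; exact hS) (by rw [g28, g25, e6]; exact h25)
    (by rw [g25]; exact hL) ?_
  intro s₂ hF₂ hreg₂ harr₂ h6 hclock₂ hext₂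
  have f28 := hreg₂ 28 (by norm_num) (by norm_num) (by norm_num)
  have f21 := hreg₂ 21 (by norm_num) (by norm_num) (by norm_num)
  have f9 := hreg₂ 9 (by norm_num) (by norm_num) (by norm_num)
  have f8 := hreg₂ 8 (by norm_num) (by norm_num) (by norm_num)
  have f7 := hreg₂ 7 (by norm_num) (by norm_num) (by norm_num)
  have a0 := harr₂ 0 (by norm_num)
  have a7 := harr₂ 7 (by norm_num)
  have a8 := harr₂ 8 (by norm_num)
  have a9 := harr₂ 9 (by norm_num)
  have a10 := harr₂ 10 (by norm_num)
  have a14 := harr₂ 14 (by norm_num)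
  rw [e6, g28] at h6
  rw [g28] at f28
  rw [g21] at f21
  have hb : Bidding e.adj S C V' L (s.arr 6) (s.arr 7) (s.arr 8) (s₁.arr 10) (s₁.reg 8) {s.reg 21}
      {u | ∃ i < s₁.reg 9, s₁.arr 0 i = u} (0 + 2) := by
    rw [← e6, ← e7, ← e8]; exact hR₁.bidding.weaken (by omega)
  have hmin' : ∀ r ∈ S, e.adj (s.reg 21) r → s.arr 6 (s.reg 28) ≤ s.arr 6 r := by
    rw [h25]; exact hmin
  have hlt : s.arr 6 (s.reg 28) < L := by rw [h25]; exact hL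
  have hsum := Bidding.sum_update (p := s.arr 6) hS
  have hclock₁ := hf₁.clock
  have hfr : ∀ r < 7, s₂.reg r = s.reg r := fun r hr => by
    rw [hreg₂ r (by omega) (by omega) (by omega), hf₁.reg r hr]
  have hfa : ∀ a, (a < 6 ∨ 10 < a) → a ≠ 14 → s₂.arr a = s.arr a := fun a ha h14 => by
    rw [harr₂ a (by omega), hf₁.arr a ha h14]
  by_cases how : s.arr 7 (s.reg 28) = 0
  · simp [changeOwner, f28, f21, a7, e7, how]
    refine hQ _ V' ⟨?_, ?_, ?_, ?_⟩ ⟨?_, ?_, ?_, ?_⟩ ?_ ?_ ?_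
    · exact hF₂.congr (by simp) (by simp) (by simp)
    · have := hb.win (n' := s₁.reg 8) (stk' := s₁.arr 10) (mt₀ := s.arr 8) hV' hadj hlt hmin'
        rfl rfl rfl (Or.inl ⟨how, rfl, rfl, rfl⟩)
      simp [a0, a7, a8, a10, e7, e8, f8, f9, h6]
      exact this
    · simpa [a9, f7] using hR₁.enum
    · intro v
      simpa [a14] using hR₁.mark v
    · intro r hr
      have : r ≠ 29 ∧ r ≠ 30 ∧ r ≠ 31 := by omega
      simp [this, hfr r hr]
    · intro a ha h14
      have : a ≠ 7 ∧ a ≠ 8 := by omega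
      simp [this, hfa a ha h14]
    · simp; omega
    · simp [hext₂, hf₁.ext]
    · simp [f9, g9]
    · simp [f8]; omega
    · simp [h6, hsum]
  · obtain ⟨q, hq⟩ := Nat.exists_eq_succ_of_ne_zero how
    rw [Nat.succ_eq_add_one] at hq
    simp [changeOwner, f28, f21, a7, e7, hq]
    refine hQ _ V' ⟨?_, ?_, ?_, ?_⟩ ⟨?_, ?_, ?_, ?_⟩ ?_ ?_ ?_
    · exact hF₂.congr (by simp) (by simp) (by simp)
    · have := hb.win (n' := s₁.reg 8 + 1) (stk' := Function.update (s₁.arr 10) (s₁.reg 8) q)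
        (mt₀ := Function.update (s.arr 8) q 0) hV' hadj hlt hmin'
        rfl rfl rfl (Or.inr ⟨q, hq, rfl, rfl, rfl⟩)
      simp [a0, a7, a8, a10, e7, e8, f8, f9, h6]
      exact this
    · simpa [a9, f7] using hR₁.enum
    · intro v
      simpa [a14] using hR₁.mark v
    · intro r hr
      have : r ≠ 29 ∧ r ≠ 30 ∧ r ≠ 31 ∧ r ≠ 8 := by omega
      simp [this, hfr r hr]
    · intro a ha h14
      have : a ≠ 7 ∧ a ≠ 8 ∧ a ≠ 10 := by omega
      simp [this, hfa a ha h14]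
    · simp; omega
    · simp [hext₂, hf₁.ext]
    · simp [f9, g9]
    · simp [f8]; omega
    · simp [h6, hsum]

/-- The bidder in register 21 has its turn. -/
def bid (L : ℕ) : Prog := findCheapest L ;; .const 29 0 ;; .ite 29 27 (buy L) .skip

/-- Only levels below `L` are searched. A bidder without a neighbour there is allowed to stay
unmatched at the end, so it drops out and no price changes; every other bidder buys. -/
theorem wp_bid {s : St} {Q : St → Prop} (h : Running e L N S C V {s.reg 21} k s) (hk : k ≤ 1)
    (hd : N < 2 ^ d) (hlive : ↑S ⊆ e.live)
    (hQ₁ : ∀ s', Running e L N S C V ∅ k s' → AuctionFrame ((11 * d + 20) * (L + 6)) s s' →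
      s'.reg 9 = s.reg 9 → s'.reg 8 = s.reg 8 → s'.arr 6 = s.arr 6 →
      (∀ r ∈ S, e.adj (s.reg 21) r → L ≤ s.arr 6 r) → Q s')
    (hQ₂ : ∀ s' V', Running e L N S C V' ∅ 0 s' → AuctionFrame ((11 * d + 20) * (L + 6)) s s' →
      s'.reg 9 = s.reg 9 → s'.reg 8 ≤ s.reg 8 + 2 →
      ∑ v ∈ S, s'.arr 6 v = ∑ v ∈ S, s.arr 6 v + 1 → Q s') : wp e (bid L) Q s := by
  have hle := h.bidding.auc.le
  have hturn := h.bidding.turn _ (Set.mem_singleton _)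
  have hlS : s.reg 21 ∈ S := h.bidding.auc.sub hturn.1
  have hcost : (11 * d + 20) * (L + 6) = (11 * d + 20) * (L + 3) + 3 * (11 * d + 20) := by ring
  simp only [bid, wp_seq]
  refine wp_findCheapest h.forest hd hlive (hle _) (by simp [auctionSets, hlS, hle]) ?_ ?_
  · intro k hk hmem
    simp [auctionSets, hk.le] at hmem
    exact hmem.2.symm
  intro s₁ hf hF hres
  have hrun : Running e L N S C V {s.reg 21} k s₁ := by
    refine ⟨?_, ?_, ?_, ?_⟩
    · rw [hf.arr] at hF ⊢; exact hF
    · rw [hf.arr, hf.reg 8 (by norm_num), hf.reg 9 (by norm_num)]; exact h.bidding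
    · rw [hf.arr, hf.reg 7 (by norm_num)]; exact h.enum
    · rw [hf.arr]; exact h.mark
  have f21 := hf.reg 21 (by norm_num)
  have f9 := hf.reg 9 (by norm_num)
  have f8 := hf.reg 8 (by norm_num)
  have hc := hf.clock
  rcases hres with ⟨h27, hnone⟩ | ⟨h27, h25, hin, hadj, hno⟩
  · have hall : ∀ r ∈ S, e.adj (s.reg 21) r → L ≤ s.arr 6 r := by
      intro r hr hadj
      by_contra hlt
      push Not at hlt
      exact hnone _ hlt r (by simp [auctionSets, hr, hlt.le]) hadj
    simp [h27]
    refine hQ₁ _ ⟨?_, ?_, ?_, ?_⟩ ⟨?_, ?_, ?_, ?_⟩ ?_ ?_ ?_ hall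
    · exact hrun.forest
    · have := hrun.bidding.drop (by rw [hf.arr]; exact hall)
      simpa using this
    · simpa using hrun.enum
    · simpa using hrun.mark
    · intro r hr
      have : r ≠ 29 := by omega
      simp [this, hf.reg r (by omega)]
    · intro a _ _
      simp [hf.arr]
    · simp; omega
    · simp [hf.ext]
    · simp [f9]
    · simp [f8]
    · simp [hf.arr]
  · simp [auctionSets, h25.le] at hin
    simp [h27]
    refine wp_buy (k := k) (V := V) (C := C) (N := N) (S := S) (d := d) ?_ hk hd hlive ?_ ?_ ?_ ?_ ?_ ?_
    · refine ⟨hrun.forest, ?_, ?_, ?_⟩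
      · simpa [f21] using hrun.bidding
      · simpa using hrun.enum
      · simpa using hrun.mark
    · simpa using hin.1
    · simpa [hf.arr] using hin.2
    · simpa using h25
    · simpa [f21] using hadj
    · intro r hr hadj
      simp [f21] at hadj
      simp [hf.arr]
      by_contra hlt
      push Not at hlt
      exact hno _ hlt r (by simp [auctionSets, hr, (hlt.trans h25).le]) hadj
    · intro s' V' hR hf' h9 h8 hsum
      refine hQ₂ s' V' hR ⟨fun r hr => ?_, fun a ha h14 => ?_, ?_, ?_⟩ ?_ ?_ ?_
      · have : r ≠ 29 := by omega
        rw [hf'.reg r hr]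
        simp [this, hf.reg r (by omega)]
      · rw [hf'.arr a ha h14]
        simp [hf.arr]
      · have := hf'.clock
        simp at this
        omega
      · rw [hf'.ext]
        simp [hf.ext]
      · rw [h9]; simp [f9]
      · simpa [f8] using h8
      · simpa [hf.arr] using hsum

end commit

/-! ### The auction: the main loop -/

/-- The cover enters the auction. -/
def startAuction : Prog :=
  .const 7 0 ;; .const 29 1 ;;
  .while 7 2 (.load 21 0 7 ;; .store 9 7 21 ;; .store 10 7 21 ;; .store 14 21 29 ;; .add 7 7 29) ;;
  .move 8 7 ;; .const 9 0

/-- Look for an untouched neighbour of the next vertex of the cover. -/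
def scanStep (L : ℕ) : Prog :=
  .load 21 0 9 ;; .load 22 6 21 ;; .const 23 L ;;
  .ite 22 23 (.const 23 (L + 1) ;; setFind (L + 2) 23 21 ;; .const 29 0 ;;
      .ite 29 52 (.move 21 53 ;; touchVertex L 21 ;; bid L) (.const 29 1 ;; .add 9 9 29))
    (.const 29 1 ;; .add 9 9 29)

/-- One round of the auction. -/
def auctionStep (L : ℕ) : Prog :=
  .const 20 0 ;; .ite 20 8 (.const 29 1 ;; .sub 8 8 29 ;; .load 21 10 8 ;; bid L) (scanStep L) ;;
  .const 20 0 ;; .sub 23 2 9 ;; .add 23 23 8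

/-- The auction. -/
def runAuction (L : ℕ) : Prog :=
  startAuction ;; .const 20 0 ;; .sub 23 2 9 ;; .add 23 23 8 ;; .while 20 23 (auctionStep L)

section mainLoop
variable {e : Env} {L N d : ℕ} {S C V : Finset ℕ} {k : ℕ}

theorem Auction.zero {adj : ℕ → ℕ → Prop} {p ow mt : ℕ → ℕ} (hp : p = 0) (how : ow = 0)
    (hmt : mt = 0) (hV : V ⊆ S) : Auction adj S V L p ow mt := by
  subst hp how hmt
  exact ⟨by simp, by simp, by simp, by simp, by simp, by simp, hV⟩

theorem CoverList.inj {len : ℕ} {arr : ℕ → ℕ → ℕ} (h : CoverList len arr C) {i j : ℕ} (hi : i < len)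
    (hj : j < len) (hij : arr 0 i = arr 0 j) : i = j := by
  have h1 := (h.idx i hi).2
  have h2 := (h.idx j hj).2
  rw [hij, h2] at h1
  omega

theorem CoverList.exists_index {len : ℕ} {arr : ℕ → ℕ → ℕ} (h : CoverList len arr C) {v : ℕ}
    (hv : v ∈ C) : ∃ i < len, arr 0 i = v := by
  obtain ⟨h1, h2, h3⟩ := h.pos v hv
  exact ⟨_, by omega, h3⟩

/-- The vertices of the cover start touched and waiting, at price zero. The reservoir kept between
updates is the complement of the cover and thus already right. -/
theorem wp_startAuction {s : St} {Q : St → Prop}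
    (hF : Forest (L + 2) N s.arr s.cont S (auctionSets S C L 0))
    (hC : CoverList (s.reg 2) s.arr C) (hCS : C ⊆ S) (h6 : s.arr 6 = 0) (h7 : s.arr 7 = 0)
    (h8 : s.arr 8 = 0) (h14 : s.arr 14 = 0)
    (hQ : ∀ s', Running e L N S C C ∅ 0 s' → AuctionFrame (10 * s.reg 2 + 10) s s' →
      s'.reg 9 = 0 → s'.reg 8 = s.reg 2 → s'.arr 6 = s.arr 6 → Q s') : wp e startAuction Q s := by
  simp only [startAuction, wp_seq, wp_const]
  refine wp_while (fun s' => (∀ r, r ≠ 7 → r ≠ 29 → r ≠ 21 → s'.reg r = s.reg r) ∧ s'.reg 29 = 1 ∧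
      s'.reg 7 ≤ s.reg 2 ∧ (∀ a, a ≠ 9 → a ≠ 10 → a ≠ 14 → s'.arr a = s.arr a) ∧
      s'.cont = s.cont ∧ s'.ext = s.ext ∧ s'.clock ≤ s.clock + 2 + 6 * s'.reg 7 ∧
      (∀ i < s'.reg 7, s'.arr 9 i = s.arr 0 i ∧ s'.arr 10 i = s.arr 0 i) ∧
      (∀ v, s'.arr 14 v = if v ∈ C ∧ s.arr 1 v ≤ s'.reg 7 then 1 else 0))
    (fun s' => s.reg 2 - s'.reg 7) ?_ ?_ ?_
  · refine ⟨fun r h1 h2 _ => by simp [h1, h2], rfl, by simp, fun _ _ _ _ => rfl, rfl, rfl, by simp,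
      by simp, fun v => ?_⟩
    have : ¬ (v ∈ C ∧ s.arr 1 v ≤ 0) := fun h => by
      have := hC.pos v h.1
      omega
    simp [h14] at this ⊢
    exact this
  · rintro s' ⟨hreg, h29, hle, harr, hcont, hext, hclock, hcp, hmark⟩ hlt
    rw [hreg 2 (by norm_num) (by norm_num) (by norm_num)] at hlt
    have e0 := harr 0 (by norm_num) (by norm_num) (by norm_num)
    have hx := hC.idx _ hlt
    simp [h29, e0]
    refine ⟨⟨?_, by omega, ?_, hcont, hext, by omega, ?_, ?_⟩, by omega⟩
    · intro r h1 h2 h3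
      simp [h1, h3, hreg r h1 h2 h3]
    · intro a h1 h2 h3
      simp [h1, h2, h3, harr a h1 h2 h3]
    · intro i hi
      rcases Nat.lt_or_eq_of_le hi with hi | hi
      · simp [hi.ne, hcp i hi]
      · simp [hi]
    · intro v
      by_cases hv : v = s.arr 0 (s'.reg 7)
      · subst hv; simp [hx]
      · rw [Function.update_of_ne hv, hmark]
        have : v ∈ C → (s.arr 1 v ≤ s'.reg 7 ↔ s.arr 1 v ≤ s'.reg 7 + 1) := by
          intro hvC
          have h1 := hC.pos v hvC
          constructor
          · omega
          · intro h2
            by_contra h3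
            have h4 : s.arr 1 v - 1 = s'.reg 7 := by omega
            rw [h4] at h1
            exact hv h1.2.2.symm
        by_cases hvC : v ∈ C
        · simp [hvC, this hvC]
        · simp [hvC]
  · rintro s' ⟨hreg, h29, hle, harr, hcont, hext, hclock, hcp, hmark⟩ hlt
    rw [hreg 2 (by norm_num) (by norm_num) (by norm_num)] at hlt
    have h7' : s'.reg 7 = s.reg 2 := by omega
    rw [h7'] at hcp hmark
    have a6 : s'.arr 6 = 0 := by rw [harr 6 (by norm_num) (by norm_num) (by norm_num), h6]
    have a7 : s'.arr 7 = 0 := by rw [harr 7 (by norm_num) (by norm_num) (by norm_num), h7]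
    have a8 : s'.arr 8 = 0 := by rw [harr 8 (by norm_num) (by norm_num) (by norm_num), h8]
    have hcard := hC.card
    simp only [wp_seq, wp_move, wp_const]
    refine hQ _ ⟨?_, ⟨Auction.zero a6 a7 a8 hCS, subset_rfl, ?_, ?_, ?_, ?_, ?_, ?_⟩, ⟨?_, ?_⟩, ?_⟩
      ⟨?_, ?_, ?_, ?_⟩ ?_ ?_ ?_
    · simp only [St.set_arr, St.set_cont, St.tick_arr, St.tick_cont, a6, hcont]
      exact hF.congr (harr 2 (by norm_num) (by norm_num) (by norm_num))
        (harr 3 (by norm_num) (by norm_num) (by norm_num))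
        (harr 4 (by norm_num) (by norm_num) (by norm_num))
    · intro i hi
      simp [h7'] at hi
      simp [hcp i hi, a8, (hC.idx i hi).1]
    · intro i hi j hj
      simp [h7'] at hi hj
      simp only [St.set_arr, St.tick_arr, (hcp i hi).2, (hcp j hj).2]
      exact hC.inj hi hj
    · simp
    · intro l hl _
      obtain ⟨i, hi, h1⟩ := hC.exists_index hl
      exact Or.inr (Or.inl ⟨i, by simpa [h7'] using hi, by simp [hcp i hi, h1]⟩)
    · simp
    · omega
    · simp only [St.set_arr, St.tick_arr, St.set_reg, St.tick_reg]
      ext v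
      simp [h7']
      constructor
      · intro hv
        obtain ⟨i, hi, h1⟩ := hC.exists_index hv
        exact ⟨i, hi, by rw [(hcp i hi).1, h1]⟩
      · rintro ⟨i, hi, rfl⟩
        rw [(hcp i hi).1]
        exact (hC.idx i hi).1
    · simpa [h7'] using hcard
    · intro v
      simp only [St.set_arr, St.tick_arr, hmark]
      by_cases hv : v ∈ C
      · simp [hv, (hC.pos v hv).2.1]
      · simp [hv]
    · intro r hr
      have : r ≠ 7 ∧ r ≠ 29 ∧ r ≠ 21 ∧ r ≠ 8 ∧ r ≠ 9 := by omega
      simp [this, hreg r this.1 this.2.1 this.2.2.1]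
    · intro a ha h14
      exact harr a (by omega) (by omega) h14
    · simp; omega
    · simp [hext]
    · simp
    · simp [h7']
    · simp [a6, h6]

theorem Bidding.scan_more {adj : ℕ → ℕ → Prop} {p ow mt stk : ℕ → ℕ} {n u : ℕ} {X sc sc' : Set ℕ}
    (h : Bidding adj S C V L p ow mt stk n X sc k) (hsc : ∀ v ∈ sc', v ∈ sc ∨ v = u)
    (hu : ∀ x ∈ S, x ∉ V → adj u x → L ≤ p u) : Bidding adj S C V L p ow mt stk n X sc' k :=
  { h with
    scan := fun v hv => by
      rcases hsc v hv with hv | rfl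
      · exact h.scan v hv
      · exact hu }

/-- The number of vertices that still need attention, with a credit for the prices. -/
def Progress (S : Finset ℕ) (s s' : St) : Prop :=
  s'.reg 8 + (s.reg 2 - s'.reg 9) + 1 + 3 * ∑ v ∈ S, s.arr 6 v ≤
    s.reg 8 + (s.reg 2 - s.reg 9) + 3 * ∑ v ∈ S, s'.arr 6 v

theorem wp_skipScan {s : St} {Q : St → Prop} (h : Running e L N S C V ∅ 0 s)
    (hu : ∀ x ∈ S, x ∉ V → e.adj (s.arr 0 (s.reg 9)) x → L ≤ s.arr 6 (s.arr 0 (s.reg 9)))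
    (h9 : s.reg 9 < s.reg 2)
    (hQ : ∀ s' V', Running e L N S C V' ∅ 0 s' → AuctionFrame 2 s s' →
      Progress S s s' → Q s') : wp e (.const 29 1 ;; .add 9 9 29) Q s := by
  simp
  refine hQ _ V ⟨h.forest, ?_, h.enum, h.mark⟩ ⟨?_, fun _ _ _ => rfl, le_rfl, rfl⟩ ?_
  · refine Bidding.scan_more (u := s.arr 0 (s.reg 9)) h.bidding ?_ hu
    rintro v ⟨i, hi, rfl⟩
    simp at hi
    rcases Nat.lt_or_eq_of_le hi with hi | hi
    · exact Or.inl ⟨i, hi, rfl⟩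
    · exact Or.inr (by simp [hi])
  · intro r hr
    have : r ≠ 29 ∧ r ≠ 9 := by omega
    simp [this]
  · simp [Progress]; omega

/-- Let `u` be the next vertex of the cover. If `u` costs less than `L` and has an untouched
neighbour, that neighbour bids at once, and successfully, as `u` itself is affordable; the raise
pays for the touch. Otherwise `u` is finished for good, since prices only rise and touched vertices
stay touched. -/
theorem wp_scanStep {s : St} {Q : St → Prop} (h : Running e L N S C V ∅ 0 s)
    (hsymm : ∀ u v, e.adj u v → e.adj v u) (hC : CoverList (s.reg 2) s.arr C) (hd : N < 2 ^ d)
    (hlive : ↑S ⊆ e.live) (h9 : s.reg 9 < s.reg 2)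
    (hQ : ∀ s' V', Running e L N S C V' ∅ 0 s' → AuctionFrame ((11 * d + 20) * (L + 8)) s s' →
      Progress S s s' → Q s') : wp e (scanStep L) Q s := by
  have hu := (hC.idx _ h9).1
  set u := s.arr 0 (s.reg 9) with hu_def
  have huV : u ∈ V := h.bidding.cover hu
  have huS : u ∈ S := h.bidding.auc.sub huV
  have hcost : (11 * d + 20) * (L + 8) = (11 * d + 20) * (L + 6) + 2 * (11 * d + 20) := by ring
  have hle1 : 11 * d + 20 ≤ (11 * d + 20) * (L + 6) := Nat.le_mul_of_pos_right _ (by omega)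
  simp only [scanStep, wp_seq, wp_load, wp_const, wp_ite]
  simp [← hu_def]
  split_ifs with hp
  · refine wp_setFind (N := N) (S := S) (A := auctionSets S V L (s.arr 6)) (d := d)
      (by exact h.forest) hd (by norm_num) (by simp) (by simpa using hlive huS) ?_
    intro s₁ hf hc hres
    have f9 := hf.reg 9 (by norm_num)
    have f8 := hf.reg 8 (by norm_num)
    have f7 := hf.reg 7 (by norm_num)
    have f2 := hf.reg 2 (by norm_num)
    have fc := hf.clock
    have fa : s₁.arr = s.arr := hf.arr
    have frun : Running e L N S C V ∅ 0 s₁ := by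
      refine ⟨?_, ?_, ?_, ?_⟩
      · rw [fa, hc]; exact h.forest
      · rw [fa, f8, f9]; simpa using h.bidding
      · rw [fa, f7]; simpa using h.enum
      · rw [fa]; exact h.mark
    simp at hres fc f9 f8 f7 f2
    rcases hres with ⟨h52, hnone⟩ | ⟨h52, hin, hmeet⟩
    · simp [h52]
      refine wp_skipScan (e := e) (L := L) (N := N) (S := S) (C := C) (V := V)
        ⟨frun.forest, by simpa using frun.bidding, by simpa using frun.enum, frun.mark⟩ ?_ ?_ ?_
      · intro x hx hxV hadj
        simp [fa, f9, ← hu_def] at hadj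
        exact absurd hadj.2 (hnone x (by simp [auctionSets, hx, hxV]))
      · simp [f9, f2, h9]
      · intro s₂ V' hrun hf₂ hpr
        refine hQ s₂ V' hrun ⟨?_, ?_, ?_, ?_⟩ ?_
        · intro r hr
          have : r ≠ 21 ∧ r ≠ 22 ∧ r ≠ 23 ∧ r ≠ 29 := by omega
          rw [hf₂.reg r hr]
          simp [this, hf.reg r (by omega)]
        · intro a ha h14
          rw [hf₂.arr a ha h14]
          simp [fa]
        · have := hf₂.clock
          simp at this
          omega
        · rw [hf₂.ext]; simp [hf.ext]
        · simpa [Progress, fa, f8, f9, f2] using hpr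
    · simp [auctionSets] at hin
      simp [h52]
      refine wp_touchVertex (N := N) (S := S) (V := V) (d := d) (by exact frun.forest)
        (by simpa using frun.enum) (by exact frun.mark) hd (by norm_num) (by norm_num) (by norm_num)
        (by norm_num) (by simpa using hin.1) (by simpa using hin.2) ?_
      intro s₂ hF₂ hE₂ hM₂ hreg₂ harr₂ hclock₂ hext₂
      simp at hF₂ hE₂ hM₂ hclock₂ hext₂
      have g21 := hreg₂ 21 (by norm_num) (by norm_num) (by norm_num) (by norm_num)
      have g9 := hreg₂ 9 (by norm_num) (by norm_num) (by norm_num) (by norm_num)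
      have g8 := hreg₂ 8 (by norm_num) (by norm_num) (by norm_num) (by norm_num)
      have g2 := hreg₂ 2 (by norm_num) (by norm_num) (by norm_num) (by norm_num)
      simp [f9, f8, f2] at g21 g9 g8 g2
      have garr : ∀ a, a ≠ 9 → a ≠ 14 → s₂.arr a = s.arr a := fun a h1 h2 => by
        rw [harr₂ a h1 h2]; simp [fa]
      have e6 := garr 6 (by norm_num) (by norm_num)
      have hrun₂ : Running e L N S C (insert (s₁.reg 53) V) {s₂.reg 21} 1 s₂ := by
        refine ⟨hF₂, ?_, hE₂, fun v => by simpa using hM₂ v⟩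
        have := h.bidding.enter hin.1 hin.2
        rw [e6, garr 7 (by norm_num) (by norm_num), garr 8 (by norm_num) (by norm_num),
          garr 10 (by norm_num) (by norm_num), garr 0 (by norm_num) (by norm_num), g9, g8, g21]
        exact this
      have hframe : ∀ s', AuctionFrame ((11 * d + 20) * (L + 6)) s₂ s' →
          AuctionFrame ((11 * d + 20) * (L + 8)) s s' := by
        intro s' hf'
        refine ⟨fun r hr => ?_, fun a ha h14 => ?_, ?_, ?_⟩
        · rw [hf'.reg r hr, hreg₂ r (by omega) (by omega) (by omega) (by omega)]
          have : r ≠ 21 ∧ r ≠ 22 ∧ r ≠ 23 ∧ r ≠ 29 := by omega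
          simp [this, hf.reg r (by omega)]
        · rw [hf'.arr a ha h14, garr a (by omega) h14]
        · have := hf'.clock
          omega
        · rw [hf'.ext, hext₂]; simp [hf.ext]
      refine wp_bid hrun₂ le_rfl hd hlive ?_ ?_
      -- A bid without a purchase would mean that `u` costs `L`, but its price is smaller.
      · intro s' _ _ _ _ _ hno
        have := hno u huS (hsymm _ _ ⟨?_, ?_⟩)
        · rw [e6] at this
          omega
        · rw [g21]; exact fun hh => hin.2 (hh ▸ huV)
        · rw [g21]; exact hmeet
      · intro s' V' hR hf' h9' h8' hsum
        refine hQ s' V' hR (hframe s' hf') ?_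
        rw [e6] at hsum
        rw [Progress, h9', hsum, g9]
        omega
  · refine wp_skipScan (e := e) (L := L) (N := N) (S := S) (C := C) (V := V)
        ⟨h.forest, by simpa using h.bidding, by simpa using h.enum, h.mark⟩ ?_ ?_ ?_
    · intro x hx hxV hadj
      simp [← hu_def] at hadj ⊢
      omega
    · simpa using h9
    · intro s₂ V' hrun hf₂ hpr
      refine hQ s₂ V' hrun ⟨?_, ?_, ?_, ?_⟩ ?_
      · intro r hr
        have : r ≠ 21 ∧ r ≠ 22 ∧ r ≠ 23 := by omega
        rw [hf₂.reg r hr]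
        simp [this]
      · intro a ha h14
        rw [hf₂.arr a ha h14]
        rfl
      · have := hf₂.clock
        simp at this
        omega
      · rw [hf₂.ext]; rfl
      · simpa [Progress] using hpr

/-- A round removes a waiting vertex, or advances the scan, or raises a price while adding at most
two waiting vertices. The weight three of the prices in `Progress` makes each of these a gain of at
least one. -/
theorem wp_auctionStep {s : St} {Q : St → Prop} (h : Running e L N S C V ∅ 0 s)
    (hsymm : ∀ u v, e.adj u v → e.adj v u) (hC : CoverList (s.reg 2) s.arr C) (hd : N < 2 ^ d)
    (hlive : ↑S ⊆ e.live) (h9 : 0 < s.reg 2 - s.reg 9 + s.reg 8)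
    (hQ : ∀ s' V', Running e L N S C V' ∅ 0 s' → AuctionFrame ((11 * d + 20) * (L + 9)) s s' →
      Progress S s s' → s'.reg 20 = 0 → s'.reg 23 = s.reg 2 - s'.reg 9 + s'.reg 8 → Q s') :
    wp e (auctionStep L) Q s := by
  have hcost : (11 * d + 20) * (L + 9) = (11 * d + 20) * (L + 8) + (11 * d + 20) := by ring
  have hcost2 : (11 * d + 20) * (L + 8) = (11 * d + 20) * (L + 6) + 2 * (11 * d + 20) := by ring
  have key : ∀ s₁ V', Running e L N S C V' ∅ 0 s₁ →
      AuctionFrame ((11 * d + 20) * (L + 8) + 6) s s₁ → Progress S s s₁ →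
      wp e (.const 20 0 ;; .sub 23 2 9 ;; .add 23 23 8) Q s₁ := by
    intro s₁ V' hR hf hp
    simp
    refine hQ _ V' ⟨hR.forest, by simpa using hR.bidding, by simpa using hR.enum, hR.mark⟩
      ⟨fun r hr => ?_, fun a ha h14 => hf.arr a ha h14, ?_, hf.ext⟩ ?_ ?_ ?_
    · have : r ≠ 20 ∧ r ≠ 23 := by omega
      simp [this, hf.reg r hr]
    · have := hf.clock
      simp
      omega
    · simpa [Progress] using hp
    · simp
    · simp [hf.reg 2 (by norm_num)]
  simp only [auctionStep, wp_seq] at key ⊢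
  simp only [wp_const]
  by_cases h8 : 0 < s.reg 8
  · simp [h8]
    have hb := h.bidding
    obtain ⟨n, hn⟩ : ∃ n, s.reg 8 = n + 1 := ⟨s.reg 8 - 1, by omega⟩
    rw [hn] at hb
    refine wp_bid (k := 0) (V := V) (C := C) (N := N) (S := S) (d := d)
      ⟨h.forest, ?_, by simpa using h.enum, h.mark⟩ (by omega) hd hlive ?_ ?_
    · simpa [hn] using hb.pop
    · intro s' hR hf' h9' h8' h6 _
      refine key s' V hR ⟨fun r hr => ?_, fun a ha h14 => ?_, ?_, ?_⟩ ?_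
      · have : r ≠ 20 ∧ r ≠ 29 ∧ r ≠ 8 ∧ r ≠ 21 := by omega
        rw [hf'.reg r hr]
        simp [this]
      · rw [hf'.arr a ha h14]; rfl
      · have := hf'.clock
        simp at this
        omega
      · rw [hf'.ext]; rfl
      · simp [hn] at h9' h8'
        rw [Progress, h9', h8', h6]
        simp
        omega
    · intro s' V' hR hf' h9' h8' hsum
      refine key s' V' hR ⟨fun r hr => ?_, fun a ha h14 => ?_, ?_, ?_⟩ ?_
      · have : r ≠ 20 ∧ r ≠ 29 ∧ r ≠ 8 ∧ r ≠ 21 := by omega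
        rw [hf'.reg r hr]
        simp [this]
      · rw [hf'.arr a ha h14]; rfl
      · have := hf'.clock
        simp at this
        omega
      · rw [hf'.ext]; rfl
      · simp [hn] at h9' h8'
        rw [Progress, h9', hsum]
        simp
        omega
  · simp [h8]
    refine wp_scanStep (V := V) (C := C) (N := N) (S := S) (d := d)
      ⟨h.forest, by simpa using h.bidding, by simpa using h.enum, h.mark⟩ hsymm (by simpa using hC) hd
      hlive (by simp; omega) ?_
    intro s' V' hR hf' hp
    refine key s' V' hR ⟨fun r hr => ?_, fun a ha h14 => ?_, ?_, ?_⟩ ?_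
    · have : r ≠ 20 := by omega
      rw [hf'.reg r hr]
      simp [this]
    · rw [hf'.arr a ha h14]; rfl
    · have := hf'.clock
      simp at this
      omega
    · rw [hf'.ext]; rfl
    · simpa [Progress] using hp

/-- The auction runs in time proportional to `L ^ 2` for every vertex of the cover. -/
theorem wp_runAuction {s : St} {Q : St → Prop}
    (hF : Forest (L + 2) N s.arr s.cont S (auctionSets S C L 0))
    (hC : CoverList (s.reg 2) s.arr C) (hcov : IsCov e.adj S C) (h6 : s.arr 6 = 0) (h7 : s.arr 7 = 0)
    (h8 : s.arr 8 = 0) (h14 : s.arr 14 = 0)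
    (hsymm : ∀ u v, e.adj u v → e.adj v u) (hd : N < 2 ^ d) (hlive : ↑S ⊆ e.live)
    (hQ : ∀ s' V, Running e L N S C V ∅ 0 s' →
      AuctionFrame ((11 * d + 20) * (L + 10) * (C.card * (6 * L + 2)) + 10 * C.card + 20) s s' →
      (∀ l ∈ S, s'.arr 8 l = 0 → ∀ r ∈ S, e.adj l r → L ≤ s'.arr 6 r) →
      V.card ≤ C.card * (4 * L + 1) → Q s') : wp e (runAuction L) Q s := by
  have hcard := hC.card
  simp only [runAuction, wp_seq]
  refine wp_startAuction (e := e) hF hC hcov.1 h6 h7 h8 h14 ?_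
  intro s₁ hR₁ hf₁ g9 g8 g6
  simp only [wp_seq, wp_const, wp_sub, wp_add]
  have g2 := hf₁.reg 2 (by norm_num)
  set M := (11 * d + 20) * (L + 10) with hM
  have hMcost : M = (11 * d + 20) * (L + 9) + (11 * d + 20) := by rw [hM]; ring
  -- Each unit of remaining work is worth `M` instructions. Work is supplied in portions of two for
  -- each vertex of the cover, once for its turn and once for its scan, and of three for each price
  -- raise. The variant counts the raises still possible, as prices sum to at most `2 * |C| * L`.
  refine wp_while (fun s' => (∃ V, Running e L N S C V ∅ 0 s') ∧
      (∀ r, r < 7 → s'.reg r = s.reg r) ∧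
      (∀ a, (a < 6 ∨ 10 < a) → a ≠ 14 → s'.arr a = s.arr a) ∧ s'.ext = s.ext ∧
      s'.reg 20 = 0 ∧ s'.reg 23 = s.reg 2 - s'.reg 9 + s'.reg 8 ∧
      s'.clock + M * (s'.reg 8 + (s.reg 2 - s'.reg 9)) ≤ s.clock + 10 * s.reg 2 + 15 + 
        M * (2 * s.reg 2 + 3 * ∑ v ∈ S, s'.arr 6 v))
    (fun s' => s'.reg 8 + (s.reg 2 - s'.reg 9) + 3 * (2 * s.reg 2 * L - ∑ v ∈ S, s'.arr 6 v)) ?_ ?_ ?_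
  · refine ⟨⟨C, hR₁.forest, by simpa using hR₁.bidding, by simpa using hR₁.enum, hR₁.mark⟩,
      fun r hr => ?_, fun a ha h14 => hf₁.arr a ha h14, hf₁.ext, by simp, ?_, ?_⟩
    · have : r ≠ 20 ∧ r ≠ 23 := by omega
      simp [this, hf₁.reg r hr]
    · simp [g2]
    · have := hf₁.clock
      simp [g9, g8, g6, h6]
      rw [two_mul]
      omega
  · rintro s' ⟨⟨V, hR⟩, hreg, harr, hext, h20, h23, hclock⟩ hlt
    have k2 := hreg 2 (by norm_num)
    refine wp_auctionStep (V := V) (C := C) (N := N) (S := S) (d := d)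
      ⟨hR.forest, hR.bidding, hR.enum, hR.mark⟩ hsymm ?_ hd hlive ?_ ?_
    · rw [St.tick_reg, St.tick_arr, k2]
      exact hC.congr (harr 0 (by norm_num) (by norm_num)) (harr 1 (by norm_num) (by norm_num))
    · simp only [St.tick_reg]; omega
    · intro s₂ V' hR' hf' hp m20 m23
      have hpot := hR'.bidding.auc.sum_price_le hcov
      have hsum : ∑ v ∈ S, s₂.arr 6 v = ∑ v ∈ V', s₂.arr 6 v := by
        symm
        refine Finset.sum_subset hR'.bidding.auc.sub fun v _ hv => ?_
        exact (hR'.bidding.auc.out v hv).1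
      rw [hcard, ← hsum] at hpot
      have hpot0 := hR.bidding.auc.sum_price_le hcov
      simp only [Progress, St.tick_reg, St.tick_arr, k2] at hp m23
      have hc := hf'.clock
      rw [St.tick_clock] at hc
      refine ⟨⟨⟨V', hR'⟩, fun r hr => ?_, fun a ha h14 => ?_, ?_, m20, m23, ?_⟩, ?_⟩
      · rw [hf'.reg r hr]; exact hreg r hr
      · rw [hf'.arr a ha h14]; exact harr a ha h14
      · rw [hf'.ext]; exact hext
      · have h1 := Nat.mul_le_mul_left M hp
        simp only [mul_add, mul_one] at h1 hclock ⊢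
        omega
      · omega
  · rintro s' ⟨⟨V, hR⟩, hreg, harr, hext, h20, h23, hclock⟩ hlt
    have hsum : ∑ v ∈ S, s'.arr 6 v = ∑ v ∈ V, s'.arr 6 v := by
      symm
      refine Finset.sum_subset hR.bidding.auc.sub fun v _ hv => ?_
      exact (hR.bidding.auc.out v hv).1
    have hpot := hR.bidding.auc.sum_price_le hcov
    rw [← hsum] at hpot
    have hcount := hR.bidding.count
    have m8 : s'.reg 8 = 0 := by omega
    have m9 : s.reg 2 ≤ s'.reg 9 := by omega
    refine hQ _ V ⟨hR.forest, hR.bidding, hR.enum, hR.mark⟩ ⟨hreg, harr, ?_, hext⟩ ?_ ?_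
    · rw [St.tick_clock]
      have h1 : M * (2 * s.reg 2 + 3 * ∑ v ∈ S, s'.arr 6 v) ≤ M * (C.card * (6 * L + 2)) := by
        refine Nat.mul_le_mul_left _ ?_
        rw [hcard] at hpot ⊢
        have : s.reg 2 * (6 * L + 2) = 3 * (2 * s.reg 2 * L) + 2 * s.reg 2 := by ring
        omega
      omega
    · have hb := hR.bidding
      rw [m8] at hb
      refine hb.done hcov hsymm fun u hu => ?_
      obtain ⟨i, hi, h1⟩ := hC.exists_index hu
      exact ⟨i, by omega, by rw [harr 0 (by norm_num) (by norm_num)]; exact h1⟩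
    · have : C.card * (4 * L + 1) = 2 * (2 * C.card * L) + C.card := by ring
      omega

end mainLoop

/-! ### Passes over a list -/

/-- Between `s` and `s'` only the registers in `rs` and those from 50 on, the arrays in `as`, and
detection instances have changed, and at most `b` instructions have been executed. -/
structure Keeps (rs as : List ℕ) (b : ℕ) (s s' : St) : Prop where
  reg : ∀ r < 50, r ∉ rs → s'.reg r = s.reg r
  arr : ∀ a, a ∉ as → s'.arr a = s.arr a
  clock : s'.clock ≤ s.clock + b
  ext : s'.ext = s.ext

/-- Run `P` with register 12 going from zero up to the value of register `n`. -/
def forEach (n : ℕ) (P : Prog) : Prog :=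
  .const 12 0 ;; .while 12 n (P ;; .const 29 1 ;; .add 12 12 29)

/-- The loop itself overwrites registers 29 and 12 after the body, so the invariant is required for
the state after these assignments. -/
theorem wp_forEach {e : Env} {n len : ℕ} {P : Prog} {s : St} {Q : St → Prop} (I : ℕ → St → Prop)
    (hn : n ≠ 12) (hn' : n ≠ 29) (hlen : s.reg n = len) (h0 : I 0 (s.set 12 0))
    (hstep : ∀ i < len, ∀ s, s.reg 12 = i → s.reg n = len → I i s →
      wp e P (fun s' => s'.reg 12 = i ∧ s'.reg n = len ∧ I (i + 1) ((s'.set 29 1).set 12 (i + 1)))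
        s.tick)
    (hQ : ∀ s, I len s → Q s.tick) : wp e (forEach n P) Q s := by
  simp only [forEach, wp_seq, wp_const]
  refine wp_while (fun s' => s'.reg n = len ∧ s'.reg 12 ≤ len ∧ I (s'.reg 12) s')
    (fun s' => len - s'.reg 12) ?_ ?_ ?_
  · simp [hn, hlen]
    exact h0
  · rintro s' ⟨h1, h2, h3⟩ hlt
    rw [h1] at hlt
    simp only [wp_seq]
    refine wp_mono (hstep _ hlt s' rfl h1 h3) ?_
    rintro s'' ⟨h4, h5, h6⟩
    simp [h4, h5, hn, hn']
    exact ⟨⟨hlt, h6⟩, by omega⟩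
  · rintro s' ⟨h1, h2, h3⟩ hlt
    have : s'.reg 12 = len := by omega
    rw [this] at h3
    exact hQ s' h3

/-- The set of the first `i` values of `a`. -/
def initial (a : ℕ → ℕ) (i : ℕ) : Finset ℕ := (Finset.range i).image a

theorem initial_zero (a : ℕ → ℕ) : initial a 0 = ∅ := rfl

theorem initial_succ (a : ℕ → ℕ) (i : ℕ) : initial a (i + 1) = insert (a i) (initial a i) := by
  rw [initial, Finset.range_add_one, Finset.image_insert]; rfl

theorem Enum.initial_eq {a : ℕ → ℕ} {n : ℕ} {V : Finset ℕ} (h : Enum a n V) : initial a n = V := h.1.symm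

theorem Enum.notMem_initial {a : ℕ → ℕ} {n i : ℕ} {V : Finset ℕ} (h : Enum a n V) (hi : i < n) :
    a i ∉ initial a i := by
  intro hm
  obtain ⟨j, hj, h1⟩ := Finset.mem_image.1 hm
  rw [Finset.mem_range] at hj
  have := h.inj j (by omega) i hi h1
  omega

open Rounding

section passes
variable {e : Env} {L R t d N : ℕ} {S V : Finset ℕ} {z : ℕ → ℕ}

/-- Compute the fractional cover in array 11, and the number of matched vertices in register 10. -/
def dualPass (L : ℕ) : Prog :=
  .const 10 0 ;; .const 20 0 ;; .const 22 (L + 1) ;;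
  forEach 7 (.const 29 1 ;; .load 21 9 12 ;; .load 23 6 21 ;; .load 24 8 21 ;;
    .ite 20 24 (.add 10 10 29 ;; .sub 24 24 29 ;; .load 24 6 24 ;; .sub 24 22 24 ;; .add 23 23 24)
      .skip ;; .store 11 21 23)

theorem wp_dualPass {s : St} {Q : St → Prop} (hE : Enum (s.arr 9) (s.reg 7) V)
    (hQ : ∀ s', Keeps [10, 12, 20, 21, 22, 23, 24, 29] [11] (20 * V.card + 20) s s' →
      s'.cont = s.cont → s'.reg 10 = (matched V (s.arr 8)).card → s'.reg 20 = 0 →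
      (∀ v ∈ V, s'.arr 11 v = dualVal L (s.arr 6) (s.arr 8) v) → Q s') : wp e (dualPass L) Q s := by
  simp only [dualPass, wp_seq, wp_const]
  refine wp_forEach (fun i s' => Keeps [10, 12, 20, 21, 22, 23, 24, 29] [11] (20 * i + 10) s s' ∧
    s'.cont = s.cont ∧ s'.reg 10 = (matched (initial (s.arr 9) i) (s.arr 8)).card ∧ s'.reg 20 = 0 ∧
    s'.reg 22 = L + 1 ∧
    ∀ v ∈ initial (s.arr 9) i, s'.arr 11 v = dualVal L (s.arr 6) (s.arr 8) v) (by norm_num)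
    (by norm_num) (len := s.reg 7) (by simp) ?_ ?_ ?_
  · refine ⟨⟨fun r _ hr => ?_, fun a _ => rfl, by simp, rfl⟩, rfl, ?_, ?_, ?_, ?_⟩
    · simp at hr
      simp [hr]
    · simp [initial_zero, matched]
    · simp
    · simp
    · simp [initial_zero]
  · rintro i hi s' h12 h7 ⟨hk, hcont, h10, h20, h22, hz⟩
    have e9 := hk.arr 9 (by simp)
    have e8 := hk.arr 8 (by simp)
    have e6 := hk.arr 6 (by simp)
    have hni := hE.notMem_initial hi
    have hc := hk.clock
    have hvne : ∀ v ∈ initial (s.arr 9) i, v ≠ s.arr 9 i := fun v hv h => hni (h ▸ hv)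
    have hmat : (matched (initial (s.arr 9) (i + 1)) (s.arr 8)).card =
        (matched (initial (s.arr 9) i) (s.arr 8)).card + if s.arr 8 (s.arr 9 i) = 0 then 0 else 1 := by
      rw [initial_succ, matched, matched, Finset.filter_insert]
      by_cases h1 : s.arr 8 (s.arr 9 i) = 0
      · rw [if_neg (not_not.2 h1), if_pos h1, add_zero]
      · rw [if_pos h1, if_neg h1,
          Finset.card_insert_of_notMem (fun h => hni (Finset.mem_filter.1 h).1)]
    by_cases hm : s.arr 8 (s.arr 9 i) = 0
    · simp [h12, e9, e8, e6, h20, hm, h7]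
      refine ⟨⟨fun r hr hrs => ?_, fun a ha => ?_, ?_, hk.ext⟩, hcont, ?_, h22, ?_⟩
      · have h1 := hk.reg r hr hrs
        simp at hrs
        simp [hrs, h1]
      · have h1 := hk.arr a ha
        simp at ha
        simp [ha, h1]
      · simp; omega
      · rw [hmat, if_pos hm]; exact h10
      · intro v hv
        rw [initial_succ, Finset.mem_insert] at hv
        rcases hv with rfl | hv
        · simp [dualVal, hm]
        · simp [hvne v hv, hz v hv]
    · have hm' : 0 < s.arr 8 (s.arr 9 i) := Nat.pos_of_ne_zero hm
      simp [h12, e9, e8, e6, h20, hm', h7, h22]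
      refine ⟨⟨fun r hr hrs => ?_, fun a ha => ?_, ?_, hk.ext⟩, hcont, ?_, ?_⟩
      · have h1 := hk.reg r hr hrs
        simp at hrs
        simp [hrs, h1]
      · have h1 := hk.arr a ha
        simp at ha
        simp [ha, h1]
      · simp; omega
      · rw [hmat, if_neg hm]; simp [h10]
      · intro v hv
        rw [initial_succ, Finset.mem_insert] at hv
        rcases hv with rfl | hv
        · simp [dualVal, hm, add_comm]
        · simp [hvne v hv, hz v hv]
  · rintro s' ⟨hk, hcont, h10, h20, h22, hz⟩
    rw [hE.initial_eq] at h10 hz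
    refine hQ _ ⟨hk.reg, hk.arr, ?_, hk.ext⟩ hcont h10 h20 hz
    have := hk.clock
    rw [hE.2, St.tick_clock]
    omega

/-- Add register 16 to register 13 if the edge of the values in registers 22 and 23 is crossing. -/
def crossTest : Prog :=
  .ite 22 14 .skip (.ite 23 14 .skip (.ite 15 22 (.add 13 13 16) (.ite 15 23 (.add 13 13 16) .skip)))

theorem wp_crossTest {s : St} {Q : St → Prop}
    (hQ : ∀ s', Keeps [13] [] 5 s s' → s'.cont = s.cont →
      s'.reg 13 = s.reg 13 + (if s.reg 14 ≤ s.reg 22 ∧ s.reg 14 ≤ s.reg 23 ∧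
        (s.reg 15 < s.reg 22 ∨ s.reg 15 < s.reg 23) then s.reg 16 else 0) → Q s') :
    wp e crossTest Q s := by
  by_cases h1 : s.reg 22 < s.reg 14
  · simp [crossTest, h1]
    refine hQ _ ⟨fun _ _ _ => rfl, fun _ _ => rfl, by simp, rfl⟩ rfl ?_
    rw [if_neg (by omega)]; rfl
  by_cases h2 : s.reg 23 < s.reg 14
  · simp [crossTest, h1, h2]
    refine hQ _ ⟨fun _ _ _ => rfl, fun _ _ => rfl, by simp, rfl⟩ rfl ?_
    rw [if_neg (by omega)]; rfl
  by_cases h3 : s.reg 15 < s.reg 22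
  · simp [crossTest, h1, h2, h3]
    refine hQ _ ⟨fun r _ hr => ?_, fun _ _ => rfl, by simp, rfl⟩ rfl ?_
    · simp at hr
      simp [hr]
    · rw [if_pos (by omega)]; simp
  by_cases h4 : s.reg 15 < s.reg 23
  · simp [crossTest, h1, h2, h3, h4]
    refine hQ _ ⟨fun r _ hr => ?_, fun _ _ => rfl, by simp, rfl⟩ rfl ?_
    · simp at hr
      simp [hr]
    · rw [if_pos (by omega)]; simp
  · simp [crossTest, h1, h2, h3, h4]
    refine hQ _ ⟨fun _ _ _ => rfl, fun _ _ => rfl, by simp, rfl⟩ rfl ?_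
    rw [if_neg (by omega)]; rfl

/-- For the threshold in register 11, count the crossing edges in register 13, in multiples of
register 16. -/
def countCrossing : Prog :=
  .sub 14 17 11 ;; .add 15 17 11 ;; .const 13 0 ;; .const 20 0 ;;
  forEach 7 (.const 29 1 ;; .load 21 9 12 ;; .load 24 8 21 ;;
    .ite 20 24 (.sub 24 24 29 ;; .load 22 11 21 ;; .load 23 11 24 ;; crossTest) .skip)

/-- Multiplication is not available, so the count is kept in multiples of register 16. With `R`
there, it can be compared directly with `2 * |M|`. -/
theorem wp_countCrossing {s : St} {Q : St → Prop} (hE : Enum (s.arr 9) (s.reg 7) V)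
    (hz : ∀ v ∈ V, s.arr 11 v = z v) (hmt : ∀ v ∈ V, s.arr 8 v ≠ 0 → s.arr 8 v - 1 ∈ V)
    (hQ : ∀ s', Keeps [12, 13, 14, 15, 20, 21, 22, 23, 24, 29] [] (20 * V.card + 20) s s' →
      s'.cont = s.cont →
      s'.reg 13 = (crossing V (s.arr 8) z (s.reg 17) (s.reg 11)).card * s.reg 16 →
      s'.reg 14 = s.reg 17 - s.reg 11 → s'.reg 15 = s.reg 17 + s.reg 11 → Q s') :
    wp e countCrossing Q s := by
  simp only [countCrossing, wp_seq, wp_const, wp_sub, wp_add]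
  refine wp_forEach (fun i s' => Keeps [12, 13, 14, 15, 20, 21, 22, 23, 24, 29] [] (20 * i + 10) s s' ∧
    s'.cont = s.cont ∧
    s'.reg 13 = (crossing (initial (s.arr 9) i) (s.arr 8) z (s.reg 17) (s.reg 11)).card * s.reg 16 ∧
    s'.reg 14 = s.reg 17 - s.reg 11 ∧ s'.reg 15 = s.reg 17 + s.reg 11 ∧ s'.reg 20 = 0) (by norm_num)
    (by norm_num) (len := s.reg 7) (by simp) ?_ ?_ ?_
  · refine ⟨⟨fun r _ hr => ?_, fun a _ => rfl, by simp, rfl⟩, rfl, ?_, ?_, ?_, ?_⟩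
    · simp at hr
      simp [hr]
    · simp [initial_zero, crossing, matched]
    · simp
    · simp
    · simp
  · rintro i hi s' h12 h7 ⟨hk, hcont, h13, h14, h15, h20⟩
    have e9 := hk.arr 9 (by simp)
    have e8 := hk.arr 8 (by simp)
    have e11 := hk.arr 11 (by simp)
    have e16 := hk.reg 16 (by norm_num) (by simp)
    have hni := hE.notMem_initial hi
    have hiV := hE.mem hi
    have hc := hk.clock
    have hcr : (crossing (initial (s.arr 9) (i + 1)) (s.arr 8) z (s.reg 17) (s.reg 11)).card =
        (crossing (initial (s.arr 9) i) (s.arr 8) z (s.reg 17) (s.reg 11)).card +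
        if s.arr 8 (s.arr 9 i) ≠ 0 ∧ s.reg 17 - s.reg 11 ≤ z (s.arr 9 i) ∧
          s.reg 17 - s.reg 11 ≤ z (s.arr 8 (s.arr 9 i) - 1) ∧ (s.reg 17 + s.reg 11 < z (s.arr 9 i) ∨
          s.reg 17 + s.reg 11 < z (s.arr 8 (s.arr 9 i) - 1)) then 1 else 0 := by
      rw [crossing, crossing, matched, matched, Finset.filter_filter, Finset.filter_filter,
        initial_succ, Finset.filter_insert]
      split_ifs
      · rw [Finset.card_insert_of_notMem (fun h => hni (Finset.mem_filter.1 h).1)]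
      · rfl
    by_cases hm : s.arr 8 (s.arr 9 i) = 0
    · simp [h12, e9, e8, h20, hm, h7]
      refine ⟨⟨fun r hr hrs => ?_, fun a ha => hk.arr a ha, ?_, hk.ext⟩, hcont, ?_, h14, h15⟩
      · have h1 := hk.reg r hr hrs
        simp at hrs
        simp [hrs, h1]
      · simp; omega
      · rw [hcr, if_neg (by simp [hm])]; exact h13
    · have hm' : 0 < s.arr 8 (s.arr 9 i) := Nat.pos_of_ne_zero hm
      simp [h12, e9, e8, h20, hm', e11]
      refine wp_crossTest ?_
      intro s₂ hk₂ hc₂ h13₂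
      have hc' := hk₂.clock
      simp at hc'
      have g : ∀ r < 50, r ∉ [12, 13, 21, 22, 23, 24, 29] → s₂.reg r = s'.reg r := by
        intro r hr hrs
        simp at hrs
        rw [hk₂.reg r hr (by simp [hrs])]
        simp [hrs]
      have g12 : s₂.reg 12 = i := by rw [hk₂.reg 12 (by norm_num) (by simp)]; simp [h12]
      refine ⟨g12, by rw [g 7 (by norm_num) (by simp), h7],
        ⟨fun r hr hrs => ?_, fun a ha => ?_, ?_, ?_⟩, ?_, ?_, ?_, ?_, ?_⟩
      · have h1 := hk.reg r hr hrs
        simp at hrs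
        simp [hrs, g r hr (by simp [hrs]), h1]
      · rw [← hk.arr a ha]; exact hk₂.arr a (by simp)
      · simp; omega
      · rw [← hk.ext]; exact hk₂.ext
      · rw [← hcont]; exact hc₂
      · simp [h13₂, hcr, h13, h14, h15, e16, hz _ hiV, hz _ (hmt _ hiV hm), hm, add_mul]
      · simp [g, h14]
      · simp [g, h15]
      · simp [g, h20]
  · rintro s' ⟨hk, hcont, h13, h14, h15, h20⟩
    rw [hE.initial_eq] at h13
    refine hQ _ ⟨hk.reg, hk.arr, ?_, hk.ext⟩ hcont h13 h14 h15
    have := hk.clock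
    rw [hE.2, St.tick_clock]
    omega

/-- Find a threshold with few crossing edges. -/
def findThreshold (R : ℕ) : Prog :=
  .const 16 R ;; .const 17 (2 * R) ;; .const 11 0 ;; .add 18 10 10 ;; countCrossing ;;
  .while 18 13 (.const 29 1 ;; .add 11 11 29 ;; countCrossing)

/-- Thresholds are tried from zero upwards. A good one exists below `R`, which stops the loop and
bounds its cost. -/
theorem wp_findThreshold {s : St} {Q : St → Prop} (hE : Enum (s.arr 9) (s.reg 7) V)
    (hz : ∀ v ∈ V, s.arr 11 v = z v) (hmt : ∀ v ∈ V, s.arr 8 v ≠ 0 → s.arr 8 v - 1 ∈ V)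
    (hex : ∃ t < R, (crossing V (s.arr 8) z (2 * R) t).card * R ≤ 2 * s.reg 10)
    (hQ : ∀ s' t, Keeps [11, 12, 13, 14, 15, 16, 17, 18, 20, 21, 22, 23, 24, 29] []
        ((20 * V.card + 25) * (R + 1)) s s' →
      s'.cont = s.cont → t < R → (crossing V (s.arr 8) z (2 * R) t).card * R ≤ 2 * s.reg 10 →
      s'.reg 14 = 2 * R - t → s'.reg 15 = 2 * R + t → Q s') :
    wp e (findThreshold R) Q s := by
  obtain ⟨t₀, ht₀, hex⟩ := hex
  simp only [findThreshold, wp_seq, wp_const, wp_add]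
  refine wp_countCrossing (z := z) (V := V) (by simpa using hE) hz hmt ?_
  intro s₁ hk₁ hc₁ h13 h14 h15
  simp at h13 h14 h15
  have g : ∀ r < 50, r ∉ [11, 12, 13, 14, 15, 16, 17, 18, 20, 21, 22, 23, 24, 29] →
      s₁.reg r = s.reg r := by
    intro r hr hrs
    simp at hrs
    rw [hk₁.reg r hr (by simp [hrs])]
    simp [hrs]
  refine wp_while (fun s' => ∃ t < R, t ≤ t₀ ∧ 
      Keeps [11, 12, 13, 14, 15, 16, 17, 18, 20, 21, 22, 23, 24, 29] []
        ((20 * V.card + 25) * (t + 1)) s s' ∧ s'.cont = s.cont ∧ s'.reg 11 = t ∧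
      s'.reg 16 = R ∧ s'.reg 17 = 2 * R ∧ s'.reg 18 = 2 * s.reg 10 ∧
      s'.reg 13 = (crossing V (s.arr 8) z (2 * R) t).card * R ∧ s'.reg 14 = 2 * R - t ∧
      s'.reg 15 = 2 * R + t) (fun s' => R - s'.reg 11) ?_ ?_ ?_
  · refine ⟨0, by omega, by omega, ⟨fun r hr hrs => g r hr hrs, fun a ha => hk₁.arr a (by simp), ?_,
      hk₁.ext⟩, hc₁, ?_, ?_, ?_, ?_, h13, h14, h15⟩
    · have := hk₁.clock
      simp at this ⊢
      omega
    · rw [hk₁.reg 11 (by norm_num) (by simp)]; simp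
    · rw [hk₁.reg 16 (by norm_num) (by simp)]; simp
    · rw [hk₁.reg 17 (by norm_num) (by simp)]; simp
    · rw [hk₁.reg 18 (by norm_num) (by simp)]; simp; ring
  · rintro s' ⟨t, htR, ht, hk, hcont, h11, h16, h17, h18, h13', h14', h15'⟩ hlt
    have htt : t ≠ t₀ := by
      rintro rfl
      rw [h18, h13'] at hlt
      omega
    simp only [wp_seq, wp_const, wp_add]
    have e9 := hk.arr 9 (by simp)
    have e8 := hk.arr 8 (by simp)
    have e11 := hk.arr 11 (by simp)
    have e7 := hk.reg 7 (by norm_num) (by simp)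
    refine wp_countCrossing (z := z) (V := V) ?_ ?_ ?_ ?_
    · simpa [e7, e9] using hE
    · simpa [e11] using hz
    · simpa [e8] using hmt
    intro s₂ hk₂ hc₂ m13 m14 m15
    simp [h17, h11, h16, e8] at m13 m14 m15
    have m11 : s₂.reg 11 = t + 1 := by rw [hk₂.reg 11 (by norm_num) (by simp)]; simp [h11]
    refine ⟨⟨t + 1, by omega, by omega, ⟨fun r hr hrs => ?_, fun a ha => ?_, ?_, ?_⟩, ?_, m11, ?_, ?_,
      ?_, m13, m14, m15⟩, ?_⟩
    · have h1 := hk.reg r hr hrs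
      simp at hrs
      rw [hk₂.reg r hr (by simp [hrs])]
      simp [hrs, h1]
    · rw [hk₂.arr a (by simp)]; exact hk.arr a ha
    · have h1 := hk₂.clock
      have h2 := hk.clock
      simp at h1
      have : (20 * V.card + 25) * (t + 1 + 1) = (20 * V.card + 25) * (t + 1) + (20 * V.card + 25) := by
        ring
      omega
    · rw [hk₂.ext]; exact hk.ext
    · rw [hc₂]; exact hcont
    · rw [hk₂.reg 16 (by norm_num) (by simp)]; simp [h16]
    · rw [hk₂.reg 17 (by norm_num) (by simp)]; simp [h17]
    · rw [hk₂.reg 18 (by norm_num) (by simp)]; simp [h18]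
    · simp only [m11, h11]; omega
  · rintro s' ⟨t, htR, ht, hk, hcont, h11, h16, h17, h18, h13', h14', h15'⟩ hlt
    rw [h18, h13'] at hlt
    refine hQ _ t ⟨hk.reg, hk.arr, ?_, hk.ext⟩ hcont htR (by omega) h14' h15'
    have h1 := hk.clock
    have : (20 * V.card + 25) * (t + 1) + (20 * V.card + 25) ≤ (20 * V.card + 25) * (R + 1) := by
      rw [← Nat.mul_succ]
      exact Nat.mul_le_mul_left _ (by omega)
    rw [St.tick_clock]
    omega

/-- List the vertices of value about one half in array 12, their number in register 19, and `q` times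
their number in register 16.  They are all marked in array 13. -/
def listMid (q : ℕ) : Prog :=
  .const 19 0 ;; .const 16 0 ;; .const 17 q ;;
  forEach 7 (.const 29 1 ;; .load 21 9 12 ;; .load 22 11 21 ;;
    .ite 22 14 .skip (.ite 15 22 .skip
      (.store 12 19 21 ;; .store 13 19 29 ;; .add 19 19 29 ;; .add 16 16 17)))

/-- Adding `q` for each listed vertex replaces a multiplication. All of them are marked in advance,
so that they all enter the cover if the static algorithm is not called. -/
theorem wp_listMid {s : St} {Q : St → Prop} {q : ℕ} (hE : Enum (s.arr 9) (s.reg 7) V)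
    (hz : ∀ v ∈ V, s.arr 11 v = z v) (h14 : s.reg 14 = 2 * R - t) (h15 : s.reg 15 = 2 * R + t)
    (hQ : ∀ s', Keeps [12, 16, 17, 19, 21, 22, 29] [12, 13] (20 * V.card + 20) s s' →
      s'.cont = s.cont → Enum (s'.arr 12) (s'.reg 19) (mid V z R t) →
      (∀ i < s'.reg 19, s'.arr 13 i = 1) → s'.reg 16 = q * (mid V z R t).card → Q s') :
    wp e (listMid q) Q s := by
  simp only [listMid, wp_seq, wp_const]
  refine wp_forEach (fun i s' => Keeps [12, 16, 17, 19, 21, 22, 29] [12, 13] (20 * i + 10) s s' ∧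
    s'.cont = s.cont ∧ Enum (s'.arr 12) (s'.reg 19) (mid (initial (s.arr 9) i) z R t) ∧
    (∀ i < s'.reg 19, s'.arr 13 i = 1) ∧ s'.reg 16 = q * (mid (initial (s.arr 9) i) z R t).card ∧
    s'.reg 17 = q) (by norm_num)
    (by norm_num) (len := s.reg 7) (by simp) ?_ ?_ ?_
  · refine ⟨⟨fun r _ hr => ?_, fun a _ => rfl, by simp, rfl⟩, rfl, ?_, ?_, ?_, ?_⟩
    · simp at hr
      simp [hr]
    · simp [initial_zero, mid, Enum]
    · simp
    · simp [initial_zero, mid]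
    · simp
  · rintro i hi s' h12 h7 ⟨hk, hcont, hEW, hb, h16, h17⟩
    have e9 := hk.arr 9 (by simp)
    have e11 := hk.arr 11 (by simp)
    have e14 := hk.reg 14 (by norm_num) (by simp)
    have e15 := hk.reg 15 (by norm_num) (by simp)
    have hni := hE.notMem_initial hi
    have hiV := hE.mem hi
    have hc := hk.clock
    have hmid : mid (initial (s.arr 9) (i + 1)) z R t =
        if 2 * R - t ≤ z (s.arr 9 i) ∧ z (s.arr 9 i) ≤ 2 * R + t then
          insert (s.arr 9 i) (mid (initial (s.arr 9) i) z R t) else mid (initial (s.arr 9) i) z R t := by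
      rw [mid, mid, initial_succ, Finset.filter_insert]
    have hmidn : s.arr 9 i ∉ mid (initial (s.arr 9) i) z R t := fun h => hni (Finset.mem_filter.1 h).1
    by_cases h1 : z (s.arr 9 i) < 2 * R - t
    · simp [h12, e9, e11, h7, e14, hz _ hiV, h14, h1]
      rw [if_neg (by omega)] at hmid
      refine ⟨⟨fun r hr hrs => ?_, fun a ha => hk.arr a ha, ?_, hk.ext⟩, hcont, hmid ▸ hEW, hb,
        hmid ▸ h16, h17⟩
      · have h1 := hk.reg r hr hrs
        simp at hrs
        simp [hrs, h1]
      · simp; omega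
    by_cases h2 : 2 * R + t < z (s.arr 9 i)
    · simp [h12, e9, e11, h7, e14, e15, hz _ hiV, h14, h15, h1, h2]
      rw [if_neg (by omega)] at hmid
      refine ⟨⟨fun r hr hrs => ?_, fun a ha => hk.arr a ha, ?_, hk.ext⟩, hcont, hmid ▸ hEW, hb,
        hmid ▸ h16, h17⟩
      · have h1 := hk.reg r hr hrs
        simp at hrs
        simp [hrs, h1]
      · simp; omega
    · simp [h12, e9, e11, h7, e14, e15, hz _ hiV, h14, h15, h1, h2]
      rw [if_pos (by omega)] at hmid
      have hpush := hEW.push hmidn rfl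
      refine ⟨⟨fun r hr hrs => ?_, fun a ha => ?_, ?_, hk.ext⟩, hcont, hmid ▸ hpush, ?_, ?_, h17⟩
      · have h1 := hk.reg r hr hrs
        simp at hrs
        simp [hrs, h1]
      · have h1 := hk.arr a ha
        simp at ha
        simp [ha, h1]
      · simp; omega
      · intro j hj
        rcases Nat.lt_or_eq_of_le hj with hj | hj
        · simp [hj.ne, hb j hj]
        · simp [hj]
      · rw [hmid, Finset.card_insert_of_notMem hmidn, h16, h17]; ring
  · rintro s' ⟨hk, hcont, hEW, hb, h16, h17⟩
    rw [hE.initial_eq] at hEW h16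
    refine hQ _ ⟨hk.reg, hk.arr, ?_, hk.ext⟩ hcont hEW hb h16
    have := hk.clock
    rw [hE.2, St.tick_clock]
    omega

end passes

open Rounding

/-! ### Building the new cover -/

/-- Run the static algorithm on the vertices of value about one half, unless they are few. -/
def solveMid : Prog := .ite 10 16 (.solve 12 13 19) .skip

/-- Clear the arrays 1, 7, 8 and 14. -/
def clearPass : Prog :=
  .const 20 0 ;; forEach 7 (.load 21 9 12 ;; .store 1 21 20 ;; .store 7 21 20 ;; .store 8 21 20 ;;
    .store 14 21 20)

/-- Put all vertices back to level zero and into the reservoir. -/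
def levelPass (L : ℕ) : Prog :=
  forEach 7 (.load 21 9 12 ;; .load 22 6 21 ;; setDelete 22 21 ;; .const 20 0 ;; setInsert 20 21 ;;
    .store 6 21 20 ;; .const 30 (L + 1) ;; setInsert 30 21)

/-- Move the vertex in register `r` from the reservoir to the cover. -/
def coverVertex (L r : ℕ) : Prog := .const 30 (L + 1) ;; setDelete 30 r ;; pushCover r

/-- Put the vertices of high value into the cover. -/
def highPass (L : ℕ) : Prog :=
  .const 2 0 ;; forEach 7 (.load 21 9 12 ;; .load 22 11 21 ;; .ite 15 22 (coverVertex L 21) .skip)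

/-- Put the marked vertices of value about one half into the cover. -/
def midPass (L : ℕ) : Prog :=
  .const 20 0 ;; forEach 19 (.load 21 12 12 ;; .load 22 13 12 ;; .ite 20 22 (coverVertex L 21) .skip)

section newCover
variable {e : Env} {L R t d N : ℕ} {S V C W X : Finset ℕ} {z : ℕ → ℕ}

/-- The static algorithm runs only if `|M| < q * |W|`, when the promise can be guaranteed; a smaller
`W` is its own cover. -/
theorem wp_solveMid {s : St} {Q : St → Prop} (hE : Enum (s.arr 12) (s.reg 19) W)
    (hb : ∀ i < s.reg 19, s.arr 13 i = 1) (hlive : ↑W ⊆ e.live)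
    (hprom : s.reg 10 < s.reg 16 → (W.card : ℝ) ≤ e.ρ * vc e.adj W)
    (hQ : ∀ s' X, Keeps [] [13] (W.card + 2) s { s' with ext := s.ext } → s'.cont = s.cont →
      IsCov e.adj W X →
      (∀ i < s.reg 19, s'.arr 13 i = if s.arr 12 i ∈ X then 1 else 0) →
      ((s.reg 10 < s.reg 16 ∧ (X.card : ℝ) ≤ e.c * vc e.adj W ∧
          (s'.ext : ℝ) ≤ s.ext + e.T W.card) ∨
        (s.reg 16 ≤ s.reg 10 ∧ X = W ∧ s'.ext = s.ext)) → Q s') : wp e solveMid Q s := by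
  simp only [solveMid, wp_ite]
  split_ifs with h
  · simp only [wp]
    have hW : (Finset.range (s.tick.reg 19)).image (s.tick.arr 12) = W := hE.1.symm
    rw [hW]
    refine ⟨?_, ?_, ?_, ?_⟩
    · refine (List.nodup_map_iff_inj_on List.nodup_range).2 fun i hi j hj hij => ?_
      exact hE.inj i (List.mem_range.1 hi) j (List.mem_range.1 hj) hij
    · intro i hi
      exact hlive (hE.mem hi)
    · have := hprom h
      rw [hE.2] at this
      exact this
    · intro X t hX hc ht
      rw [St.tick_reg, ← hE.2] at ht
      refine hQ _ X ⟨fun _ _ _ => rfl, fun a ha => ?_, ?_, rfl⟩ rfl hX ?_ (Or.inl ⟨h, hc, ?_⟩)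
      · simp at ha
        simp [ha]
      · simp [hE.2]; omega
      · intro i hi
        simp [hi]
        congr
      · simp only [St.bits_ext, St.tick_ext]
        push_cast
        linarith
  · refine hQ _ W ⟨fun _ _ _ => rfl, fun _ _ => rfl, by simp, rfl⟩ rfl
      ⟨subset_rfl, fun u hu v hv _ => Or.inl hu⟩ ?_ (Or.inr ⟨by omega, rfl, rfl⟩)
    intro i hi
    simp [hb i hi, hE.mem hi]

/-- These arrays vanish outside the touched vertices, so clearing them takes time proportional to
`|V|` and not to the number of objects. -/
theorem wp_clearPass {s : St} {Q : St → Prop} (hE : Enum (s.arr 9) (s.reg 7) V)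
    (hout : ∀ a ∈ [1, 7, 8, 14], ∀ v, v ∉ V → s.arr a v = 0)
    (hQ : ∀ s', Keeps [12, 20, 21, 29] [1, 7, 8, 14] (10 * V.card + 10) s s' → s'.cont = s.cont →
      (∀ a ∈ [1, 7, 8, 14], s'.arr a = 0) → Q s') : wp e clearPass Q s := by
  simp only [clearPass, wp_seq, wp_const]
  refine wp_forEach (fun i s' => Keeps [12, 20, 21, 29] [1, 7, 8, 14] (10 * i + 5) s s' ∧
    s'.cont = s.cont ∧ s'.reg 20 = 0 ∧ ∀ a ∈ [1, 7, 8, 14], ∀ v,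
      v ∉ V ∨ v ∈ initial (s.arr 9) i → s'.arr a v = 0) (by norm_num)
    (by norm_num) (len := s.reg 7) (by simp) ?_ ?_ ?_
  · refine ⟨⟨fun r _ hr => ?_, fun a _ => rfl, by simp, rfl⟩, rfl, by simp, ?_⟩
    · simp at hr
      simp [hr]
    · intro a ha v hv
      rw [initial_zero] at hv
      exact hout a ha v (hv.resolve_right (by simp))
  · rintro i hi s' h12 h7 ⟨hk, hcont, h20, hz⟩
    have e9 := hk.arr 9 (by simp)
    have hc := hk.clock
    simp [h12, e9, h7, h20]
    refine ⟨⟨fun r hr hrs => ?_, fun a ha => ?_, ?_, hk.ext⟩, hcont, ?_⟩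
    · have h1 := hk.reg r hr hrs
      simp at hrs
      simp [hrs, h1]
    · have h1 := hk.arr a ha
      simp at ha
      simp [ha, h1]
    · simp; omega
    · simp at hz
      simp only [initial_succ, Finset.mem_insert]
      refine ⟨fun v hv => ?_, fun v hv => ?_, fun v hv => ?_, fun v hv => ?_⟩ <;>
        by_cases h1 : v = s.arr 9 i <;> simp [h1] <;> simp [h1] at hv
      · exact hz.1 v hv
      · exact hz.2.1 v hv
      · exact hz.2.2.1 v hv
      · exact hz.2.2.2 v hv
  · rintro s' ⟨hk, hcont, h20, hz⟩
    rw [hE.initial_eq] at hz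
    refine hQ _ ⟨hk.reg, hk.arr, ?_, hk.ext⟩ hcont ?_
    · have := hk.clock
      rw [hE.2, St.tick_clock]
      omega
    · intro a ha
      funext v
      exact hz a ha v (or_comm.1 (Classical.em _))

/-- Three moves for one vertex: out of its level, into level zero, and back into the reservoir,
which makes it untouched. -/
theorem auctionSets_reset {x j k : ℕ} {p p' : ℕ → ℕ} {A₁ A₂ : ℕ → Set ℕ} (hj : j ≤ L)
    (hx : x ∈ S) (hpx : p x = j) (hp : p' = Function.update p x 0) (hk : k < L + 2)
    (hA₁ : A₁ = Function.update (auctionSets S V L p) j (auctionSets S V L p j \ {x}))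
    (hA₂ : A₂ = Function.update A₁ 0 (insert x (A₁ 0))) :
    auctionSets S (V.erase x) L p' k =
      Function.update A₂ (L + 1) (insert x (A₂ (L + 1))) k := by
  ext v
  by_cases hv : v = x
  · subst hv
    by_cases h1 : k = L + 1
    · subst h1
      simp [auctionSets, hx]
    · rw [Function.update_of_ne h1, hA₂]
      by_cases h0 : k = 0
      · subst h0
        simp [auctionSets, hx, hp]
      · rw [Function.update_of_ne h0, hA₁]
        by_cases hkj : k = j
        · subst hkj
          simp [auctionSets, hp, hj, Ne.symm h0]
        · rw [Function.update_of_ne hkj]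
          have hkL : k ≤ L := by omega
          simp [auctionSets, hp, hpx, Ne.symm h0, Ne.symm hkj, hkL]
  · have h1 : ∀ (f : ℕ → Set ℕ) (i : ℕ), v ∈ Function.update f i (insert x (f i)) k ↔ v ∈ f k := by
      intro f i
      by_cases hik : k = i
      · subst hik; simp [hv]
      · rw [Function.update_of_ne hik]
    have h2 : v ∈ A₁ k ↔ v ∈ auctionSets S V L p k := by
      rw [hA₁]
      by_cases hik : k = j
      · subst hik; simp [hv]
      · rw [Function.update_of_ne hik]
    rw [h1, hA₂, h1, h2]
    simp [auctionSets, hp, hv]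

theorem wp_levelPass {s : St} {Q : St → Prop} (hE : Enum (s.arr 9) (s.reg 7) V)
    (hF : Forest (L + 2) N s.arr s.cont S (auctionSets S V L (s.arr 6))) (hVS : V ⊆ S)
    (hle : ∀ v, s.arr 6 v ≤ L) (hout : ∀ v, v ∉ V → s.arr 6 v = 0) (hd : N < 2 ^ d)
    (hlive : ↑S ⊆ e.live)
    (hQ : ∀ s', Keeps [12, 20, 21, 22, 29, 30] [6] ((15 * d + 30) * V.card + 10) s s' →
      Forest (L + 2) N s'.arr s'.cont S (auctionSets S ∅ L 0) → s'.arr 6 = 0 → Q s') :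
    wp e (levelPass L) Q s := by
  simp only [levelPass]
  refine wp_forEach (fun i s' => Keeps [12, 20, 21, 22, 29, 30] [6] ((15 * d + 30) * i + 5) s s' ∧
    Forest (L + 2) N s'.arr s'.cont S (auctionSets S (V \ initial (s.arr 9) i) L (s'.arr 6)) ∧
    ∀ v, s'.arr 6 v = if v ∈ initial (s.arr 9) i then 0 else s.arr 6 v) (by norm_num)
    (by norm_num) (len := s.reg 7) (by simp) ?_ ?_ ?_
  · refine ⟨⟨fun r _ hr => ?_, fun a _ => rfl, by simp, rfl⟩, ?_, ?_⟩
    · simp at hr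
      simp [hr]
    · rw [initial_zero, Finset.sdiff_empty]; exact hF
    · simp [initial_zero]
  · rintro i hi s' h12 h7 ⟨hk, hF', h6⟩
    have e9 := hk.arr 9 (by simp)
    have hc := hk.clock
    have hni := hE.notMem_initial hi
    have hiV := hE.mem hi
    set x := s.arr 9 i with hx_def
    set V' := V \ initial (s.arr 9) i with hV'
    have hxV' : x ∈ V' := Finset.mem_sdiff.2 ⟨hiV, hni⟩
    have hxS := hVS hiV
    have h6x : s'.arr 6 x = s.arr 6 x := by rw [h6, if_neg hni]
    have hjL : s'.arr 6 x ≤ L := by rw [h6x]; exact hle x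
    simp [h12, e9, ← hx_def]
    refine wp_setDelete (N := N) (S := S) (A := auctionSets S V' L (s'.arr 6)) (w := L + 2) (d := d)
      (by exact hF') hd (by norm_num) (by simp; omega) (by simp [auctionSets, hxS, hjL]) ?_
    intro s₁ hf₁ hF₁
    have g21 := hf₁.reg 21 (by norm_num)
    simp at hF₁ g21
    simp
    set A₁ := Function.update (auctionSets S V' L (s'.arr 6)) (s'.arr 6 x)
      (auctionSets S V' L (s'.arr 6) (s'.arr 6 x) \ {x}) with hA₁
    refine wp_setInsert (N := N) (S := S) (A := A₁) (w := L + 2) (d := d)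
      (by exact hF₁) hd hlive (by norm_num) (by simp) (by simpa [g21] using hxS) ?_ ?_
    · simp [g21, hA₁]
      by_cases h0 : s'.arr 6 x = 0
      · simp [h0]
      · rw [Function.update_of_ne (Ne.symm h0)]
        simp [auctionSets, h0]
    intro s₂ hf₂ hF₂
    have f21 := hf₂.reg 21 (by norm_num)
    have f20 := hf₂.reg 20 (by norm_num)
    simp [g21] at hF₂ f21 f20
    simp [f21, f20]
    set A₂ := Function.update A₁ 0 (insert x (A₁ 0)) with hA₂
    refine wp_setInsert (N := N) (S := S) (A := A₂) (w := L + 2) (d := d)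
      (hF₂.congr (by simp) (by simp) (by simp)) hd hlive (by norm_num) (by simp)
      (by simpa [f21] using hxS) ?_ ?_
    · simp [f21, hA₂, hA₁]
      rw [Function.update_of_ne (by omega)]
      simp [auctionSets, hxV']
    intro s₃ hf₃ hF₃
    simp [f21] at hF₃
    have garr : s₃.arr = Function.update s'.arr 6 (Function.update (s'.arr 6) x 0) := by
      rw [hf₃.arr]
      simp [hf₂.arr, hf₁.arr]
    have greg : ∀ r < 50, r ∉ [20, 21, 22, 30] → s₃.reg r = s'.reg r := by
      intro r hr hrs
      simp at hrs
      rw [hf₃.reg r hr]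
      simp [hrs, hf₂.reg r hr, hf₁.reg r hr]
    refine ⟨by rw [greg 12 (by norm_num) (by simp), h12], by rw [greg 7 (by norm_num) (by simp), h7],
      ⟨fun r hr hrs => ?_, fun a ha => ?_, ?_, ?_⟩, ?_, ?_⟩
    · have h1 := hk.reg r hr hrs
      simp at hrs
      simp [hrs, greg r hr (by simp [hrs]), h1]
    · have h1 := hk.arr a ha
      simp at ha
      simp [ha, garr, h1]
    · have c1 := hf₁.clock
      have c2 := hf₂.clock
      have c3 := hf₃.clock
      simp at c1 c2 c3 ⊢
      rw [mul_add]
      omega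
    · simp [hf₃.ext, hf₂.ext, hf₁.ext, hk.ext]
    · have hV'' : V \ initial (s.arr 9) (i + 1) = V'.erase x := by
        rw [initial_succ, hV', ← hx_def]
        ext v
        simp
        tauto
      rw [hV'']
      simp only [garr, Function.update_self]
      rw [garr] at hF₃
      refine hF₃.congr_sets fun k hk => ?_
      rw [auctionSets_reset hjL hxS rfl rfl hk hA₁ hA₂]
    · intro v
      simp only [garr, Function.update_self, initial_succ, Finset.mem_insert, ← hx_def]
      by_cases hv : v = x
      · simp [hv]
      · simp [hv, h6]
  · rintro s' ⟨hk, hF', h6⟩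
    have h0 : s'.arr 6 = 0 := by
      funext v
      rw [h6, hE.initial_eq]
      split_ifs with hv
      · rfl
      · exact hout v hv
    rw [hE.initial_eq, Finset.sdiff_self, h0] at hF'
    refine hQ _ ⟨hk.reg, hk.arr, ?_, hk.ext⟩ hF' h0
    have := hk.clock
    rw [hE.2, St.tick_clock]
    omega

/-- The reservoir has to remain the complement of the cover, so a vertex that joins the cover leaves
the reservoir. -/
theorem wp_coverVertex {s : St} {Q : St → Prop} {r : ℕ}
    (hF : Forest (L + 2) N s.arr s.cont S (auctionSets S C L 0)) (hC : CoverList (s.reg 2) s.arr C)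
    (hd : N < 2 ^ d) (hr : r < 50) (hr2 : r ≠ 2) (hr30 : r ≠ 30) (hS : s.reg r ∈ S)
    (hh : s.reg r ∉ C)
    (hQ : ∀ s', Keeps [2, 30] [0, 1] (5 * d + 20) s s' →
      Forest (L + 2) N s'.arr s'.cont S (auctionSets S (insert (s.reg r) C) L 0) →
      CoverList (s'.reg 2) s'.arr (insert (s.reg r) C) → Q s') : wp e (coverVertex L r) Q s := by
  simp [coverVertex]
  refine wp_setDelete (N := N) (S := S) (A := auctionSets S C L 0) (w := L + 2) (d := d)
    (by exact hF) hd hr (by simp) (by simp [auctionSets, hr30, hS, hh]) ?_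
  intro s₁ hf₁ hF₁
  have g2 := hf₁.reg 2 (by norm_num)
  have gr := hf₁.reg r hr
  have garr : s₁.arr = s.arr := hf₁.arr
  simp [hr30] at hF₁ g2 gr
  refine wp_pushCover (C := C) ?_ hr hr2 ?_ ?_
  · rw [g2, garr]; exact hC
  · rw [gr]; exact hh
  intro s₂ hC₂ hreg₂ _ harr₂ hcont₂ hclock₂ hext₂
  rw [gr] at hC₂
  refine hQ s₂ ⟨fun q hq hqs => ?_, fun a ha => ?_, ?_, ?_⟩ ?_ hC₂
  · simp at hqs
    rw [hreg₂ q hq (by omega), hf₁.reg q hq]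
    simp [hqs]
  · simp at ha
    rw [harr₂ a (by omega) (by omega), garr]
  · have := hf₁.clock
    simp at this
    omega
  · rw [hext₂, hf₁.ext]; rfl
  · rw [hcont₂]
    refine (hF₁.congr (harr₂ 2 (by norm_num) (by norm_num)) (harr₂ 3 (by norm_num) (by norm_num))
      (harr₂ 4 (by norm_num) (by norm_num))).congr_sets fun k hk => ?_
    exact auctionSets_insert hk

theorem CoverList.empty {arr : ℕ → ℕ → ℕ} (h : arr 1 = 0) : CoverList 0 arr ∅ :=
  ⟨by simp, by simp, fun v _ => by rw [h]; rfl⟩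

theorem wp_highPass {s : St} {Q : St → Prop} (hE : Enum (s.arr 9) (s.reg 7) V)
    (hF : Forest (L + 2) N s.arr s.cont S (auctionSets S ∅ L 0)) (hVS : V ⊆ S) (h1 : s.arr 1 = 0)
    (hz : ∀ v ∈ V, s.arr 11 v = z v) (h15 : s.reg 15 = 2 * R + t) (hd : N < 2 ^ d)
    (hQ : ∀ s', Keeps [2, 12, 21, 22, 29, 30] [0, 1] ((5 * d + 30) * V.card + 10) s s' →
      Forest (L + 2) N s'.arr s'.cont S (auctionSets S (high V z R t) L 0) →
      CoverList (s'.reg 2) s'.arr (high V z R t) → Q s') : wp e (highPass L) Q s := by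
  simp only [highPass, wp_seq, wp_const]
  refine wp_forEach (fun i s' => Keeps [2, 12, 21, 22, 29, 30] [0, 1] ((5 * d + 30) * i + 5) s s' ∧
    Forest (L + 2) N s'.arr s'.cont S (auctionSets S (high (initial (s.arr 9) i) z R t) L 0) ∧
    CoverList (s'.reg 2) s'.arr (high (initial (s.arr 9) i) z R t)) (by norm_num)
    (by norm_num) (len := s.reg 7) (by simp) ?_ ?_ ?_
  · refine ⟨⟨fun r _ hr => ?_, fun a _ => rfl, by simp, rfl⟩, ?_, ?_⟩
    · simp at hr
      simp [hr]
    · exact hF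
    · exact CoverList.empty h1
  · rintro i hi s' h12 h7 ⟨hk, hF', hC'⟩
    have e9 := hk.arr 9 (by simp)
    have e11 := hk.arr 11 (by simp)
    have e15 := hk.reg 15 (by norm_num) (by simp)
    have hc := hk.clock
    have hni := hE.notMem_initial hi
    have hiV := hE.mem hi
    have hhigh : high (initial (s.arr 9) (i + 1)) z R t =
        if 2 * R + t < z (s.arr 9 i) then insert (s.arr 9 i) (high (initial (s.arr 9) i) z R t)
        else high (initial (s.arr 9) i) z R t := by
      rw [high, high, initial_succ, Finset.filter_insert]
    have hn : s.arr 9 i ∉ high (initial (s.arr 9) i) z R t := fun h => hni (Finset.mem_filter.1 h).1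
    by_cases hlt : 2 * R + t < z (s.arr 9 i)
    · rw [if_pos hlt] at hhigh
      simp [h12, e9, e11, e15, h15, hz _ hiV, hlt]
      refine wp_coverVertex (N := N) (S := S) (d := d) (C := high (initial (s.arr 9) i) z R t)
        (by exact hF') (by simpa using hC') hd (by norm_num) (by norm_num) (by norm_num)
        (by simpa using hVS hiV) (by simpa using hn) ?_
      intro s₂ hk₂ hF₂ hC₂
      simp at hF₂ hC₂
      have greg : ∀ r < 50, r ∉ [2, 21, 22, 30] → s₂.reg r = s'.reg r := by
        intro r hr hrs
        simp at hrs
        rw [hk₂.reg r hr (by simp [hrs])]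
        simp [hrs]
      rw [hhigh]
      refine ⟨by rw [greg 12 (by norm_num) (by simp), h12], by rw [greg 7 (by norm_num) (by simp), h7],
        ⟨fun r hr hrs => ?_, fun a ha => ?_, ?_, ?_⟩, hF₂, by simpa using hC₂⟩
      · have h1 := hk.reg r hr hrs
        simp at hrs
        simp [hrs, greg r hr (by simp [hrs]), h1]
      · rw [← hk.arr a ha]; exact hk₂.arr a ha
      · have c2 := hk₂.clock
        simp at c2 ⊢
        rw [mul_add]
        omega
      · simp [hk₂.ext, hk.ext]
    · rw [if_neg hlt] at hhigh
      simp [h12, e9, e11, e15, h15, hz _ hiV, hlt, h7, hhigh]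
      refine ⟨⟨fun r hr hrs => ?_, fun a ha => hk.arr a ha, ?_, hk.ext⟩, hF', hC'⟩
      · have h1 := hk.reg r hr hrs
        simp at hrs
        simp [hrs, h1]
      · simp
        rw [mul_add]
        omega
  · rintro s' ⟨hk, hF', hC'⟩
    rw [hE.initial_eq] at hF' hC'
    refine hQ _ ⟨hk.reg, hk.arr, ?_, hk.ext⟩ hF' hC'
    have := hk.clock
    rw [hE.2, St.tick_clock]
    omega

theorem wp_midPass {s : St} {Q : St → Prop} (hE : Enum (s.arr 12) (s.reg 19) W)
    (hF : Forest (L + 2) N s.arr s.cont S (auctionSets S C L 0)) (hWS : W ⊆ S)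
    (hC : CoverList (s.reg 2) s.arr C) (hdisj : ∀ v ∈ W, v ∉ C) (hX : X ⊆ W)
    (hb : ∀ i < s.reg 19, s.arr 13 i = if s.arr 12 i ∈ X then 1 else 0) (hd : N < 2 ^ d)
    (hQ : ∀ s', Keeps [2, 12, 20, 21, 22, 29, 30] [0, 1] ((5 * d + 30) * W.card + 10) s s' →
      Forest (L + 2) N s'.arr s'.cont S (auctionSets S (C ∪ X) L 0) →
      CoverList (s'.reg 2) s'.arr (C ∪ X) → Q s') : wp e (midPass L) Q s := by
  simp only [midPass, wp_seq, wp_const]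
  refine wp_forEach (fun i s' => Keeps [2, 12, 20, 21, 22, 29, 30] [0, 1] ((5 * d + 30) * i + 5) s s' ∧
    s'.reg 20 = 0 ∧
    Forest (L + 2) N s'.arr s'.cont S (auctionSets S (C ∪ (X ∩ initial (s.arr 12) i)) L 0) ∧
    CoverList (s'.reg 2) s'.arr (C ∪ (X ∩ initial (s.arr 12) i))) (by norm_num)
    (by norm_num) (len := s.reg 19) (by simp) ?_ ?_ ?_
  · refine ⟨⟨fun r _ hr => ?_, fun a _ => rfl, by simp, rfl⟩, by simp, ?_, ?_⟩
    · simp at hr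
      simp [hr]
    · simpa [initial_zero] using hF
    · simpa [initial_zero] using hC
  · rintro i hi s' h12 h7 ⟨hk, h20, hF', hC'⟩
    have e12 := hk.arr 12 (by simp)
    have e13 := hk.arr 13 (by simp)
    have hc := hk.clock
    have hni := hE.notMem_initial hi
    have hiV := hE.mem hi
    have hset : C ∪ (X ∩ initial (s.arr 12) (i + 1)) =
        if s.arr 12 i ∈ X then insert (s.arr 12 i) (C ∪ (X ∩ initial (s.arr 12) i))
        else C ∪ (X ∩ initial (s.arr 12) i) := by
      rw [initial_succ]
      split_ifs with h
      · rw [Finset.inter_insert_of_mem h, Finset.union_insert]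
      · rw [Finset.inter_insert_of_notMem h]
    have hn : s.arr 12 i ∉ C ∪ (X ∩ initial (s.arr 12) i) := by
      rw [Finset.mem_union, Finset.mem_inter]
      rintro (h | h)
      · exact hdisj _ hiV h
      · exact hni h.2
    by_cases hlt : s.arr 12 i ∈ X
    · rw [if_pos hlt] at hset
      simp [h12, e12, e13, h20, hb i hi, hlt]
      refine wp_coverVertex (N := N) (S := S) (d := d) (C := C ∪ (X ∩ initial (s.arr 12) i))
        (by exact hF') (by simpa using hC') hd (by norm_num) (by norm_num) (by norm_num)
        (by simpa using hWS hiV) (by simpa using hn) ?_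
      intro s₂ hk₂ hF₂ hC₂
      have greg : ∀ r < 50, r ∉ [2, 21, 22, 30] → s₂.reg r = s'.reg r := by
        intro r hr hrs
        simp at hrs
        rw [hk₂.reg r hr (by simp [hrs])]
        simp [hrs]
      rw [hset]
      refine ⟨by rw [greg 12 (by norm_num) (by simp), h12], by rw [greg 19 (by norm_num) (by simp), h7],
        ⟨fun r hr hrs => ?_, fun a ha => ?_, ?_, ?_⟩, ?_, by simpa using hF₂, by simpa using hC₂⟩
      · have h1 := hk.reg r hr hrs
        simp at hrs
        simp [hrs, greg r hr (by simp [hrs]), h1]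
      · rw [← hk.arr a ha]; exact hk₂.arr a ha
      · have c2 := hk₂.clock
        simp at c2 ⊢
        rw [mul_add]
        omega
      · simp [hk₂.ext, hk.ext]
      · simp [greg 20 (by norm_num) (by simp), h20]
    · rw [if_neg hlt] at hset
      simp [h12, e12, e13, h20, hb i hi, hlt, h7, hset]
      refine ⟨⟨fun r hr hrs => ?_, fun a ha => hk.arr a ha, ?_, hk.ext⟩, by simpa using hF', by simpa using hC'⟩
      · have h1 := hk.reg r hr hrs
        simp at hrs
        simp [hrs, h1]
      · simp
        rw [mul_add]
        omega
  · rintro s' ⟨hk, h20, hF', hC'⟩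
    rw [hE.initial_eq, Finset.inter_eq_left.2 hX] at hF' hC'
    refine hQ _ ⟨hk.reg, hk.arr, ?_, hk.ext⟩ hF' hC'
    have := hk.clock
    rw [hE.2, St.tick_clock]
    omega

end newCover

open Rounding

/-! ### Rebuilding -/

/-- Between updates, level zero holds all present vertices, and the reservoir those outside the cover. -/
structure Rest (e : Env) (R N : ℕ) (S C : Finset ℕ) (s : St) : Prop where
  forest : Forest (2 * R + 2) N s.arr s.cont S (auctionSets S C (2 * R) 0)
  cover : CoverList (s.reg 2) s.arr C
  isCov : IsCov e.adj S C
  zero : ∀ a ∈ [6, 7, 8, 14], s.arr a = 0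

/-- Replace the cover by one that is close to a minimum cover. -/
def rebuild (R q : ℕ) : Prog :=
  runAuction (2 * R) ;; dualPass (2 * R) ;; findThreshold R ;; listMid q ;; solveMid ;; clearPass ;;
    levelPass (2 * R) ;; highPass (2 * R) ;; midPass (2 * R) ;; .const 5 0 ;; .move 6 2

section rebuilding
variable {e : Env} {R N d q : ℕ} {S C : Finset ℕ}

/-- The summands are the costs of the passes in their order. The auction has `O(n * R)` rounds of
`O(d * R)` instructions. The later passes deal with `v = O(n * R)` touched vertices, and only the
search for the threshold visits them up to `R + 1` times. -/
theorem rebuild_cost {n v w : ℕ} (hv : v ≤ n * (4 * (2 * R) + 1)) (hw : w ≤ v) :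
    (11 * d + 20) * (2 * R + 10) * (n * (6 * (2 * R) + 2)) + 10 * n + 20 + (20 * v + 20) +
      (20 * v + 25) * (R + 1) + (20 * v + 20) + (w + 2) + (10 * v + 10) + ((15 * d + 30) * v + 10) +
      ((5 * d + 30) * v + 10) + ((5 * d + 30) * w + 10) + 2 ≤
      5000 * ((d + 1) * (R + 1) ^ 2 * (n + 1)) := by
  set K := (d + 1) * (R + 1) ^ 2 with hK
  have hRK : R + 1 ≤ K := by
    rw [hK]
    calc R + 1 = 1 * (1 * (R + 1)) := by ring
      _ ≤ (d + 1) * ((R + 1) * (R + 1)) :=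
        Nat.mul_le_mul (by omega) (Nat.mul_le_mul (by omega) le_rfl)
      _ = _ := by ring
  have h1 : (11 * d + 20) * (2 * R + 10) * (n * (6 * (2 * R) + 2)) ≤ 2400 * (K * n) := by
    calc _ ≤ (20 * (d + 1)) * (10 * (R + 1)) * (n * (12 * (R + 1))) :=
          Nat.mul_le_mul (Nat.mul_le_mul (by omega) (by omega)) (Nat.mul_le_mul le_rfl (by omega))
      _ = _ := by rw [hK]; ring
  have hv1 : v * (R + 1) ≤ 8 * (K * n) := by
    calc v * (R + 1) ≤ 1 * (n * (8 * (R + 1))) * (R + 1) := by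
          rw [one_mul]
          exact Nat.mul_le_mul (hv.trans (Nat.mul_le_mul le_rfl (by omega))) le_rfl
      _ ≤ (d + 1) * (n * (8 * (R + 1))) * (R + 1) :=
        Nat.mul_le_mul (Nat.mul_le_mul (by omega) le_rfl) le_rfl
      _ = _ := by rw [hK]; ring
  have hv2 : v ≤ v * (R + 1) := Nat.le_mul_of_pos_right _ (by omega)
  have hv3 : d * v ≤ 8 * (K * n) := by
    calc d * v ≤ (d + 1) * (n * (8 * (R + 1))) * 1 := by
          rw [mul_one]
          exact Nat.mul_le_mul (by omega) (hv.trans (Nat.mul_le_mul le_rfl (by omega)))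
      _ ≤ (d + 1) * (n * (8 * (R + 1))) * (R + 1) := Nat.mul_le_mul le_rfl (by omega)
      _ = _ := by rw [hK]; ring
  have hdw : d * w ≤ d * v := Nat.mul_le_mul le_rfl hw
  have hn : n ≤ K * n := Nat.le_mul_of_pos_left _ (by omega)
  have e1 : (20 * v + 25) * (R + 1) = 20 * (v * (R + 1)) + 25 * (R + 1) := by ring
  have e2 : (15 * d + 30) * v = 15 * (d * v) + 30 * v := by ring
  have e3 : (5 * d + 30) * v = 5 * (d * v) + 30 * v := by ring
  have e4 : (5 * d + 30) * w = 5 * (d * w) + 30 * w := by ring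
  have e5 : K * (n + 1) = K * n + K := by ring
  rw [e1, e2, e3, e4, e5]
  omega

/-- The bound on the size of the new cover. -/
theorem card_rebuilt_le {adj : ℕ → ℕ → Prop} {V X : Finset ℕ} {t : ℕ} {p ow mt z : ℕ → ℕ} {c : ℝ}
    (h : Rounding adj S V R t p ow mt z)
    (hcr : (crossing V mt z (2 * R) t).card * R ≤ 2 * (matched V mt).card) (hq : 0 < q) (hc : 1 ≤ c)
    (hX : (X.card : ℝ) ≤ c * vc adj (mid V z R t) ∨
      (q * (mid V z R t).card ≤ (matched V mt).card ∧ X = mid V z R t)) :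
    ((high V z R t ∪ X).card : ℝ) ≤ (c + 2 / R + 2 / q) * vc adj S := by
  obtain ⟨D, hD, hDc⟩ := exists_vc (adj := adj) S
  have hR : 0 < R := lt_of_le_of_lt (Nat.zero_le _) h.lt
  have hM := h.auc.card_matched_le hD
  have hF := h.card_high_le hcr hD
  have hWS : mid V z R t ⊆ S := fun v hv => h.auc.sub (Finset.mem_filter.1 hv).1
  set W := mid V z R t with hW
  set M := (matched V mt).card with hMdef
  have hDW := (hD.inter hWS).vc_le
  have hsplit := Finset.card_sdiff_add_card_inter D W
  have hR' : (0 : ℝ) < R := by exact_mod_cast hR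
  have hq' : (0 : ℝ) < q := by exact_mod_cast hq
  rw [← hDc]
  have hMr : (M : ℝ) ≤ 2 * D.card := by exact_mod_cast hM
  have h1 : ((high V z R t).card : ℝ) ≤ (D \ W).card + 2 / R * D.card := by
    have h2 : ((high V z R t).card : ℝ) * R ≤ (D \ W).card * R + M := by exact_mod_cast hF
    have h3 : ((D \ W).card + 2 / R * D.card) * (R : ℝ) = (D \ W).card * R + 2 * D.card := by
      field_simp
    exact le_of_mul_le_mul_right (by linarith) hR'
  have h2 : (X.card : ℝ) ≤ c * (D ∩ W).card + 2 / q * D.card := by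
    rcases hX with hX | ⟨hX, rfl⟩
    · have h3 : (vc adj W : ℝ) ≤ (D ∩ W).card := by exact_mod_cast hDW
      have h4 : c * (vc adj W : ℝ) ≤ c * (D ∩ W).card := by gcongr
      have h5 : (0 : ℝ) ≤ 2 / q * D.card := by positivity
      linarith
    · have h3 : (q : ℝ) * W.card ≤ M := by exact_mod_cast hX
      have h4 : (2 / q * D.card) * (q : ℝ) = 2 * D.card := by field_simp
      have h5 : (0 : ℝ) ≤ c * (D ∩ W).card := by positivity
      have h6 : (W.card : ℝ) ≤ 2 / q * D.card := le_of_mul_le_mul_right (by linarith) hq'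
      linarith
  have h3 : ((high V z R t ∪ X).card : ℝ) ≤ (high V z R t).card + X.card := by
    exact_mod_cast Finset.card_union_le _ _
  have h4 : ((D \ W).card : ℝ) + (D ∩ W).card = D.card := by exact_mod_cast hsplit
  -- As `1 ≤ c`, the part of `D` outside the middle may be charged at the rate `c` as well, and the
  -- two parts of `D` recombine.
  have h5 : ((D \ W).card : ℝ) ≤ c * (D \ W).card := by
    nlinarith [Nat.cast_nonneg (α := ℝ) (D \ W).card]
  have h6 : c * (D.card : ℝ) = c * (D \ W).card + c * (D ∩ W).card := by rw [← h4]; ring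
  have h7 : (c + 2 / R + 2 / q) * (D.card : ℝ) = c * D.card + 2 / R * D.card + 2 / q * D.card := by ring
  linarith

/-- The old cover `C` drives the auction, and afterwards only touched vertices are visited; so the
cost depends on `C`, while the quality is measured against the optimum. The two bounds with factor
six combine `Rounding.card_high_add_mid` with `Auction.card_matched_le`, for `C` and for an optimal
cover. -/
theorem wp_rebuild {s : St} {Q : St → Prop} (h : Rest e R N S C s) (hR : 0 < R) (hq : 0 < q)
    (hc : 1 ≤ e.c) (hsymm : ∀ u v, e.adj u v → e.adj v u) (hd : N < 2 ^ d) (hlive : ↑S ⊆ e.live)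
    (hprom : ∀ W M : ℕ, ∀ o : ℕ, M < q * W → W * R ≤ 2 * o * R + 2 * M → (W : ℝ) ≤ e.ρ * o)
    (hQ : ∀ s' C', Rest e R N S C' s' → s'.reg 5 = 0 → s'.reg 6 = C'.card →
      s'.reg 3 = s.reg 3 → s'.reg 4 = s.reg 4 → s'.arr 2 = s.arr 2 → s'.arr 5 = s.arr 5 →
      s'.clock ≤ s.clock + 5000 * ((d + 1) * (R + 1) ^ 2 * (C.card + 1)) →
      (C'.card : ℝ) ≤ (e.c + 2 / R + 2 / q) * vc e.adj S → C'.card ≤ 6 * C.card →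
      C'.card ≤ 6 * vc e.adj S →
      (s'.ext = s.ext ∨ ∃ l, 1 ≤ l ∧ l ≤ S.card ∧ l ≤ 6 * C.card ∧ (s'.ext : ℝ) ≤ s.ext + e.T l) →
      Q s') : wp e (rebuild R q) Q s := by
  simp only [rebuild, wp_seq]
  refine wp_runAuction h.forest h.cover h.isCov (h.zero 6 (by simp)) (h.zero 7 (by simp))
    (h.zero 8 (by simp)) (h.zero 14 (by simp)) hsymm hd hlive ?_
  intro s₁ V hR₁ hf₁ hdone hV
  have hauc := hR₁.bidding.auc
  set p := s₁.arr 6 with hp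
  set ow := s₁.arr 7 with how
  set mt := s₁.arr 8 with hmt
  set z := dualVal (2 * R) p mt with hz
  have hround : ∀ t < R, Rounding e.adj S V R t p ow mt z := fun t ht =>
    ⟨hauc, hsymm, hdone, fun _ => rfl, ht⟩
  have hpartner : ∀ v ∈ V, mt v ≠ 0 → mt v - 1 ∈ V := fun v hv hm =>
    ((hround 0 hR).partner (Finset.mem_filter.2 ⟨hv, hm⟩)).2.1
  refine wp_dualPass (L := 2 * R) hR₁.enum ?_
  intro s₂ hk₂ _ h10 _ hz₂
  have a9 : s₂.arr 9 = s₁.arr 9 := hk₂.arr 9 (by simp)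
  have r7 : s₂.reg 7 = s₁.reg 7 := hk₂.reg 7 (by norm_num) (by simp)
  have a8 : s₂.arr 8 = mt := hk₂.arr 8 (by simp)
  refine wp_findThreshold (V := V) (z := z) (by rw [a9, r7]; exact hR₁.enum) hz₂
    (by rw [a8]; exact hpartner) (by rw [a8, h10]; exact (hround 0 hR).exists_threshold) ?_
  intro s₃ t hk₃ _ ht hcr h14 h15
  rw [a8, h10] at hcr
  have hrd := hround t ht
  have k9 : s₃.arr 9 = s₁.arr 9 := by rw [hk₃.arr 9 (by simp), a9]
  have k7 : s₃.reg 7 = s₁.reg 7 := by rw [hk₃.reg 7 (by norm_num) (by simp), r7]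
  refine wp_listMid (V := V) (z := z) (R := R) (t := t) (by rw [k9, k7]; exact hR₁.enum)
    (by rw [hk₃.arr 11 (by simp)]; exact hz₂) h14 h15 ?_
  intro s₄ hk₄ _ hEW hb₄ h16
  have hWV : mid V z R t ⊆ V := Finset.filter_subset _ _
  have hWS := hWV.trans hauc.sub
  have h10' : s₄.reg 10 = (matched V mt).card := by
    rw [hk₄.reg 10 (by norm_num) (by simp), hk₃.reg 10 (by norm_num) (by simp), h10]
  refine wp_solveMid hEW hb₄ ((Finset.coe_subset.2 hWS).trans hlive) ?_ ?_
  · intro hlt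
    rw [h10', h16] at hlt
    obtain ⟨D, hD, hDc⟩ := exists_vc (adj := e.adj) (mid V z R t)
    refine hprom _ _ _ hlt ?_
    rw [← hDc]
    exact hrd.card_mid_le hcr hD
  intro s₅ X hk₅ hc₅ hX hb₅ hsol
  rw [h10', h16] at hsol
  have karr : ∀ a, a ∉ [11, 12, 13] → s₅.arr a = s₁.arr a := by
    intro a ha
    simp at ha
    have h5 : s₅.arr a = s₄.arr a := hk₅.arr a (by simp [ha])
    rw [h5, hk₄.arr a (by simp [ha]), hk₃.arr a (by simp), hk₂.arr a (by simp [ha])]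
  have kreg5 : ∀ r < 50, s₅.reg r = s₄.reg r := fun r hr => hk₅.reg r hr (by simp)
  have kreg : ∀ r < 8, s₅.reg r = s₁.reg r := by
    intro r hr
    rw [kreg5 r (by omega), hk₄.reg r (by omega) (by simp; omega),
      hk₃.reg r (by omega) (by simp; omega), hk₂.reg r (by omega) (by simp; omega)]
  have hE₅ : Enum (s₅.arr 9) (s₅.reg 7) V := by
    rw [karr 9 (by simp), kreg 7 (by norm_num)]; exact hR₁.enum
  refine wp_clearPass (V := V) hE₅ ?_ ?_
  · intro a ha v hv
    simp only [List.mem_cons, List.not_mem_nil, or_false] at ha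
    rcases ha with rfl | rfl | rfl | rfl
    · rw [karr 1 (by simp), hf₁.arr 1 (by norm_num) (by norm_num)]
      exact h.cover.out v fun hvC => hv (hR₁.bidding.cover hvC)
    · rw [karr 7 (by simp)]; exact hauc.ow_out hv
    · rw [karr 8 (by simp)]; exact (hauc.out v hv).2
    · rw [karr 14 (by simp), hR₁.mark, if_neg hv]
  intro s₆ hk₆ hc₆ hzero₆
  have e6 : s₆.arr 6 = p := by rw [hk₆.arr 6 (by simp), karr 6 (by simp)]
  have hcont : s₆.cont = s₁.cont := by rw [hc₆, hc₅]; simp only [*]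
  refine wp_levelPass (V := V) (N := N) (S := S) (d := d) (L := 2 * R) ?_ ?_ hauc.sub ?_ ?_ hd hlive ?_
  · rw [hk₆.arr 9 (by simp), hk₆.reg 7 (by norm_num) (by simp)]; exact hE₅
  · rw [e6, hcont]
    refine hR₁.forest.congr ?_ ?_ ?_
    · rw [hk₆.arr 2 (by simp), karr 2 (by simp)]
    · rw [hk₆.arr 3 (by simp), karr 3 (by simp)]
    · rw [hk₆.arr 4 (by simp), karr 4 (by simp)]
  · rw [e6]; exact hauc.le
  · rw [e6]; exact fun v hv => (hauc.out v hv).1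
  intro s₇ hk₇ hF₇ h6₇
  have karr7 : ∀ a, a ∉ [1, 6, 7, 8, 14] → s₇.arr a = s₅.arr a := by
    intro a ha
    simp at ha
    rw [hk₇.arr a (by simp [ha]), hk₆.arr a (by simp [ha])]
  have kreg7 : ∀ r < 50, r ∉ [12, 20, 21, 22, 29, 30] → s₇.reg r = s₅.reg r := by
    intro r hr hrs
    simp at hrs
    rw [hk₇.reg r hr (by simp [hrs]), hk₆.reg r hr (by simp [hrs])]
  have hz₅ : ∀ v ∈ V, s₅.arr 11 v = z v := by
    have h5 : s₅.arr 11 = s₄.arr 11 := hk₅.arr 11 (by simp)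
    rw [h5, hk₄.arr 11 (by simp), hk₃.arr 11 (by simp)]
    exact hz₂
  refine wp_highPass (V := V) (z := z) (R := R) (t := t) (N := N) (S := S) (d := d) (L := 2 * R)
    ?_ hF₇ hauc.sub ?_ ?_ ?_ hd ?_
  · rw [karr7 9 (by simp), kreg7 7 (by norm_num) (by simp)]; exact hE₅
  · rw [hk₇.arr 1 (by simp)]; exact hzero₆ 1 (by simp)
  · rw [karr7 11 (by simp)]; exact hz₅
  · rw [kreg7 15 (by norm_num) (by simp), kreg5 15 (by norm_num), hk₄.reg 15 (by norm_num) (by simp)]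
    exact h15
  intro s₈ hk₈ hF₈ hC₈
  have hdisj : ∀ v ∈ mid V z R t, v ∉ high V z R t := by
    intro v hv hv'
    simp only [mid, high, Finset.mem_filter] at hv hv'
    omega
  have e12 : s₈.arr 12 = s₄.arr 12 := by
    rw [hk₈.arr 12 (by simp), karr7 12 (by simp)]; exact hk₅.arr 12 (by simp)
  have e13 : s₈.arr 13 = s₅.arr 13 := by rw [hk₈.arr 13 (by simp), karr7 13 (by simp)]
  have e19 : s₈.reg 19 = s₄.reg 19 := by
    rw [hk₈.reg 19 (by norm_num) (by simp), kreg7 19 (by norm_num) (by simp), kreg5 19 (by norm_num)]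
  refine wp_midPass (W := mid V z R t) (X := X) (C := high V z R t) (N := N) (S := S) (d := d)
    (L := 2 * R) (by rw [e12, e19]; exact hEW) hF₈ hWS hC₈ hdisj hX.1
    (by rw [e12, e13, e19]; exact hb₅) hd ?_
  intro s₉ hk₉ hF₉ hC₉
  simp only [wp_seq, wp_const, wp_move]
  have karr9 : ∀ a, 2 ≤ a → a ∉ [6, 7, 8, 14, 11, 12, 13, 9, 10] → s₉.arr a = s.arr a := by
    intro a ha2 ha
    simp at ha
    have : a ≠ 0 ∧ a ≠ 1 := by omega
    rw [hk₉.arr a (by simp [this]), hk₈.arr a (by simp [this]), karr7 a (by simp [ha, this]),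
      karr a (by simp [ha])]
    exact hf₁.arr a (by omega) ha.2.2.2.1
  have kreg9 : ∀ r < 7, r ≠ 2 → s₉.reg r = s.reg r := by
    intro r hr hr2
    rw [hk₉.reg r (by omega) (by simp; omega), hk₈.reg r (by omega) (by simp; omega),
      kreg7 r (by omega) (by simp; omega), kreg r (by omega), hf₁.reg r hr]
  have hzero9 : ∀ a ∈ [6, 7, 8, 14], s₉.arr a = 0 := by
    intro a ha
    simp only [List.mem_cons, List.not_mem_nil, or_false] at ha
    have : a ≠ 0 ∧ a ≠ 1 := by omega
    rw [hk₉.arr a (by simp [this]), hk₈.arr a (by simp [this])]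
    rcases ha with rfl | rfl | rfl | rfl
    · exact h6₇
    · rw [hk₇.arr 7 (by simp)]; exact hzero₆ 7 (by simp)
    · rw [hk₇.arr 8 (by simp)]; exact hzero₆ 8 (by simp)
    · rw [hk₇.arr 14 (by simp)]; exact hzero₆ 14 (by simp)
  have hFW := hrd.card_high_add_mid
  have hXW := Finset.card_le_card hX.1
  have hMC := hauc.card_matched_le h.isCov
  have hCX := Finset.card_union_le (high V z R t) X
  refine hQ _ (high V z R t ∪ X) ⟨by exact hF₉, by simpa using hC₉, hrd.isCov hX, hzero9⟩ ?_ ?_ ?_ ?_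
    ?_ ?_ ?_ ?_ ?_ ?_ ?_
  · simp
  · simp [hC₉.card]
  · simpa using kreg9 3 (by norm_num) (by norm_num)
  · simpa using kreg9 4 (by norm_num) (by norm_num)
  · exact karr9 2 le_rfl (by simp)
  · exact karr9 5 (by norm_num) (by simp)
  · have c1 := hf₁.clock
    have c2 := hk₂.clock
    have c3 := hk₃.clock
    have c4 := hk₄.clock
    have c5 : s₅.clock ≤ s₄.clock + _ := hk₅.clock
    have c6 := hk₆.clock
    have c7 := hk₇.clock
    have c8 := hk₈.clock
    have c9 := hk₉.clock
    have := rebuild_cost (R := R) (d := d) hV (Finset.card_le_card hWV)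
    simp only [St.set_clock]
    omega
  · refine card_rebuilt_le hrd hcr hq hc ?_
    rcases hsol with ⟨_, h1, _⟩ | ⟨h1, h2, _⟩
    · exact Or.inl h1
    · exact Or.inr ⟨h1, h2⟩
  · omega
  · obtain ⟨D, hD, hDc⟩ := exists_vc (adj := e.adj) S
    have := hauc.card_matched_le hD
    omega
  · have hext9 : s₉.ext = s₅.ext := by rw [hk₉.ext, hk₈.ext, hk₇.ext, hk₆.ext]
    have hext4 : s₄.ext = s.ext := by rw [hk₄.ext, hk₃.ext, hk₂.ext, hf₁.ext]
    simp only [St.set_ext, hext9]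
    rcases hsol with ⟨h1, _, h2⟩ | ⟨_, _, h2⟩
    · refine Or.inr ⟨_, ?_, Finset.card_le_card hWS, by omega, ?_⟩
      -- On an empty middle part the test `|M| < q * 0` fails. So the static algorithm only sees
      -- nonempty inputs, for which the monotonicity of `T n / n` is available.
      · by_contra h0
        have : (mid V z R t).card = 0 := by omega
        rw [this] at h1
        omega
      · rw [hext4] at h2; exact h2
    · exact Or.inl (by rw [h2, hext4])

end rebuilding

/-! ### Updates -/

/-- Insert the vertex in register 1. -/
def insertVertex (R : ℕ) : Prog :=
  allocNode (2 * R + 2) ;; .const 20 0 ;; setInsert 20 1 ;; pushCover 1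

/-- Delete the vertex in register 1. -/
def deleteVertex (R : ℕ) : Prog :=
  .const 20 0 ;; setDelete 20 1 ;; .const 20 0 ;; .load 22 1 1 ;;
  .ite 20 22 removeCover (.const 20 (2 * R + 1) ;; setDelete 20 1) ;; freeNode

/-- Count the update, and rebuild when the updates have become many. -/
def account (R q E : ℕ) : Prog := .const 21 E ;; .add 5 5 21 ;; .ite 5 6 .skip (rebuild R q)

/-- The whole data structure. -/
def program (R q E : ℕ) : Prog :=
  .const 20 0 ;; .ite 20 0 (deleteVertex R) (insertVertex R) ;; account R q E

section updates
variable {e : Env} {R N d q E : ℕ} {S C : Finset ℕ}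

/-- The new vertex joins the cover. Thus its edges are covered, and the reservoir, being the
complement of the cover, does not change. -/
theorem wp_insertVertex {s : St} {Q : St → Prop} (h : Rest e R N S C s)
    (hsl : Slots (2 * R + 2) N s.reg s.arr S) (h1 : s.reg 1 ∉ S) (hd : N < 2 ^ d)
    (hd' : S.card + 1 < 2 ^ d) (hlive : ↑(insert (s.reg 1) S) ⊆ e.live)
    (hQ : ∀ s' N', Rest e R N' (insert (s.reg 1) S) (insert (s.reg 1) C) s' →
      Slots (2 * R + 2) N' s'.reg s'.arr (insert (s.reg 1) S) → (N' = N ∨ N' = S.card + 1) →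
      s'.reg 5 = s.reg 5 → s'.reg 6 = s.reg 6 → s'.clock ≤ s.clock + (10 * d + 60) →
      s'.ext = s.ext → Q s') : wp e (insertVertex R) Q s := by
  have h1C : s.reg 1 ∉ C := fun hC => h1 (h.isCov.1 hC)
  simp only [insertVertex, wp_seq]
  refine wp_allocNode (by omega) h.forest hsl h1 ?_
  intro s₁ N' hF₁ hsl₁ hN hreg₁ harr₁ hclock₁ hext₁
  have hN' : N' < 2 ^ d := by omega
  have g1 := hreg₁ 1 (by norm_num) (by norm_num) (by norm_num)
  simp only [wp_seq, wp_const]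
  refine wp_setInsert (N := N') (w := 2 * R + 2) (d := d) (by exact hF₁) hN' hlive (by norm_num)
    (by simp) (by simp [g1]) (by simp [g1, auctionSets, h1]) ?_
  intro s₂ hf₂ hF₂
  have f1 := hf₂.reg 1 (by norm_num)
  have f2 := hf₂.reg 2 (by norm_num)
  have g2 := hreg₁ 2 (by norm_num) (by norm_num) (by norm_num)
  have farr : s₂.arr = s₁.arr := hf₂.arr
  simp [g1, g2] at hF₂ f1 f2
  refine wp_pushCover (C := C) ?_ (by norm_num) (by norm_num) (by rw [f1]; exact h1C) ?_
  · rw [f2, farr]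
    exact h.cover.congr (harr₁ 0 (by norm_num) (by norm_num) (by norm_num))
      (harr₁ 1 (by norm_num) (by norm_num) (by norm_num))
  intro s₃ hC₃ hreg₃ _ harr₃ hcont₃ hclock₃ hext₃
  rw [f1] at hC₃
  have karr : ∀ a, a ≠ 0 → a ≠ 1 → s₃.arr a = s₁.arr a := fun a h0 h1 => by
    rw [harr₃ a h0 h1, farr]
  have kreg : ∀ r < 20, r ≠ 2 → s₃.reg r = s₁.reg r := fun r hr h2 => by
    rw [hreg₃ r (by omega) h2, hf₂.reg r (by omega)]
    have : r ≠ 20 := by omega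
    simp [this]
  refine hQ s₃ N' ⟨?_, hC₃, ?_, ?_⟩ ?_ hN ?_ ?_ ?_ ?_
  · rw [hcont₃]
    refine (hF₂.congr (harr₃ 2 (by norm_num) (by norm_num)) (harr₃ 3 (by norm_num) (by norm_num))
      (harr₃ 4 (by norm_num) (by norm_num))).congr_sets fun k hk => ?_
    by_cases hk0 : k = 0
    · subst hk0
      ext v
      simp [auctionSets]
    · rw [Function.update_of_ne hk0]
      ext v
      by_cases hkL : k ≤ 2 * R
      · simp [auctionSets, hkL, Ne.symm hk0]
      · by_cases hv : v = s.reg 1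
        · subst hv; simp [auctionSets, hkL, h1]
        · simp [auctionSets, hkL, hv]
  · refine ⟨Finset.insert_subset_insert _ h.isCov.1, fun u hu v hv huv => ?_⟩
    simp only [Finset.mem_insert] at hu hv ⊢
    rcases hu with hu | hu
    · exact Or.inl (Or.inl hu)
    · rcases hv with hv | hv
      · exact Or.inr (Or.inl hv)
      · exact (h.isCov.2 u hu v hv huv).imp Or.inr Or.inr
  · intro a ha
    rw [← h.zero a ha]
    simp at ha
    rw [karr a (by omega) (by omega), harr₁ a (by omega) (by omega) (by omega)]
  · exact hsl₁.congr (kreg 3 (by norm_num) (by norm_num)) (kreg 4 (by norm_num) (by norm_num))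
      (karr 5 (by norm_num) (by norm_num)) (karr 2 (by norm_num) (by norm_num))
  · rw [kreg 5 (by norm_num) (by norm_num), hreg₁ 5 (by norm_num) (by norm_num) (by norm_num)]
  · rw [kreg 6 (by norm_num) (by norm_num), hreg₁ 6 (by norm_num) (by norm_num) (by norm_num)]
  · have := hf₂.clock
    simp at this
    omega
  · rw [hext₃, hf₂.ext]; exact hext₁

/-- Every vertex is at level zero, but only vertices outside the cover are in the reservoir, hence
the two cases. -/
theorem auctionSets_erase {L x k : ℕ} {A₁ : ℕ → Set ℕ} (hkw : k < L + 2)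
    (hA₁ : A₁ = Function.update (auctionSets S C L 0) 0 (auctionSets S C L 0 0 \ {x})) :
    auctionSets (S.erase x) (C.erase x) L 0 k =
      if x ∈ C then A₁ k else Function.update A₁ (L + 1) (A₁ (L + 1) \ {x}) k := by
  ext v
  by_cases hv : v = x
  · subst hv
    split_ifs with hC
    · by_cases hk : k = 0
      · subst hk; simp [hA₁, auctionSets]
      · rw [hA₁, Function.update_of_ne hk]
        by_cases hkL : k ≤ L <;> simp [auctionSets, hkL, Ne.symm hk, hC]
    · by_cases hk : k = L + 1
      · subst hk; simp [auctionSets]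
      · rw [Function.update_of_ne hk, hA₁]
        by_cases hk0 : k = 0
        · subst hk0; simp [auctionSets]
        · rw [Function.update_of_ne hk0]
          by_cases hkL : k ≤ L
          · simp [auctionSets, hkL, Ne.symm hk0]
          · simp [auctionSets, hkL]
            have : k = L + 1 := by omega
            exact absurd this hk
  · have h1 : ∀ (f : ℕ → Set ℕ) (i : ℕ), v ∈ Function.update f i (f i \ {x}) k ↔ v ∈ f k := by
      intro f i
      by_cases hik : k = i
      · subst hik; simp [hv]
      · rw [Function.update_of_ne hik]
    have h2 : v ∈ auctionSets (S.erase x) (C.erase x) L 0 k ↔ v ∈ auctionSets S C L 0 k := by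
      simp [auctionSets, hv]
    rw [h2]
    split_ifs
    · rw [hA₁, h1]
    · rw [h1, hA₁, h1]

/-- What remains of the cover still covers the remaining vertices. The node is freed last, because
`setDelete` climbs from it. -/
theorem wp_deleteVertex {s : St} {Q : St → Prop} (h : Rest e R N S C s)
    (hsl : Slots (2 * R + 2) N s.reg s.arr S) (h1 : s.reg 1 ∈ S) (hd : N < 2 ^ d)
    (hQ : ∀ s', Rest e R N (S.erase (s.reg 1)) (C.erase (s.reg 1)) s' →
      Slots (2 * R + 2) N s'.reg s'.arr (S.erase (s.reg 1)) →
      s'.reg 5 = s.reg 5 → s'.reg 6 = s.reg 6 → s'.clock ≤ s.clock + (10 * d + 60) →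
      s'.ext = s.ext → Q s') : wp e (deleteVertex R) Q s := by
  set x := s.reg 1 with hx
  simp only [deleteVertex, wp_seq, wp_const]
  refine wp_setDelete (N := N) (S := S) (A := auctionSets S C (2 * R) 0) (w := 2 * R + 2) (d := d)
    (by exact h.forest) hd (by norm_num) (by simp) (by simp [auctionSets, ← hx, h1]) ?_
  intro s₁ hf₁ hF₁
  have g1 := hf₁.reg 1 (by norm_num)
  have g2 := hf₁.reg 2 (by norm_num)
  have garr : s₁.arr = s.arr := hf₁.arr
  simp [← hx] at hF₁ g1 g2
  set A₁ := Function.update (auctionSets S C (2 * R) 0) 0 (auctionSets S C (2 * R) 0 0 \ {x}) with hA₁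
  have hres : ∀ k < 2 * R + 2, auctionSets (S.erase x) (C.erase x) (2 * R) 0 k =
      if x ∈ C then A₁ k else Function.update A₁ (2 * R + 1) (A₁ (2 * R + 1) \ {x}) k :=
    fun k hk => auctionSets_erase hk hA₁
  have hfree : ∀ s₂, Forest (2 * R + 2) N s₂.arr s₂.cont S
        (auctionSets (S.erase x) (C.erase x) (2 * R) 0) → CoverList (s₂.reg 2) s₂.arr (C.erase x) →
      (∀ r < 20, r ≠ 2 → s₂.reg r = s.reg r) → (∀ a, a ≠ 0 → a ≠ 1 → s₂.arr a = s.arr a) →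
      s₂.clock ≤ s.clock + (10 * d + 30) → s₂.ext = s.ext → wp e freeNode Q s₂ := by
    intro s₂ hF₂ hC₂ hreg₂ harr₂ hclock₂ hext₂
    have f1 : s₂.reg 1 = x := hreg₂ 1 (by norm_num) (by norm_num)
    refine wp_freeNode hF₂ (hsl.congr (hreg₂ 3 (by norm_num) (by norm_num))
      (hreg₂ 4 (by norm_num) (by norm_num)) (harr₂ 5 (by norm_num) (by norm_num))
      (harr₂ 2 (by norm_num) (by norm_num))) (by rw [f1]; exact h1) ?_ ?_
    · intro k _
      simp [f1, auctionSets]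
    intro s₃ hF₃ hsl₃ hreg₃ harr₃ hclock₃ hext₃
    rw [f1] at hF₃ hsl₃
    refine hQ s₃ ⟨hF₃, ?_, ?_, ?_⟩ hsl₃ ?_ ?_ (by omega) (by rw [hext₃, hext₂])
    · rw [hreg₃ 2 (by norm_num) (by norm_num)]
      exact hC₂.congr (harr₃ 0 (by norm_num)) (harr₃ 1 (by norm_num))
    · refine ⟨Finset.erase_subset_erase _ h.isCov.1, fun u hu v hv huv => ?_⟩
      rw [Finset.mem_erase] at hu hv
      exact (h.isCov.2 u hu.2 v hv.2 huv).imp (fun hc => Finset.mem_erase.2 ⟨hu.1, hc⟩)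
        fun hc => Finset.mem_erase.2 ⟨hv.1, hc⟩
    · intro a ha
      rw [← h.zero a ha]
      simp at ha
      rw [harr₃ a (by omega), harr₂ a (by omega) (by omega)]
    · rw [hreg₃ 5 (by norm_num) (by norm_num), hreg₂ 5 (by norm_num) (by norm_num)]
    · rw [hreg₃ 6 (by norm_num) (by norm_num), hreg₂ 6 (by norm_num) (by norm_num)]
  simp only [wp_seq, wp_const, wp_load, wp_ite]
  by_cases hxC : x ∈ C
  · have hpos : 0 < s.arr 1 x := (h.cover.pos x hxC).1
    simp [g1, garr, hpos]
    refine wp_removeCover (C := C) ?_ (by simpa [g1] using hxC) ?_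
    · simpa [g2, garr] using h.cover
    intro s₂ hC₂ hreg₂ _ harr₂ hcont₂ hclock₂ hext₂
    simp [g1] at hC₂
    refine hfree s₂ ?_ hC₂ (fun r hr h2 => ?_) (fun a h0 h1 => ?_) ?_ ?_
    · rw [hcont₂]
      refine (hF₁.congr (harr₂ 2 (by norm_num) (by norm_num)) (harr₂ 3 (by norm_num) (by norm_num))
        (harr₂ 4 (by norm_num) (by norm_num))).congr_sets fun k hk => ?_
      rw [hres k hk, if_pos hxC]
    · rw [hreg₂ r (by omega) h2]
      have : r ≠ 20 ∧ r ≠ 22 := by omega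
      simp [this, hf₁.reg r (by omega)]
    · rw [harr₂ a h0 h1]; simp [garr]
    · have := hf₁.clock
      simp at this hclock₂
      omega
    · rw [hext₂]; exact hf₁.ext
  · have hpos : s.arr 1 x = 0 := h.cover.out x hxC
    simp [g1, garr, hpos]
    refine wp_setDelete (N := N) (S := S) (A := A₁) (w := 2 * R + 2) (d := d)
      (by exact hF₁) hd (by norm_num) (by simp) ?_ ?_
    · simp [g1, hA₁, auctionSets, h1, hxC]
    intro s₂ hf₂ hF₂
    simp [g1] at hF₂
    have farr : s₂.arr = s.arr := by rw [hf₂.arr]; exact garr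
    have freg : ∀ r < 20, s₂.reg r = s.reg r := fun r hr => by
      rw [hf₂.reg r (by omega)]
      have : r ≠ 20 ∧ r ≠ 22 := by omega
      simp [this, hf₁.reg r (by omega)]
    refine hfree s₂ ?_ ?_ (fun r hr h2 => freg r hr) (fun a h0 h1 => by rw [farr]) ?_ ?_
    · refine hF₂.congr_sets fun k hk => ?_
      rw [hres k hk, if_neg hxC]
    · rw [freg 2 (by norm_num), farr, Finset.erase_eq_of_notMem hxC]
      exact h.cover
    · have := hf₁.clock
      have h2 := hf₂.clock
      simp at this h2
      omega
    · rw [hf₂.ext]; exact hf₁.ext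

/-- What an update leads to, when the present vertices are `S` and the cover was `C` before
the accounting: nothing more, or a rebuilt cover `C'`. -/
structure Outcome (e : Env) (R q E N d : ℕ) (S C : Finset ℕ) (s s' : St) (C' : Finset ℕ) : Prop where
  rest : Rest e R N S C' s'
  slots : Slots (2 * R + 2) N s'.reg s'.arr S
  result : (C' = C ∧ s'.reg 5 = s.reg 5 + E ∧ s.reg 5 + E < s.reg 6 ∧ s'.reg 6 = s.reg 6 ∧
      s'.clock ≤ s.clock + (10 * d + 70) ∧ s'.ext = s.ext) ∨
    (s.reg 6 ≤ s.reg 5 + E ∧ s'.reg 5 = 0 ∧ s'.reg 6 = C'.card ∧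
      s'.clock ≤ s.clock + (10 * d + 70) + 5000 * ((d + 1) * (R + 1) ^ 2 * (C.card + 1)) ∧
      (C'.card : ℝ) ≤ (e.c + 2 / R + 2 / q) * vc e.adj S ∧ C'.card ≤ 6 * vc e.adj S ∧
      (s'.ext = s.ext ∨ ∃ l, 1 ≤ l ∧ l ≤ S.card ∧ l ≤ 6 * C.card ∧ (s'.ext : ℝ) ≤ s.ext + e.T l))

/-- Register 5 grows by `E` with every update, so comparing it with the size of the last rebuilt
cover in register 6 needs neither multiplication nor division. -/
theorem wp_account {s s₀ : St} {Q : St → Prop} (h : Rest e R N S C s)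
    (hsl : Slots (2 * R + 2) N s.reg s.arr S) (h5 : s.reg 5 = s₀.reg 5) (h6 : s.reg 6 = s₀.reg 6)
    (hclock : s.clock ≤ s₀.clock + (10 * d + 62)) (hext : s.ext = s₀.ext) (hR : 0 < R) (hq : 0 < q)
    (hc : 1 ≤ e.c) (hsymm : ∀ u v, e.adj u v → e.adj v u) (hd : N < 2 ^ d) (hlive : ↑S ⊆ e.live)
    (hprom : ∀ W M : ℕ, ∀ o : ℕ, M < q * W → W * R ≤ 2 * o * R + 2 * M → (W : ℝ) ≤ e.ρ * o)
    (hQ : ∀ s' C', Outcome e R q E N d S C s₀ s' C' → Q s') : wp e (account R q E) Q s := by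
  simp [account]
  split_ifs with hlt
  · rw [h5, h6] at hlt
    refine hQ _ C ⟨⟨h.forest, by simpa using h.cover, h.isCov, h.zero⟩,
      hsl.congr (by simp) (by simp) rfl rfl, Or.inl ⟨rfl, ?_, hlt, ?_, ?_, hext⟩⟩
    · simp [h5]
    · simp [h6]
    · simp; omega
  · rw [h5, h6] at hlt
    refine wp_rebuild (C := C) ⟨by exact h.forest, by simpa using h.cover, h.isCov, h.zero⟩ hR hq hc
      hsymm hd hlive hprom ?_
    intro s' C' hrest k5 k6 k3 k4 a2 a5 hcl hcard _ hcard6 hex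
    simp at k3 k4 a2 a5 hcl hex
    refine hQ s' C' ⟨hrest, hsl.congr k3 k4 a5 a2, Or.inr ⟨by omega, k5, k6, by omega, hcard, hcard6, ?_⟩⟩
    rw [← hext]; exact hex

theorem wp_program_insert {s : St} {Q : St → Prop} (h : Rest e R N S C s)
    (hsl : Slots (2 * R + 2) N s.reg s.arr S) (h0 : s.reg 0 = 0) (h1 : s.reg 1 ∉ S) (hd : N < 2 ^ d)
    (hd' : S.card + 1 < 2 ^ d) (hlive : ↑(insert (s.reg 1) S) ⊆ e.live) (hR : 0 < R) (hq : 0 < q)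
    (hc : 1 ≤ e.c) (hsymm : ∀ u v, e.adj u v → e.adj v u)
    (hprom : ∀ W M : ℕ, ∀ o : ℕ, M < q * W → W * R ≤ 2 * o * R + 2 * M → (W : ℝ) ≤ e.ρ * o)
    (hQ : ∀ s' N' C', (N' = N ∨ N' = S.card + 1) →
      Outcome e R q E N' d (insert (s.reg 1) S) (insert (s.reg 1) C) s s' C' → Q s') :
    wp e (program R q E) Q s := by
  simp [program, h0]
  refine wp_insertVertex (d := d) (N := N) (S := S) (C := C)
    ⟨by exact h.forest, by simpa using h.cover, h.isCov, h.zero⟩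
    (hsl.congr (by simp) (by simp) rfl rfl) (by simpa using h1) hd hd' (by simpa using hlive) ?_
  intro s₁ N' hrest hsl₁ hN k5 k6 hcl hext
  simp at hrest hsl₁ k5 k6 hcl hext
  exact wp_account hrest hsl₁ k5 k6 (by omega) hext hR hq hc hsymm (by omega) hlive hprom
    fun s' C' ho => hQ s' N' C' hN ho

theorem wp_program_delete {s : St} {Q : St → Prop} (h : Rest e R N S C s)
    (hsl : Slots (2 * R + 2) N s.reg s.arr S) (h0 : s.reg 0 = 1) (h1 : s.reg 1 ∈ S) (hd : N < 2 ^ d)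
    (hlive : ↑S ⊆ e.live) (hR : 0 < R) (hq : 0 < q)
    (hc : 1 ≤ e.c) (hsymm : ∀ u v, e.adj u v → e.adj v u)
    (hprom : ∀ W M : ℕ, ∀ o : ℕ, M < q * W → W * R ≤ 2 * o * R + 2 * M → (W : ℝ) ≤ e.ρ * o)
    (hQ : ∀ s' C', Outcome e R q E N d (S.erase (s.reg 1)) (C.erase (s.reg 1)) s s' C' → Q s') :
    wp e (program R q E) Q s := by
  simp [program, h0]
  refine wp_deleteVertex (d := d) (N := N) (S := S) (C := C)
    ⟨by exact h.forest, by simpa using h.cover, h.isCov, h.zero⟩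
    (hsl.congr (by simp) (by simp) rfl rfl) (by simpa using h1) hd ?_
  intro s₁ hrest hsl₁ k5 k6 hcl hext
  simp at hrest hsl₁ k5 k6 hcl hext
  have hlive' : ↑(S.erase (s.reg 1)) ⊆ e.live := fun v hv => hlive (Finset.mem_of_mem_erase hv)
  exact wp_account hrest hsl₁ k5 k6 (by omega) hext hR hq hc hsymm hd hlive' hprom hQ

end updates

/-! ### Sequences of updates -/

theorem IsCov.congr {adj adj' : ℕ → ℕ → Prop} {S D : Finset ℕ}
    (h : ∀ u ∈ S, ∀ v ∈ S, adj' u v → adj u v) (hD : IsCov adj S D) : IsCov adj' S D :=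
  ⟨hD.1, fun u hu v hv huv => hD.2 u hu v hv (h u hu v hv huv)⟩

theorem vc_congr {adj adj' : ℕ → ℕ → Prop} {S : Finset ℕ}
    (h : ∀ u ∈ S, ∀ v ∈ S, adj u v ↔ adj' u v) : vc adj S = vc adj' S := by
  obtain ⟨D, hD, hc⟩ := exists_vc (adj := adj) S
  obtain ⟨D', hD', hc'⟩ := exists_vc (adj := adj') S
  refine le_antisymm ?_ ?_
  · rw [← hc']
    exact (hD'.congr fun u hu v hv => (h u hu v hv).1).vc_le
  · rw [← hc]
    exact (hD.congr fun u hu v hv => (h u hu v hv).2).vc_le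

/-- Instances below `w` belong to node zero and hold nothing, by `Forest.low`; the others hold
subsets of the sets. So no instance remembers a handle that is out of use, and such a handle may be
given to another object. -/
theorem Forest.cont_subset {w N : ℕ} {arr : ℕ → ℕ → ℕ} {cont : ℕ → Set ℕ} {S : Finset ℕ}
    {A : ℕ → Set ℕ} (h : Forest w N arr cont S A) (hw : 0 < w) (i : ℕ) : cont i ⊆ S := by
  have hlt := Nat.mod_lt i hw
  have hi : i / w * w + i % w = i := by rw [mul_comm]; exact Nat.div_add_mod i w
  rcases Nat.eq_zero_or_pos (i / w) with h0 | h0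
  · rw [← hi, h0, zero_mul, zero_add, h.low _ hlt]
    exact Set.empty_subset _
  · rw [← hi, h.cont _ _ h0 hlt]
    exact fun v hv => h.sub _ hlt hv.1

theorem DetOp.SizeLe.mono {α : Type*} {a b : ℕ} (hab : a ≤ b) :
    ∀ {l : List (DetOp α)}, DetOp.SizeLe a l → DetOp.SizeLe b l
  | [], _ => trivial
  | _ :: _, h => ⟨h.1.trans hab, DetOp.SizeLe.mono hab h.2⟩

/-- The description depends on the table only through the stored handles. This carries the state
over the change of the table from one update to the next. -/
theorem Describes.transfer {α : Type*} {D : Detector α} {tbl tbl' : ℕ → Option α} {cap cap' : ℕ}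
    {s : St} {m : Mach α} {t : ℕ} (h : Describes D tbl cap s m t)
    (htbl : ∀ i, ∀ v ∈ s.cont i, tbl' v = tbl v) (hcap : cap ≤ cap') :
    Describes D tbl' cap' s m t where
  reg := h.reg
  arr := h.arr
  live i v hv := by
    have := h.live i hv
    simp only [Set.mem_ofPred_eq] at this ⊢
    rwa [htbl i v hv]
  cont i x := by
    rw [h.cont]
    refine exists_congr fun v => and_congr_right fun hv => ?_
    rw [htbl i v hv]
  legal := h.legal
  size i := (h.size i).mono hcap
  time := h.time

/-! ### Update sequences: handles, objects and the peak -/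

namespace Update
variable {α : Type*}

/-- The largest number of objects that have been present. -/
noncomputable def peak : List (Update α) → ℕ
  | [] => 0
  | u :: us => max (objects (u :: us)).ncard (peak us)

theorem peak_le {n : ℕ} : ∀ {us : List (Update α)}, SizeLe n us → peak us ≤ n
  | [], _ => Nat.zero_le _
  | _ :: _, h => max_le h.1 (peak_le h.2)

theorem ncard_le_peak : ∀ us : List (Update α), (objects us).ncard ≤ peak us
  | [] => by simp [objects, table]
  | _ :: _ => le_max_left _ _

theorem injTable : ∀ {us : List (Update α)}, Legal us → InjTable (table us)
  | [], _ => fun _ _ _ h => by simp [table] at h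
  | .insert k x :: us, h => by
    have ih := injTable h.2.2
    intro a b y ha hb
    simp only [table, Function.update_apply] at ha hb
    split_ifs at ha hb with h1 h2 h2
    · rw [h1, h2]
    · exact absurd ⟨b, by rw [hb, ← ha]⟩ h.2.1
    · exact absurd ⟨a, by rw [ha, ← hb]⟩ h.2.1
    · exact ih a b y ha hb
  | .delete k :: us, h => by
    have ih := injTable h.2
    intro a b y ha hb
    simp only [table, Function.update_apply] at ha hb
    split_ifs at ha hb with h1 h2
    exact ih a b y ha hb

theorem objects_eq {us : List (Update α)} {S : Finset ℕ} (hS : ∀ h, h ∈ S ↔ table us h ≠ none) :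
    objects us = objs (table us) S := by
  ext x
  simp only [objects, objs, Set.mem_ofPred_eq]
  refine exists_congr fun h => ⟨fun hx => ⟨(hS h).2 (by rw [hx]; simp), hx⟩, fun hx => hx.2⟩

theorem card_le_of_objects {us : List (Update α)} {S : Finset ℕ}
    (hS : ∀ h, h ∈ S ↔ table us h ≠ none) (X : Finset α) (hX : ∀ x ∈ X, ∃ h, table us h = some x) :
    X.card ≤ S.card := by
  classical
  choose f hf using hX
  refine Finset.card_le_card_of_injOn (fun x => if hx : x ∈ X then f x hx else 0) ?_ ?_
  · intro x hx
    rw [Finset.mem_coe] at hx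
    simp only [hx, dif_pos]
    exact Finset.mem_coe.2 ((hS _).2 (by rw [hf]; simp))
  · intro x hx y hy hxy
    rw [Finset.mem_coe] at hx hy
    simp only [hx, hy, dif_pos] at hxy
    have := hf x hx
    rw [hxy, hf y hy] at this
    exact (Option.some_injective _ this).symm

theorem ncard_objects {us : List (Update α)} (hinj : InjTable (table us)) {S : Finset ℕ}
    (hS : ∀ h, h ∈ S ↔ table us h ≠ none) : (objects us).ncard = S.card := by
  have hex : ∀ h ∈ S, ∃ x, table us h = some x := fun h hh => Option.ne_none_iff_exists'.1 ((hS h).1 hh)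
  choose f hf using hex
  rw [← Set.ncard_coe_finset]
  symm
  refine Set.ncard_congr f (fun h hh => ⟨h, hf h hh⟩) ?_ ?_
  · intro a b ha hb hab
    exact hinj a b _ (hf a ha) (hab ▸ hf b hb)
  · rintro x ⟨h, hx⟩
    have hh : h ∈ S := (hS h).2 (by rw [hx]; simp)
    exact ⟨h, hh, Option.some_injective _ ((hf h hh).symm.trans hx)⟩

end Update

/-! ### The invariants along a sequence of updates -/

section maintain
variable {α P : Type*} {shape : α → Set P} {D : Detector α} {A : StaticAlg α} {ρ c : ℝ} {T : ℕ → ℝ}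
  {R q E : ℕ}

/-- The invariants of the data structure: `j` updates have taken place since the last time that
the cover was rebuilt. -/
structure Maintains (D : Detector α) (shape : α → Set P) (ρ c : ℝ) (T : ℕ → ℝ) (R q E : ℕ)
    (us : List (Update α)) (s : St) (m : Mach α) (t : ℕ) (S C : Finset ℕ) (N j : ℕ) : Prop where
  desc : Describes D (Update.table us) (Update.peak us) s m t
  mem : ∀ h, h ∈ S ↔ Update.table us h ≠ none
  rest : Rest (envOf shape (Update.table us) ρ c T) R N S C s
  slots : Slots (2 * R + 2) N s.reg s.arr S
  nodes : N ≤ Update.peak us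
  count : s.reg 5 = E * j
  fresh : j = 0 ∨ E * j < s.reg 6
  size : C.card ≤ s.reg 6 + j
  base : ∃ o : ℕ, (s.reg 6 : ℝ) ≤ (c + 2 / R + 2 / q) * o ∧ s.reg 6 ≤ 6 * o ∧
    o ≤ vc (envOf shape (Update.table us) ρ c T).adj S + j
  recent : j ≤ us.length
  clock : s.clock ≤ 5000 * (((Update.peak us).size + 1) * (R + 1) ^ 2 * (E + 2)) * (us.length - j) +
    (10 * (Update.peak us).size + 70) * us.length
  ext : ∀ n, Update.peak us ≤ n → (s.ext : ℝ) ≤ 6 * (E + 1) * (T n / n) * (us.length - j : ℕ)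

theorem Maintains.init : Maintains D shape ρ c T R q E [] ⟨0, 0, fun _ => ∅, 0, 0⟩
    (Mach.init α) 0 ∅ ∅ 0 0 where
  desc := ⟨rfl, rfl, by simp, by simp [Mach.init, DetOp.content], fun _ => trivial, fun _ => trivial,
    ∅, fun _ _ => rfl, by simp, by simp⟩
  mem := by simp [Update.table]
  rest := by
    refine ⟨⟨by simp, by simp, by simp, by simp, ?_, ?_, by simp, ?_⟩, ⟨by simp, by simp, by simp⟩,
      ⟨by simp, by simp⟩, by simp⟩
    · intro i hi
      have : i / 2 = 0 := by omega
      simp [this]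
    · intro k _
      simp [auctionSets]
    · intro i k _ _
      simp [auctionSets]
  slots := ⟨by simp, by simp, by simp, by simp⟩
  nodes := le_rfl
  count := by simp
  fresh := Or.inl rfl
  size := by simp
  base := ⟨0, by simp, by simp, by simp⟩
  recent := le_rfl
  clock := by simp
  ext := by simp

theorem envOf_adj_symm {tbl : ℕ → Option α} (u v : ℕ) (h : (envOf shape tbl ρ c T).adj u v) :
    (envOf shape tbl ρ c T).adj v u := by
  obtain ⟨hne, x, y, hx, hy, hxy⟩ := h
  exact ⟨hne.symm, y, x, hy, hx, by rwa [Set.inter_comm]⟩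

theorem envOf_adj_congr {tbl tbl' : ℕ → Option α} {S : Finset ℕ} (h : ∀ v ∈ S, tbl' v = tbl v) :
    ∀ u ∈ S, ∀ v ∈ S, (envOf shape tbl ρ c T).adj u v ↔ (envOf shape tbl' ρ c T).adj u v := by
  intro u hu v hv
  simp only [Env.adj, envOf, meetsOf, h u hu, h v hv]

/-- The invariants after an update with the given outcome. -/
theorem Maintains.next {us us' : List (Update α)} {s s₀ s' : St} {m m' : Mach α} {t t' : ℕ}
    {S S' C C₁ C' : Finset ℕ} {N N' j d : ℕ} {tbl : ℕ → Option α}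
    (h : Maintains D shape ρ c T R q E us s m t S C N j)
    (hmono : ∀ m n : ℕ, 1 ≤ m → m ≤ n → T m / m ≤ T n / n) (hT : ∀ n, 0 ≤ T n)
    (hlen : us'.length = us.length + 1) (hpeak : Update.peak us ≤ Update.peak us')
    (hd : d ≤ (Update.peak us').size) (h5 : s₀.reg 5 = s.reg 5) (h6 : s₀.reg 6 = s.reg 6)
    (hclock : s₀.clock = s.clock) (hext : s₀.ext = s.ext) (hC : C₁.card ≤ C.card + 1)
    (hS' : S'.card ≤ Update.peak us') (hN' : N' ≤ Update.peak us')
    (ho : Outcome (envOf shape tbl ρ c T) R q E N' d S' C₁ s₀ s' C')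
    (hvc : vc (envOf shape (Update.table us) ρ c T).adj S ≤ vc (envOf shape tbl ρ c T).adj S' + 1)
    (hmem : ∀ h, h ∈ S' ↔ Update.table us' h ≠ none)
    (htbl : ∀ v ∈ S', Update.table us' v = tbl v)
    (hdesc : Describes D tbl (Update.peak us') s' m' t') :
    ∃ j', Maintains D shape ρ c T R q E us' s' m' t' S' C' N' j' := by
  have hadj := envOf_adj_congr (shape := shape) (ρ := ρ) (c := c) (T := T) htbl
  have hvceq := vc_congr hadj
  have hdesc' : Describes D (Update.table us') (Update.peak us') s' m' t' := by
    refine hdesc.transfer (fun i v hv => htbl v ?_) le_rfl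
    exact ho.rest.forest.cont_subset (by omega) i hv
  have hrest : Rest (envOf shape (Update.table us') ρ c T) R N' S' C' s' :=
    ⟨ho.rest.forest, ho.rest.cover, ho.rest.isCov.congr fun u hu v hv => (hadj u hu v hv).2,
      ho.rest.zero⟩
  have hsz : (Update.peak us).size ≤ (Update.peak us').size := Nat.size_le_size hpeak
  have hjl := h.recent
  obtain ⟨U, hU⟩ : ∃ U, U = 5000 * (((Update.peak us').size + 1) * (R + 1) ^ 2 * (E + 2)) := ⟨_, rfl⟩
  have hclk : s.clock ≤ U * (us.length - j) + (10 * (Update.peak us').size + 70) * us.length := by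
    refine h.clock.trans (Nat.add_le_add (Nat.mul_le_mul ?_ le_rfl) (Nat.mul_le_mul (by omega) le_rfl))
    rw [hU]
    gcongr
  have hb : (10 * (Update.peak us').size + 70) * us'.length =
      (10 * (Update.peak us').size + 70) * us.length + (10 * (Update.peak us').size + 70) := by
    rw [hlen]; ring
  have hτ : ∀ n, 0 ≤ 6 * ((E : ℝ) + 1) * (T n / n) := fun n => by
    have := hT n
    positivity
  -- Rebuilding costs are charged to the `us.length - j` updates up to the last rebuild. Without a
  -- rebuild this number stays the same; a rebuild is charged to the `j + 1` updates since the
  -- previous one.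
  rcases ho.result with ⟨rfl, k5, hlt, k6, kclock, kext⟩ | ⟨hge, k5, k6, kclock, hcard, hcard6, kext⟩
  · obtain ⟨o, ho1, ho2, ho3⟩ := h.base
    have hk6 : s'.reg 6 = s.reg 6 := by rw [k6, h6]
    have hcnt : s₀.reg 5 + E = E * (j + 1) := by rw [h5, h.count]; ring
    refine ⟨j + 1, hdesc', hmem, hrest, ho.slots, hN', by rw [k5, hcnt], Or.inr ?_, ?_, ⟨o, ?_, ?_, ?_⟩,
      by omega, ?_, ?_⟩
    · rw [← hcnt, k6]; exact hlt
    · rw [hk6]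
      have := h.size
      omega
    · rw [hk6]; exact ho1
    · rw [hk6]; exact ho2
    · rw [← hvceq]; omega
    · have e : us'.length - (j + 1) = us.length - j := by omega
      rw [e, hb, ← hU]
      omega
    · intro n hn
      have e : us'.length - (j + 1) = us.length - j := by omega
      rw [e, kext, hext]
      exact h.ext n (hpeak.trans hn)
  · have hC1 : C₁.card ≤ (E + 1) * (j + 1) := by
      have h1 := h.size
      rw [h5, h.count, h6] at hge
      have : (E + 1) * (j + 1) = E * j + E + j + 1 := by ring
      omega
    have e : us'.length - 0 = (us.length - j) + (j + 1) := by omega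
    refine ⟨0, hdesc', hmem, hrest, ho.slots, hN', by rw [k5]; simp, Or.inl rfl, by omega,
      ⟨vc (envOf shape (Update.table us') ρ c T).adj S', ?_, ?_, by omega⟩, Nat.zero_le _, ?_, ?_⟩
    · rw [k6, ← hvceq]; exact hcard
    · rw [k6, ← hvceq]; exact hcard6
    · have h1 : 5000 * ((d + 1) * (R + 1) ^ 2 * (C₁.card + 1)) ≤ U * (j + 1) := by
        calc _ ≤ 5000 * (((Update.peak us').size + 1) * (R + 1) ^ 2 * ((E + 2) * (j + 1))) := by
              refine Nat.mul_le_mul le_rfl (Nat.mul_le_mul (Nat.mul_le_mul (by omega) le_rfl) ?_)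
              have : (E + 2) * (j + 1) = (E + 1) * (j + 1) + (j + 1) := by ring
              omega
          _ = U * (j + 1) := by rw [hU]; ring
      rw [e, hb, ← hU, mul_add]
      omega
    · intro n hn
      have h1 := h.ext n (hpeak.trans hn)
      rw [e]
      push_cast
      rw [mul_add]
      rcases kext with kext | ⟨l, hl1, hlS, hlC, kext⟩
      · have h2 := hτ n
        have h3 : 0 ≤ 6 * ((E : ℝ) + 1) * (T n / n) * (j + 1) := by positivity
        rw [kext, hext]
        linarith
      -- The static instance has at most `n` vertices, so its time is at most `l` times `T n / n`,
      -- and `l ≤ 6 * |C₁|` is paid for by the `j + 1` updates.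
      · have h2 := hmono l n hl1 (by omega)
        have hl0 : (0 : ℝ) < l := by exact_mod_cast hl1
        have h3 : T l ≤ l * (T n / n) := by
          rw [div_le_iff₀ hl0] at h2
          linarith
        have h4 : (l : ℝ) ≤ 6 * ((E + 1) * (j + 1)) := by
          exact_mod_cast hlC.trans (Nat.mul_le_mul le_rfl hC1)
        have h5 : (0 : ℝ) ≤ T n / n := div_nonneg (hT n) (Nat.cast_nonneg n)
        have h6 := mul_le_mul_of_nonneg_right h4 h5
        have h7 : (envOf shape tbl ρ c T).T l = T l := rfl
        rw [h7, hext] at kext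
        linarith

/-- The data structure processes every legal sequence of updates. -/
theorem exists_maintains {B : ℝ} {τ₀ : ℕ → ℝ} (hR : 0 < R) (hq : 0 < q) (hc : 1 ≤ c)
    (hD : D.Detects shape B τ₀) (hA : A.Approximates shape ρ c T) (hT : ∀ n, 0 ≤ T n)
    (hmono : ∀ m n : ℕ, 1 ≤ m → m ≤ n → T m / m ≤ T n / n)
    (hprom : ∀ W M : ℕ, ∀ o : ℕ, M < q * W → W * R ≤ 2 * o * R + 2 * M → (W : ℝ) ≤ ρ * o) :
    ∀ us : List (Update α), Update.Legal us → ∃ s m t S C N j,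
      Runs D A (program R q E) us m t ∧ Maintains D shape ρ c T R q E us s m t S C N j
  | [], _ => ⟨_, _, _, _, _, _, _, .nil, Maintains.init⟩
  | .insert k x :: us, hleg => by
    obtain ⟨s, m, t, S, C, N, j, hrun, h⟩ :=
      exists_maintains hR hq hc hD hA hT hmono hprom us hleg.2.2
    set us' := Update.insert k x :: us with hus'
    have hinj := Update.injTable hleg
    have hkS : k ∉ S := fun hk => (h.mem k).1 hk hleg.1
    have hmem : ∀ v, v ∈ insert k S ↔ Update.table us' v ≠ none := by
      intro v
      rw [Finset.mem_insert, hus', Update.table]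
      by_cases hv : v = k
      · simp [hv]
      · simp [hv, h.mem]
    have htbl : ∀ v ∈ S, Update.table us' v = Update.table us v := fun v hv => by
      have hvk : v ≠ k := fun hh => hkS (hh ▸ hv)
      rw [hus', Update.table, Function.update_of_ne hvk]
    have hpeak : Update.peak us ≤ Update.peak us' := le_max_right _ _
    have hS' : (insert k S).card ≤ Update.peak us' := by
      rw [← Update.ncard_objects hinj hmem]
      exact Update.ncard_le_peak us'
    have hcardS : (insert k S).card = S.card + 1 := Finset.card_insert_of_notMem hkS
    have hadj := envOf_adj_congr (shape := shape) (ρ := ρ) (c := c) (T := T) htbl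
    -- The binary length of the peak serves as the height of the heap, also after a new node has
    -- been opened.
    have hlt := Nat.lt_size_self (Update.peak us')
    have hnodes := h.nodes
    set s₀ : St := { s with reg := Function.update (Function.update s.reg 0 0) 1 k } with hs₀
    have hdesc : Describes D (Update.table us') (Update.peak us') s₀ ((m.setReg 0 0).setReg 1 k) t := by
      refine Describes.transfer (tbl := Update.table us) (cap := Update.peak us) ?_ (fun i v hv => ?_) hpeak
      · have := h.desc.step (Function.update (Function.update s.reg 0 0) 1 k) s.arr 0 0
        simpa [Mach.setReg, h.desc.reg, h.desc.arr, hs₀] using this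
      · exact htbl v (h.rest.forest.cont_subset (by omega) i hv)
    have hwp : wp (envOf shape (Update.table us') ρ c T) (program R q E)
        (fun s' => ∃ N' C', N' ≤ Update.peak us' ∧ Outcome (envOf shape (Update.table us') ρ c T) R q E N'
          (Update.peak us').size (insert k S) (insert k C) s₀ s' C') s₀ := by
      have e1 : s₀.reg 1 = k := by simp [hs₀]
      refine wp_program_insert (N := N) (S := S) (C := C) (d := (Update.peak us').size)
        ⟨h.rest.forest, by simpa [hs₀] using h.rest.cover,
          h.rest.isCov.congr fun u hu v hv => (hadj u hu v hv).2, h.rest.zero⟩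
        (h.slots.congr (by simp [hs₀]) (by simp [hs₀]) rfl rfl) (by simp [hs₀]) (by rw [e1]; exact hkS)
        (by omega) (by omega) ?_ hR hq hc envOf_adj_symm hprom ?_
      · rw [e1]
        intro v hv
        exact (hmem v).1 (Finset.mem_coe.1 hv)
      · intro s' N' C' hN ho
        rw [e1] at ho
        exact ⟨N', C', by omega, ho⟩
    obtain ⟨s', m', t', hex, hdesc', N', C', hN', ho⟩ := wp_sound hinj
      (fun X hX => (Update.card_le_of_objects hmem X hX).trans hS') hD hA hwp hdesc
    obtain ⟨j', h'⟩ := h.next (s₀ := s₀) hmono hT (by simp [hus']) hpeak le_rfl (by simp [hs₀]) (by simp [hs₀]) rfl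
      rfl (Finset.card_insert_le _ _) hS' hN' ho (by
        rw [vc_congr hadj]
        exact (vc_mono (Finset.subset_insert _ _)).trans (Nat.le_succ _)) hmem (fun _ _ => rfl) hdesc'
    exact ⟨s', m', _, _, C', N', j', .insert k x hrun hex, h'⟩
  | .delete k :: us, hleg => by
    obtain ⟨s, m, t, S, C, N, j, hrun, h⟩ :=
      exists_maintains hR hq hc hD hA hT hmono hprom us hleg.2
    set us' := Update.delete k :: us with hus'
    have hinj := Update.injTable hleg.2
    have hinj' := Update.injTable hleg
    have hkS : k ∈ S := (h.mem k).2 hleg.1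
    have hmem : ∀ v, v ∈ S.erase k ↔ Update.table us' v ≠ none := by
      intro v
      rw [Finset.mem_erase, hus', Update.table]
      by_cases hv : v = k
      · simp [hv]
      · simp [hv, h.mem]
    have htbl : ∀ v ∈ S.erase k, Update.table us' v = Update.table us v := fun v hv => by
      rw [hus', Update.table, Function.update_of_ne (Finset.ne_of_mem_erase hv)]
    have hpeak : Update.peak us ≤ Update.peak us' := le_max_right _ _
    have hS : S.card ≤ Update.peak us := by
      rw [← Update.ncard_objects hinj h.mem]
      exact Update.ncard_le_peak us
    have hS' : (S.erase k).card ≤ Update.peak us' :=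
      (Finset.card_le_card (Finset.erase_subset _ _)).trans (hS.trans hpeak)
    have hlt := Nat.lt_size_self (Update.peak us)
    have hnodes := h.nodes
    set s₀ : St := { s with reg := Function.update (Function.update s.reg 0 1) 1 k } with hs₀
    -- During a deletion the handle still stands for its object, so the program runs in the
    -- environment of `us`. The state is moved to the new table afterwards, when no instance holds
    -- the handle any more.
    have hdesc : Describes D (Update.table us) (Update.peak us) s₀ ((m.setReg 0 1).setReg 1 k) t := by
      have := h.desc.step (Function.update (Function.update s.reg 0 1) 1 k) s.arr 0 0
      simpa [Mach.setReg, h.desc.reg, h.desc.arr, hs₀] using this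
    have hwp : wp (envOf shape (Update.table us) ρ c T) (program R q E)
        (fun s' => ∃ C', Outcome (envOf shape (Update.table us) ρ c T) R q E N
          (Update.peak us).size (S.erase k) (C.erase k) s₀ s' C') s₀ := by
      have e1 : s₀.reg 1 = k := by simp [hs₀]
      refine wp_program_delete (N := N) (S := S) (C := C) (d := (Update.peak us).size)
        ⟨h.rest.forest, by simpa [hs₀] using h.rest.cover, h.rest.isCov, h.rest.zero⟩
        (h.slots.congr (by simp [hs₀]) (by simp [hs₀]) rfl rfl) (by simp [hs₀]) (by rw [e1]; exact hkS)
        (by omega) (fun v hv => (h.mem v).1 (Finset.mem_coe.1 hv)) hR hq hc envOf_adj_symm hprom ?_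
      intro s' C' ho
      rw [e1] at ho
      exact ⟨C', ho⟩
    obtain ⟨s', m', t', hex, hdesc', C', ho⟩ := wp_sound hinj
      (fun X hX => (Update.card_le_of_objects h.mem X hX).trans hS) hD hA hwp hdesc
    obtain ⟨j', h'⟩ := h.next (s₀ := s₀) hmono hT (by simp [hus']) hpeak (Nat.size_le_size hpeak) (by simp [hs₀])
      (by simp [hs₀]) rfl rfl ((Finset.card_le_card (Finset.erase_subset _ _)).trans (Nat.le_succ _))
      hS' (hnodes.trans hpeak) ho (vc_le_erase S k) hmem htbl (hdesc'.transfer (fun _ _ _ => rfl) hpeak)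
    exact ⟨s', m', _, _, C', N, j', .delete k hrun hex, h'⟩

end maintain

namespace Update
variable {α : Type*}

theorem finite_objects : ∀ us : List (Update α), (objects us).Finite
  | [] => by simp [objects, table]
  | .insert k x :: us => by
    refine ((finite_objects us).insert x).subset ?_
    rintro y ⟨h, hy⟩
    simp only [table, Function.update_apply] at hy
    split_ifs at hy
    · exact Or.inl (Option.some_injective _ hy).symm
    · exact Or.inr ⟨h, hy⟩
  | .delete k :: us => by
    refine (finite_objects us).subset ?_
    rintro y ⟨h, hy⟩
    simp only [table, Function.update_apply] at hy
    split_ifs at hy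
    exact ⟨h, hy⟩

/-- The earliest update of a legal sequence is an insertion, since nothing can be deleted from the
empty set. -/
theorem peak_pos : ∀ {us : List (Update α)}, Legal us → us ≠ [] → 1 ≤ peak us ∧ Nonempty α
  | [], _, h => absurd rfl h
  | .insert k x :: us, _, _ => by
    refine ⟨le_max_of_le_left ?_, ⟨x⟩⟩
    exact (Set.ncard_pos (finite_objects _)).2 ⟨x, k, by simp [table]⟩
  | .delete k :: us, h, _ => by
    have hus : us ≠ [] := by
      rintro rfl
      exact h.1 rfl
    obtain ⟨h1, h2⟩ := peak_pos h.2 hus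
    exact ⟨le_max_of_le_right h1, h2⟩

end Update

/-! ### The choice of the constants -/

section constants
variable {c ε δ γ : ℝ} {R q E : ℕ}

/-- With `M < q * W` the additive error becomes a multiplicative one: `W * (1 - κ) ≤ 2 * o`, where
`κ = 4 * γ / a` is an upper bound for `2 * q / R`. The constant `a = 16 / K + 2` makes `κ` at most
`1 / 2` and at most `K * γ / 4`, so that `(2 + K * γ) * (1 - κ) ≥ 2`. -/
theorem promise_of_mass {K : ℝ} (hK : 0 < K) (hδ : 0 < δ) (hγδ : δ < γ) (hγ : γ < 1 / 4)
    (hR : (16 / K + 2) / δ ≤ R) (hq : (q : ℝ) ≤ 2 * (γ / δ)) (W M o : ℕ) (hM : M < q * W)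
    (h : W * R ≤ 2 * o * R + 2 * M) : (W : ℝ) ≤ (2 + K * γ) * o := by
  have hγ0 : 0 < γ := hδ.trans hγδ
  have h' : (W : ℝ) * R ≤ 2 * o * R + 2 * (q * W) := by
    have : W * R ≤ 2 * o * R + 2 * (q * W) := h.trans (by omega)
    exact_mod_cast this
  have ha : 0 < 16 / K + 2 := by positivity
  set a := 16 / K + 2 with ha'
  have hRpos : (0 : ℝ) < R := lt_of_lt_of_le (by positivity) hR
  have hκ : 2 * (q : ℝ) ≤ 4 * γ / a * R := by
    rw [div_le_iff₀ hδ] at hR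
    calc 2 * (q : ℝ) ≤ 4 * γ / a * (a / δ) := by
          rw [div_mul_div_comm, mul_comm a δ, mul_div_mul_right _ _ ha.ne']
          calc 2 * (q : ℝ) ≤ 2 * (2 * (γ / δ)) := by linarith
            _ = 4 * γ / δ := by ring
      _ ≤ 4 * γ / a * R := by
          refine mul_le_mul_of_nonneg_left ?_ (by positivity)
          rwa [div_le_iff₀ hδ]
  set κ := 4 * γ / a with hκ'
  have h1 : κ ≤ 1 / 2 := by
    rw [hκ', div_le_iff₀ ha]
    have : 0 < 16 / K := by positivity
    linarith
  have h2 : κ ≤ K * γ / 4 := by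
    rw [hκ', div_le_iff₀ ha, ha']
    have e : K * γ / 4 * (16 / K + 2) = 4 * γ + K * γ / 2 := by
      field_simp
      ring
    rw [e]
    have : 0 < K * γ := by positivity
    linarith
  have h3 : (W : ℝ) * (1 - κ) ≤ 2 * o := by
    have h4 : 2 * ((q : ℝ) * W) ≤ κ * R * W := by
      have := mul_le_mul_of_nonneg_right hκ (Nat.cast_nonneg W : (0 : ℝ) ≤ W)
      linarith
    have h5 : (W * (1 - κ)) * R ≤ 2 * o * R := by
      have : (W * (1 - κ)) * R = W * R - κ * R * W := by ring
      linarith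
    exact le_of_mul_le_mul_right h5 hRpos
  have h6 : 2 ≤ (2 + K * γ) * (1 - κ) := by
    have h7 : K * γ * κ ≤ K * γ * (1 / 2) := mul_le_mul_of_nonneg_left h1 (by positivity)
    have e : (2 + K * γ) * (1 - κ) = 2 + K * γ - 2 * κ - K * γ * κ := by ring
    linarith
  have h8 : 2 * (o : ℝ) ≤ (2 + K * γ) * o * (1 - κ) := by
    have := mul_le_mul_of_nonneg_right h6 (Nat.cast_nonneg o : (0 : ℝ) ≤ o)
    linarith
  exact le_of_mul_le_mul_right (h3.trans h8) (by linarith)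

/-- Here `b` and `o` are the size of the last rebuilt cover and the optimum at that time, `k` and
`v` the current ones, and `j` counts the updates in between. From `E * j ≤ 6 * o` and `12 ≤ E`
follows `j ≤ o / 2`, hence `o ≤ 2 * v` and `j ≤ (12 / E) * v ≤ ε * v`. Moreover `2 / R` and `2 / q`
are `O(δ / γ)`, and `δ / γ ≤ √(δ / γ)`. -/
theorem ratio_le (hc : 1 ≤ c) (hε : 0 < ε) (hδ : 0 < δ) (hγδ : δ < γ) (hγ : γ < 1 / 4)
    (hR : 2 / δ ≤ R) (hq : γ / δ ≤ q) (hE : 12 / ε ≤ E) (hE12 : 12 ≤ E) {k b o j v : ℕ}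
    (hk : k ≤ b + j) (hb : (b : ℝ) ≤ (c + 2 / R + 2 / q) * o) (hb6 : b ≤ 6 * o) (ho : o ≤ v + j)
    (hj : j = 0 ∨ E * j < b) : (k : ℝ) ≤ c * (1 + 6 * (√(δ / γ) + ε)) * v := by
  have hγ0 : 0 < γ := hδ.trans hγδ
  have hR0 : (0 : ℝ) < R := lt_of_lt_of_le (by positivity) hR
  have hq0 : (0 : ℝ) < q := lt_of_lt_of_le (by positivity) hq
  have hE0 : (0 : ℝ) < E := lt_of_lt_of_le (by positivity) hE
  have hx0 : 0 < δ / γ := by positivity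
  have hx1 : δ / γ ≤ 1 := (div_le_one hγ0).2 hγδ.le
  have hs : δ / γ ≤ √(δ / γ) := Real.le_sqrt_of_sq_le (by nlinarith)
  have hR' : 2 / (R : ℝ) ≤ δ / γ := by
    rw [div_le_iff₀ hR0]
    have h1 : δ ≤ δ / γ := by
      rw [le_div_iff₀ hγ0]
      nlinarith
    rw [div_le_iff₀ hδ] at hR
    nlinarith
  have hq' : 2 / (q : ℝ) ≤ 2 * (δ / γ) := by
    rw [div_le_iff₀ hq0]
    have h1 := mul_le_mul_of_nonneg_left hq hx0.le
    have h2 : δ / γ * (γ / δ) = 1 := by field_simp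
    linarith
  have hE' : 12 / (E : ℝ) ≤ ε := by
    rw [div_le_iff₀ hE0]
    rw [div_le_iff₀ hε] at hE
    linarith
  have hjE : E * j ≤ 6 * o := by
    rcases hj with rfl | hj
    · simp
    · omega
  have hj12 : 12 * j ≤ 6 * o := (Nat.mul_le_mul_right j hE12).trans hjE
  have hjv : E * j ≤ 12 * v := by omega
  have hjv' : (j : ℝ) ≤ ε * v := by
    have h1 : (E : ℝ) * j ≤ 12 * v := by exact_mod_cast hjv
    have h2 : (j : ℝ) ≤ 12 / E * v := by
      rw [div_mul_eq_mul_div, le_div_iff₀ hE0]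
      linarith
    exact h2.trans (mul_le_mul_of_nonneg_right hE' (Nat.cast_nonneg v))
  have hk' : (k : ℝ) ≤ b + j := by exact_mod_cast hk
  have ho' : (o : ℝ) ≤ v + j := by exact_mod_cast ho
  have hv0 : (0 : ℝ) ≤ v := Nat.cast_nonneg v
  have hj0 : (0 : ℝ) ≤ j := Nat.cast_nonneg j
  set r := c + 2 / R + 2 / q with hr
  have hr1 : r ≤ c * (1 + 3 * (δ / γ)) := by nlinarith
  have hr0 : 0 ≤ r := by positivity
  have hr5 : r + 1 ≤ 6 * c := by nlinarith
  have h1 : (k : ℝ) ≤ r * v + (r + 1) * j := by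
    have := mul_le_mul_of_nonneg_left ho' hr0
    linarith
  have h2 : (r + 1) * (j : ℝ) ≤ 6 * c * (ε * v) := mul_le_mul hr5 hjv' hj0 (by positivity)
  have h3 : r * v ≤ c * (1 + 3 * (δ / γ)) * v := mul_le_mul_of_nonneg_right hr1 hv0
  have h4 : c * (δ / γ) * v ≤ c * √(δ / γ) * v := by gcongr
  have h5 : 0 ≤ c * √(δ / γ) * v := by positivity
  linarith

/-- The binary length exceeds the base-two logarithm by at most one, and `log (n + 2) ≥ log 3 > 1`
absorbs the constants. -/
theorem size_le_log {n : ℕ} (hn : 1 ≤ n) :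
    1 ≤ Real.log (n + 2) ∧ ((n.size : ℝ) + 1) ≤ 4 * Real.log (n + 2) := by
  have hn' : (1 : ℝ) ≤ n := by exact_mod_cast hn
  have h1 : 1 ≤ Real.log (n + 2) := by
    rw [Real.le_log_iff_exp_le (by linarith)]
    have := Real.exp_one_lt_d9
    linarith
  refine ⟨h1, ?_⟩
  have h2 : 2 ^ (n.size - 1) ≤ n := Nat.lt_size.1 (by have := Nat.size_pos.2 hn; omega)
  have h3 : ((n.size - 1 : ℕ) : ℝ) * Real.log 2 ≤ Real.log (n + 2) := by
    rw [← Real.log_pow]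
    refine Real.log_le_log (by positivity) ?_
    have : ((2 ^ (n.size - 1) : ℕ) : ℝ) ≤ n := by exact_mod_cast h2
    push_cast at this
    linarith
  have h4 : (n.size : ℝ) ≤ ((n.size - 1 : ℕ) : ℝ) + 1 := by
    have : n.size ≤ (n.size - 1) + 1 := by omega
    exact_mod_cast this
  have h5 := Real.log_two_gt_d9
  have h6 : (0 : ℝ) ≤ ((n.size - 1 : ℕ) : ℝ) := Nat.cast_nonneg _
  nlinarith

/-- The first summand is the share of an update in the rebuilds, with `R = O(1 / δ)` and `E = O(1 /
ε)`; the second is its own cost, which fits under the same bound because `δ ^ 2 * ε ≤ 1`. -/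
theorem clock_le {a : ℝ} (ha : 2 ≤ a) (hε : 0 < ε) (hε1 : ε ≤ 1) (hδ : 0 < δ) (hδ1 : δ ≤ 1)
    (hR : (R : ℝ) ≤ a / δ + 1) (hE : (E : ℝ) ≤ 12 / ε + 1) {n p : ℕ} (hp : p ≤ n) (hn : 1 ≤ n) :
    ((5000 * ((p.size + 1) * (R + 1) ^ 2 * (E + 2)) + (10 * p.size + 70) : ℕ) : ℝ) ≤
      (300000 * (a + 2) ^ 2 + 110) * Real.log (n + 2) / (δ ^ 2 * ε) := by
  obtain ⟨hL, hsz⟩ := size_le_log hn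
  set L := Real.log (n + 2)
  have hps : (p.size : ℝ) + 1 ≤ 4 * L := by
    have : (p.size : ℝ) ≤ n.size := by exact_mod_cast Nat.size_le_size hp
    linarith
  have hR' : (R : ℝ) + 1 ≤ (a + 2) / δ := by
    rw [add_div]
    have : 2 ≤ 2 / δ := by rw [le_div_iff₀ hδ]; linarith
    linarith
  have hE' : (E : ℝ) + 2 ≤ 15 / ε := by
    have h1 : 3 ≤ 3 / ε := by rw [le_div_iff₀ hε]; linarith
    have h2 : 15 / ε = 12 / ε + 3 / ε := by ring
    linarith
  have h1 : ((p.size : ℝ) + 1) * (R + 1) ^ 2 * (E + 2) ≤ 4 * L * ((a + 2) / δ) ^ 2 * (15 / ε) := by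
    gcongr
  have h2 : 10 * (p.size : ℝ) + 70 ≤ 110 * L / (δ ^ 2 * ε) := by
    have hd : δ ^ 2 * ε ≤ 1 := mul_le_one₀ (pow_le_one₀ hδ.le hδ1) hε.le hε1
    have h3 : 110 * L ≤ 110 * L / (δ ^ 2 * ε) := by
      rw [le_div_iff₀ (by positivity)]
      nlinarith
    linarith
  push_cast
  calc _ ≤ 5000 * (4 * L * ((a + 2) / δ) ^ 2 * (15 / ε)) + 110 * L / (δ ^ 2 * ε) := by linarith
    _ = _ := by
      field_simp
      ring

end constants

/-! ### From the invariants to the theorem -/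

theorem Maintains.holdsCover {α P : Type*} {shape : α → Set P} {D : Detector α} {ρ c : ℝ}
    {T : ℕ → ℝ} {R q E : ℕ} {us : List (Update α)} {s : St} {m : Mach α} {t : ℕ} {S C : Finset ℕ}
    {N j : ℕ} (hleg : Update.Legal us) (h : Maintains D shape ρ c T R q E us s m t S C N j) {r : ℝ}
    (hr : (C.card : ℝ) ≤ r * vc (envOf shape (Update.table us) ρ c T).adj S) :
    HoldsCover shape us m r := by
  have hinj := Update.injTable hleg
  have hcov := h.rest.cover
  rw [HoldsCover, h.desc.reg, h.desc.arr, Update.objects_eq h.mem, minCover_eq_vc hinj (ρ := ρ)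
    (c := c) (T := T)]
  refine ⟨fun i hi => ?_, ?_, by rwa [← hcov.card]⟩
  · exact (h.mem _).1 (h.rest.isCov.1 (hcov.idx i hi).1)
  · have hidx : ∀ u ∈ C, ∃ i < s.reg 2, s.arr 0 i = u := fun u hu => by
      obtain ⟨h1, h2, h3⟩ := hcov.pos u hu
      exact ⟨s.arr 1 u - 1, by omega, h3⟩
    rintro ⟨x, u, hu, hx⟩ ⟨y, v, hv, hy⟩ ⟨hne, hxy⟩
    have huv : u ≠ v := by
      rintro rfl
      exact hne (Subtype.ext (Option.some_injective _ (hx.symm.trans hy)))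
    rcases h.rest.isCov.2 u hu v hv ⟨huv, x, y, hx, hy, hxy⟩ with hC | hC
    · obtain ⟨i, hi, e⟩ := hidx u hC
      exact Or.inl ⟨i, hi, by rw [e]; exact hx⟩
    · obtain ⟨i, hi, e⟩ := hidx v hC
      exact Or.inr ⟨i, hi, by rw [e]; exact hy⟩

/-- An operation takes at least one time unit, so a single query shows `1 ≤ B * τ₀ n`. The clock
bounds both the number of instructions and the number of oracle operations, which explains the
factor two. -/
theorem Maintains.time_le {α P : Type*} {shape : α → Set P} {D : Detector α} {ρ c B : ℝ}
    {τ₀ T : ℕ → ℝ} {R q E : ℕ} {us : List (Update α)} {s : St} {m : Mach α} {t : ℕ} {S C : Finset ℕ}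
    {N j : ℕ} (hD : D.Detects shape B τ₀) (h : Maintains D shape ρ c T R q E us s m t S C N j)
    [Nonempty α] {n : ℕ} (hn : Update.peak us ≤ n) :
    0 ≤ B * τ₀ n ∧ (t : ℝ) ≤ 2 * (B * τ₀ n) * s.clock + s.ext := by
  obtain ⟨x⟩ := ‹Nonempty α›
  have h1 : 1 ≤ B * τ₀ n := by
    have h2 := hD.2.2 n [.query x] trivial ⟨by simp [DetOp.content], trivial⟩
    have h3 : (1 : ℝ) ≤ D.totalTime [.query x] := by
      exact_mod_cast (hD.2.1 [] (.query x)).trans (Nat.le_add_right _ _)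
    simp only [List.length_singleton, Nat.cast_one, mul_one] at h2
    linarith
  refine ⟨by linarith, ?_⟩
  obtain ⟨I, -, ht, hl⟩ := h.desc.time
  have ht' : (t : ℝ) ≤ s.clock + s.ext + ∑ i ∈ I, (D.totalTime (m.hist i) : ℝ) := by exact_mod_cast ht
  have hl' : ∑ i ∈ I, ((m.hist i).length : ℝ) ≤ s.clock := by exact_mod_cast hl
  -- The amortized guarantee is applied to the whole history of each instance, none of which ever
  -- stored more than `n` objects.
  have h2 : ∑ i ∈ I, (D.totalTime (m.hist i) : ℝ) ≤ B * τ₀ n * ∑ i ∈ I, ((m.hist i).length : ℝ) := by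
    rw [Finset.mul_sum]
    exact Finset.sum_le_sum fun i _ => hD.2.2 n _ (h.desc.legal i) ((h.desc.size i).mono hn)
  have h3 := mul_le_mul_of_nonneg_left hl' (by linarith : 0 ≤ B * τ₀ n)
  have h4 := mul_le_mul_of_nonneg_right h1 (Nat.cast_nonneg s.clock : (0 : ℝ) ≤ s.clock)
  linarith

/-- `K`, `B` and `Δ` are the constants hidden in the hypotheses: in the promise
`n ≤ (2 + O(γ)) OPT`, in the time `O(τ₀ n)` of the detection structure, and in `T (2n) = O(T n)`.
The degree `k` of the polylogarithmic factor is absolute, the constant `C₁` in the approximation ratio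
depends only on `K`, and the constant `C₂` in the time bound only on `K`, `B`, `Δ`.  The oracles are
used as black boxes: the program depends only on these constants and on `c`, `ε`, `δ`, `γ`. -/
theorem theorem4p4 :
    ∃ k : ℕ, ∀ K : ℝ, 0 < K → ∃ C₁ : ℝ, 0 < C₁ ∧ ∀ B Δ : ℝ, 0 < B → 0 < Δ → ∃ C₂ : ℝ, 0 < C₂ ∧
    ∀ c ε δ γ : ℝ, 1 ≤ c → 0 < ε → ε ≤ 1 → 0 < δ → δ < γ → γ < 1 / 4 →
    ∃ prog : Prog,
    ∀ (α : Type*) (P : Type*) (shape : α → Set P) (τ₀ T : ℕ → ℝ)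
      (D : Detector α) (A : StaticAlg α),
      D.Detects shape B τ₀ →
      A.Approximates shape (2 + K * γ) c T →
      (∀ n, 0 ≤ T n) →
      (∀ m n : ℕ, 1 ≤ m → m ≤ n → T m / m ≤ T n / n) →
      (∀ n : ℕ, 1 ≤ n → T (2 * n) ≤ Δ * T n) →
      ∀ us : List (Update α), Update.Legal us →
        ∃ (m : Mach α) (t : ℕ), Runs D A prog us m t ∧
          HoldsCover shape us m (c * (1 + C₁ * (Real.sqrt (δ / γ) + ε))) ∧
          ∀ n : ℕ, Update.SizeLe n us →
            (t : ℝ) ≤ C₂ * us.length * Real.log (n + 2) ^ k *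
              (τ₀ n / (δ ^ 2 * ε) + T n / (ε * n)) := by
  -- A single logarithm suffices; it comes from the height of the heap. The constant `6` is that of
  -- `ratio_le`.
  refine ⟨1, fun K hK => ⟨6, by norm_num, fun B Δ hB _ => ?_⟩⟩
  have ha : 2 ≤ 16 / K + 2 := by
    have : 0 < 16 / K := by positivity
    linarith
  obtain ⟨a, haK⟩ : ∃ a, a = 16 / K + 2 := ⟨_, rfl⟩
  rw [← haK] at ha
  -- The first part is `2 * B` times the constant of `clock_le`, and `90` pays for the static
  -- algorithm, as `6 * (E + 1) ≤ 90 / ε`.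
  refine ⟨2 * B * (300000 * (a + 2) ^ 2 + 110) + 90, by positivity, ?_⟩
  intro c ε δ γ hc hε hε1 hδ hγδ hγ
  have hγ0 : 0 < γ := hδ.trans hγδ
  -- The parameters of the program: `a / δ` for `R`, `γ / δ` for `q` and `12 / ε` for `E`, rounded
  -- up. The approximation ratio needs all three to be large, the running time needs `R` and `E` not
  -- too large, and the promise limits `q` from above.
  have hR1 : a / δ ≤ ⌈a / δ⌉₊ := Nat.le_ceil _
  have hR2 : (⌈a / δ⌉₊ : ℝ) ≤ a / δ + 1 := (Nat.ceil_lt_add_one (by positivity)).le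
  have hq1 : γ / δ ≤ ⌈γ / δ⌉₊ := Nat.le_ceil _
  have hq2 : (⌈γ / δ⌉₊ : ℝ) ≤ 2 * (γ / δ) := by
    have h1 := (Nat.ceil_lt_add_one (div_nonneg hγ0.le hδ.le)).le
    have h2 : 1 ≤ γ / δ := by rw [le_div_iff₀ hδ]; linarith
    linarith
  have hE1 : 12 / ε ≤ ⌈12 / ε⌉₊ := Nat.le_ceil _
  have hE2 : (⌈12 / ε⌉₊ : ℝ) ≤ 12 / ε + 1 := (Nat.ceil_lt_add_one (by positivity)).le
  have hR0 : 0 < ⌈a / δ⌉₊ := Nat.ceil_pos.2 (by positivity)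
  have hq0 : 0 < ⌈γ / δ⌉₊ := Nat.ceil_pos.2 (by positivity)
  have hE12 : 12 ≤ ⌈12 / ε⌉₊ := by
    have h1 : (12 : ℝ) ≤ 12 / ε := by rw [le_div_iff₀ hε]; linarith
    exact_mod_cast h1.trans hE1
  generalize ⌈a / δ⌉₊ = R at hR1 hR2 hR0
  generalize ⌈γ / δ⌉₊ = q at hq1 hq2 hq0
  generalize ⌈12 / ε⌉₊ = E at hE1 hE2 hE12
  refine ⟨program R q E, ?_⟩
  intro α P shape τ₀ T D A hD hA hT hmono _ us hleg
  obtain ⟨s, m, t, S, C, N, j, hrun, h⟩ := exists_maintains hR0 hq0 hc hD hA hT hmono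
    (promise_of_mass hK hδ hγδ hγ (haK ▸ hR1) hq2) us hleg
  have hR2' : 2 / δ ≤ R := le_trans (by gcongr) hR1
  obtain ⟨o, ho1, ho2, ho3⟩ := h.base
  refine ⟨m, t, hrun, h.holdsCover hleg
    (ratio_le hc hε hδ hγδ hγ hR2' hq1 hE1 hE12 h.size ho1 ho2 ho3 h.fresh), fun n hn => ?_⟩
  -- The empty sequence is treated apart: then `n` may be zero, and there may be no object whose
  -- query shows `1 ≤ B * τ₀ n`.
  rcases eq_or_ne us [] with rfl | hne
  · cases hrun
    simp
  obtain ⟨hpos, hα⟩ := Update.peak_pos hleg hne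
  have hpn := Update.peak_le hn
  have hn1 := hpos.trans hpn
  obtain ⟨hL, -⟩ := size_le_log hn1
  obtain ⟨hBτ, ht⟩ := h.time_le hD hpn
  have hclk := clock_le ha hε hε1 hδ (by linarith) hR2 hE2 hpn hn1
  have hext := h.ext n hpn
  have hclock : (s.clock : ℝ) ≤ (300000 * (a + 2) ^ 2 + 110) * Real.log (n + 2) / (δ ^ 2 * ε) *
      us.length := by
    refine le_trans ?_ (mul_le_mul_of_nonneg_right hclk (Nat.cast_nonneg _))
    have h1 := h.clock.trans (Nat.add_le_add_right (Nat.mul_le_mul_left _ (Nat.sub_le _ j)) _)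
    rw [← add_mul] at h1
    exact_mod_cast h1
  have hTn : 0 ≤ T n / n := div_nonneg (hT n) (Nat.cast_nonneg n)
  have hτ : 0 ≤ τ₀ n := nonneg_of_mul_nonneg_right hBτ hB
  generalize Real.log (n + 2) = L at hL hclock ⊢
  have hlen : (0 : ℝ) ≤ us.length := Nat.cast_nonneg _
  have hext' : (s.ext : ℝ) ≤ 90 / ε * (T n / n) * us.length * L := by
    have h1 : 6 * ((E : ℝ) + 1) ≤ 90 / ε := by
      have h2 : 2 ≤ 2 / ε := by rw [le_div_iff₀ hε]; linarith
      have h3 : 90 / ε = 72 / ε + 9 * (2 / ε) := by ring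
      have h4 : 6 * (12 / ε) = 72 / ε := by ring
      linarith
    calc (s.ext : ℝ) ≤ 6 * (E + 1) * (T n / n) * (us.length - j : ℕ) := hext
      _ ≤ 90 / ε * (T n / n) * us.length := by
        have : ((us.length - j : ℕ) : ℝ) ≤ us.length := by exact_mod_cast Nat.sub_le _ _
        gcongr
      _ ≤ _ := le_mul_of_one_le_right (by positivity) hL
  have hA0 : 0 ≤ us.length * L * (τ₀ n / (δ ^ 2 * ε)) := by positivity
  have hB0 : 0 ≤ us.length * L * (T n / (ε * n)) := by
    have e : T n / (ε * n) = T n / n / ε := by rw [mul_comm, div_mul_eq_div_div]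
    rw [e]
    positivity
  set G := 300000 * (a + 2) ^ 2 + 110 with hG
  have hG0 : 0 ≤ G := by positivity
  calc (t : ℝ) ≤ 2 * (B * τ₀ n) * s.clock + s.ext := ht
    _ ≤ 2 * (B * τ₀ n) * (G * L / (δ ^ 2 * ε) * us.length) + 90 / ε * (T n / n) * us.length * L := by
      gcongr
    _ = 2 * B * G * (us.length * L * (τ₀ n / (δ ^ 2 * ε))) + 90 * (us.length * L * (T n / (ε * n))) := by
      rw [mul_comm ε (n : ℝ), div_mul_eq_div_div]
      ring
    _ ≤ (2 * B * G + 90) * (us.length * L * (τ₀ n / (δ ^ 2 * ε))) +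
        (2 * B * G + 90) * (us.length * L * (T n / (ε * n))) := by
      have h1 : 0 ≤ 2 * B * G := by positivity
      gcongr
      · linarith
      · linarith
    _ = _ := by ring
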